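/- Let $M$ be a connected (Hausdorff, second countable, boundaryless) smooth manifold of dimension $n\ge 0$, and let $S=M\times\mathbb C^2$ be the trivial Hermitian bundle. Let $\mathcal A$ be the set of smooth $SU(2)$-connections $\nabla=d+A$ on $S$, where $A$ is a smooth $\mathfrak{su}(2)$-valued one-form. Let $\mu$ be a smooth positive measure on $M$ (for example a Riemannian volume measure). The half density $\sqrt\mu$ identifies $H=L^2(M,\Omega^{1/2}\otimes S)$ with $L^2(M,\mu;\mathbb C^2)$. For a smooth complete vector field $X$ with flow $\exp_t(X)$ and a unitary connection $\nabla$ on $S$, or on a smooth subbundle of $S$, put $$(e^X_\nabla\xi)(m)=\sqrt{\tfrac{d(\exp_1(X)^*\mu)}{d\mu}(m)}\;\mathrm{Hol}(\gamma_m,\nabla)\,\xi(\exp_1(X)(m)),\qquad \gamma_m(t)=\exp_{1-t}(X)(m),\ t\in[0,1],$$ where $(\exp_1(X)^*\mu)(B)=\mu(\exp_1(X)(B))$ and $\mathrm{Hol}(\gamma_m,\nabla)$ is parallel transport along $\gamma_m$ from $\exp_1(X)(m)$ to $m$. For $f\in C_c^\infty(M)$ let $fe^X$ be the operator valued function $\nabla\mapsto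 fe^X_\nabla$ on $\mathcal A$. The holonomy-diffeomorphism algebra $\mathbf{HD}(M,S,\mathcal A)$ is the $C^*$-algebra generated by the span of all $fe^X$ in the $C^*$-algebra of bounded functions $\mathcal A\to\mathcal B(H)$ with the supremum norm. For $\nabla\in\mathcal A$ let $\varphi_\nabla:\mathbf{HD}(M,S,\mathcal A)\to\mathcal B(H)$ be evaluation at $\nabla$, so that $\varphi_\nabla(fe^X)=fe^X_\nabla$. A representation is called irreducible if its Hilbert space is nonzero and has no closed invariant subspaces other than $0$ and the whole space. **Proposition.** Let $\nabla\in\mathcal A$ and $m\in M$. 1. The representation $\varphi_\nabla$ is irreducible if and only if $\nabla$ is irreducible, that is, if and only if the holonomy group of $\nabla$ at $m$ (the parallel transports around piecewise smooth loops at $m$) acts irreducibly on the fibre $\mathbb C^2$ over $m$. 2. If $\nabla$ is reducible (not irreducible), then $\varphi_\nabla$ is the direct sum of two irreducible representations that come from $U(1)$-connections: there are an orthogonal decomposition $S=L_1\oplus L_2$ into smooth complex line subbundles, smooth unitary connections $\nabla_i$ on $L_i$, and irreducible $*$-representations $\pi_i$ of $\mathbf{HD}(M,S,\mathcal A)$ on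 $L^2(M,\Omega^{1/2}\otimes L_i)$ with $\pi_i(fe^X)=fe^X_{\nabla_i}$ for all $f\in C_c^\infty(M)$ and all complete $X$, such that $H=L^2(M,\Omega^{1/2}\otimes L_1)\oplus L^2(M,\Omega^{1/2}\otimes L_2)$ orthogonally and $\varphi_\nabla(a)=\pi_1(a)\oplus\pi_2(a)$ for all $a\in\mathbf{HD}(M,S,\mathcal A)$. -/

import Mathlib

open MeasureTheory Set
open scoped Manifold ContDiff ENNReal

noncomputable section

namespace HolDiff

/-- The fibre `ℂ²`, with its standard Hermitian inner product. -/
abbrev Fibre : Type := EuclideanSpace ℂ (Fin 2)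

/-- Endomorphisms of the fibre (2 × 2 complex matrices). -/
abbrev EndFibre : Type := Fibre →L[ℂ] Fibre

/-! ### Irreducible families of operators -/

/-- A family of maps acts irreducibly on a (nonzero) Hilbert space if `0` and the whole space are
the only closed subspaces that are invariant under it. -/
def ActsIrreducibly {H : Type*} [NormedAddCommGroup H] [InnerProductSpace ℂ H]
    (T : Set (H → H)) : Prop :=
  Nontrivial H ∧ ∀ K : Submodule ℂ H, IsClosed (K : Set H) →
    (∀ g ∈ T, ∀ x ∈ K, g x ∈ K) → K = ⊥ ∨ K = ⊤

/-- Irreducibility of a `*`-representation `π : A → B(H)`. -/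
def IsIrreducibleRep {A : Type*} [NonUnitalNonAssocSemiring A] [Module ℂ A] [Star A]
    {H : Type*} [NormedAddCommGroup H] [InnerProductSpace ℂ H] [CompleteSpace H]
    (π : A →⋆ₙₐ[ℂ] (H →L[ℂ] H)) : Prop :=
  ActsIrreducibly (Set.range fun a : A => (π a : H → H))

/-- The C*-algebra of bounded functions from a set `𝒜` to the bounded operators on a Hilbert space,
with the pointwise operations and the supremum norm. -/
abbrev BoundedOperatorFunctions (𝒜 H : Type*) [NormedAddCommGroup H] [InnerProductSpace ℂ H] :
    Type _ :=
  lp (fun _ : 𝒜 => H →L[ℂ] H) ∞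

/-- The C*-subalgebra generated by a set of bounded operator valued functions: the norm closure of
the `*`-algebra generated by it. -/
def generatedCStarAlgebra {𝒜 H : Type*} [NormedAddCommGroup H] [InnerProductSpace ℂ H]
    [CompleteSpace H] (C : Set (BoundedOperatorFunctions 𝒜 H)) :
    NonUnitalStarSubalgebra ℂ (BoundedOperatorFunctions 𝒜 H) :=
  (NonUnitalStarAlgebra.adjoin ℂ C).topologicalClosure

section Geometry

variable (n : ℕ) (M : Type*) [TopologicalSpace M] [ChartedSpace (EuclideanSpace ℝ (Fin n)) M]

/-! ### Smooth positive measures -/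

/-- `μ` is a smooth positive measure (a nowhere vanishing smooth density): in every smooth chart it
is a smooth positive function times Lebesgue measure. Volume measures of Riemannian metrics are of
this kind. -/
def IsSmoothPositiveMeasure [MeasurableSpace M] (μ : Measure M) : Prop :=
  ∀ e ∈ IsManifold.maximalAtlas (𝓡 n) ∞ M, ∃ ρ : EuclideanSpace ℝ (Fin n) → ℝ,
    ContDiffOn ℝ ∞ ρ e.target ∧ (∀ x ∈ e.target, 0 < ρ x) ∧
    (μ.restrict e.source).map e =
      (volume.restrict e.target).withDensity fun x => ENNReal.ofReal (ρ x)

/-! ### Exponentiable vector fields -/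

/-- An exponentiable vector field: a smooth vector field all of whose integral curves exist for all
times. -/
structure ExpVectorField [IsManifold (𝓡 n) ∞ M] where
  toFun : ∀ m : M, TangentSpace (𝓡 n) m
  smooth : ContMDiff (𝓡 n) (𝓡 n).tangent ∞ fun m => (⟨m, toFun m⟩ : TangentBundle (𝓡 n) M)
  complete : ∀ m : M, ∃ c : ℝ → M, c 0 = m ∧ IsMIntegralCurve (I := 𝓡 n) c toFun

/-! ### Hermitian bundles -/

/-- A smooth (Hermitian) subbundle of the trivial bundle `M × ℂ²`, given by the orthogonal
projections onto its fibres; the fibre over `m` is the range of `proj m`. -/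
structure Subbundle where
  proj : M → EndFibre
  smooth : ContMDiff (𝓡 n) 𝓘(ℝ, EndFibre) ∞ proj
  isStarProjection : ∀ m, IsStarProjection (proj m)

/-- The trivial bundle `S = M × ℂ²`. -/
def trivialBundle : Subbundle n M where
  proj := fun _ => 1
  smooth := contMDiff_const
  isStarProjection := fun _ => IsStarProjection.one EndFibre

variable {n M}

/-- The subbundle is a line bundle. -/
def Subbundle.IsLineBundle (L : Subbundle n M) : Prop :=
  ∀ m, Module.finrank ℂ (L.proj m).range = 1

/-! ### Square integrable half densities -/

section L2

variable [MeasurableSpace M] (μ : Measure M)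

/-- The Hilbert space `L²(M, Ω^{1/2} ⊗ S)`. The half density `√μ` of a smooth positive measure `μ`
trivializes `Ω^{1/2}`; in this trivialization the space is `L²(M, μ; ℂ²)`. -/
abbrev L2 : Type _ := Lp Fibre 2 μ

/-- The Hilbert space `L²(M, Ω^{1/2} ⊗ L)` of a subbundle `L`, as a subspace of
`L²(M, Ω^{1/2} ⊗ S)`. -/
def L2Sections (L : Subbundle n M) : Submodule ℂ (L2 μ) where
  carrier := {ξ | ∀ᵐ m ∂μ, L.proj m (ξ m) = ξ m}
  add_mem' := by
    intro ξ η hξ hη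
    filter_upwards [hξ, hη, Lp.coeFn_add ξ η] with m h1 h2 h3
    rw [h3, Pi.add_apply, map_add, h1, h2]
  zero_mem' := by
    filter_upwards [Lp.coeFn_zero Fibre 2 μ] with m h
    rw [h, Pi.zero_apply, map_zero]
  smul_mem' := by
    intro a ξ hξ
    filter_upwards [hξ, Lp.coeFn_smul a ξ] with m h1 h2
    rw [h2, Pi.smul_apply, map_smul, h1]

theorem isClosed_L2Sections (L : Subbundle n M) : IsClosed (L2Sections μ L : Set (L2 μ)) := by
  refine isSeqClosed_iff_isClosed.mp ?_
  intro ξ η hξ hlim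
  obtain ⟨ns, -, hns⟩ := (tendstoInMeasure_of_tendsto_Lp hlim).exists_seq_tendsto_ae
  have h1 : ∀ᵐ m ∂μ, ∀ k, L.proj m (ξ k m) = ξ k m := ae_all_iff.mpr hξ
  change ∀ᵐ m ∂μ, L.proj m (η m) = η m
  filter_upwards [hns, h1] with m h2 h3
  have h4 := ((L.proj m).continuous.tendsto _).comp h2
  refine tendsto_nhds_unique (h4.congr fun k => ?_) h2
  simp [h3]

instance (L : Subbundle n M) : CompleteSpace (L2Sections μ L) :=
  (isClosed_L2Sections μ L).completeSpace_coe

end L2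

/-! ### Flows, connections and holonomy -/

variable [IsManifold (𝓡 n) ∞ M]

/-- The flow `exp_t(X)` of an exponentiable vector field. -/
def ExpVectorField.flow (X : ExpVectorField n M) (t : ℝ) (m : M) : M :=
  (X.complete m).choose t

/-- A smooth unitary connection on a subbundle `L` with projections `P`: every such connection is
`∇ s = P ds + A s` for a unique smooth one-form `A` with values in the skew-adjoint endomorphisms
of `L`. Smoothness of the one-form is smoothness as a map on the total space of the tangent
bundle. -/
structure UnitaryConnection (L : Subbundle n M) where
  form : ∀ m : M, TangentSpace (𝓡 n) m →L[ℝ] EndFibre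
  smooth : ContMDiff (𝓡 n).tangent 𝓘(ℝ, EndFibre) ∞
    fun p : TangentBundle (𝓡 n) M => form p.1 p.2
  skew : ∀ m v, star (form m v) = -form m v
  compress : ∀ m v, L.proj m * form m v * L.proj m = form m v

variable (n M) in
/-- A smooth `SU(2)`-connection on the trivial bundle `M × ℂ²`: `∇ = d + A` with `A` a smooth
`su(2)`-valued one-form. -/
structure SU2Connection extends UnitaryConnection (trivialBundle n M) where
  trace_zero : ∀ m v, LinearMap.trace ℂ Fibre (form m v).toLinearMap = 0

/-- `u` is a parallel section along the curve `c : [0,1] → M`: `u(t)` lies in the fibre over `c(t)`,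
`u` is continuous, and `∇_{c'} u = 0` except at finitely many times. -/
def UnitaryConnection.IsParallelAlong {L : Subbundle n M} (D : UnitaryConnection L)
    (c : ℝ → M) (u : ℝ → Fibre) : Prop :=
  ContinuousOn u (Icc 0 1) ∧ (∀ t ∈ Icc (0 : ℝ) 1, L.proj (c t) (u t) = u t) ∧
  ∃ s : Finset ℝ, ∀ t ∈ Ioo (0 : ℝ) 1, t ∉ s → DifferentiableAt ℝ u t ∧
    L.proj (c t) (deriv u t) +
      D.form (c t) (mfderiv 𝓘(ℝ, ℝ) (𝓡 n) c t (1 : ℝ)) (u t) = 0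

open Classical in
/-- The holonomy `Hol(c, ∇)`: parallel transport of vectors in the fibre over `c 0` to the fibre
over `c 1`, along a piecewise smooth curve `c : [0,1] → M`. -/
def UnitaryConnection.hol {L : Subbundle n M} (D : UnitaryConnection L)
    (c : ℝ → M) (v : Fibre) : Fibre :=
  if h : ∃ u, D.IsParallelAlong c u ∧ u 0 = v then h.choose 1 else 0

variable (n) in
/-- The curve `c : [0,1] → M` is piecewise smooth: it is continuous, and there are finitely many
times such that `c` is smooth (up to the ends) on every closed subinterval without such a time in
its interior. -/
def IsPiecewiseSmooth (c : ℝ → M) : Prop :=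
  ContinuousOn c (Icc 0 1) ∧ ∃ s : Finset ℝ, ∀ a b : ℝ, 0 ≤ a → a < b → b ≤ 1 →
    (∀ t ∈ s, t ∉ Ioo a b) → ContMDiffOn 𝓘(ℝ, ℝ) (𝓡 n) ∞ c (Icc a b)

/-- The holonomy group at `m` of a connection on `M × ℂ²`: the parallel transports around all
piecewise smooth loops at `m`. -/
def SU2Connection.holonomyGroup (D : SU2Connection n M) (m : M) : Set (Fibre → Fibre) :=
  {g | ∃ c : ℝ → M, IsPiecewiseSmooth n c ∧ c 0 = m ∧ c 1 = m ∧ g = D.hol c}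

/-- The connection is irreducible at `m`: its holonomy group at `m` acts irreducibly on the
fibre. -/
def SU2Connection.IsIrreducibleAt (D : SU2Connection n M) (m : M) : Prop :=
  ActsIrreducibly (D.holonomyGroup m)

/-! ### Flow operators and the holonomy-diffeomorphism algebra -/

variable [MeasurableSpace M] (μ : Measure M)

/-- The section `e^X_∇ ξ`. Its value at `m` is the holonomy of `∇` along
`t ↦ exp_{1-t}(X)(m)`, a curve from `exp_1(X)(m)` to `m`, applied to `ξ (exp_1(X)(m))`, times the
factor that comes from the pullback of half densities, the square root of the density of the
pullback `exp_1(X)^* μ : A ↦ μ (exp_1(X)(A))` with respect to `μ`. -/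
def flowSection {L : Subbundle n M} (D : UnitaryConnection L) (X : ExpVectorField n M)
    (ξ : M → Fibre) (m : M) : Fibre :=
  ((√((μ.map (X.flow (-1))).rnDeriv μ m).toReal : ℝ) : ℂ) •
    D.hol (fun t => X.flow (1 - t) m) (ξ (X.flow 1 m))

variable (n) in
/-- The bounded functions from the set of smooth `SU(2)`-connections on `M × ℂ²` to the bounded
operators on `L²(M, Ω^{1/2} ⊗ S)`. -/
abbrev OperatorFunctions : Type _ :=
  BoundedOperatorFunctions (SU2Connection n M) (L2 μ)

/-- `Ψ` is the operator valued function `f e^X : ∇ ↦ f e^X_∇`. -/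
def IsFlowOperator (f : M → ℂ) (X : ExpVectorField n M) (Ψ : OperatorFunctions n μ) : Prop :=
  ∀ (D : SU2Connection n M) (ξ : L2 μ),
    (Ψ D ξ : M → Fibre) =ᵐ[μ] fun m => f m • flowSection μ D.toUnitaryConnection X ξ m

variable (n) in
/-- `C = span {f e^X | f ∈ C_c^∞(M), X an exponentiable vector field}`. -/
def generators : Submodule ℂ (OperatorFunctions n μ) :=
  Submodule.span ℂ {Ψ | ∃ (f : M → ℂ) (X : ExpVectorField n M),
    ContMDiff (𝓡 n) 𝓘(ℝ, ℂ) ∞ f ∧ HasCompactSupport f ∧ IsFlowOperator μ f X Ψ}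

variable (n) in
/-- The holonomy-diffeomorphism algebra `HD(M, S, 𝒜)`, where `S = M × ℂ²` and `𝒜` is the set of
smooth `SU(2)`-connections: the C*-algebra generated by `C`. -/
def HD : NonUnitalStarSubalgebra ℂ (OperatorFunctions n μ) :=
  generatedCStarAlgebra (generators n μ : Set (OperatorFunctions n μ))

/-- The representation `φ_∇` of the holonomy-diffeomorphism algebra on `L²(M, Ω^{1/2} ⊗ S)`:
evaluation at `∇`. -/
def phi (D : SU2Connection n M) : HD n μ →⋆ₙₐ[ℂ] (L2 μ →L[ℂ] L2 μ) where
  toFun a := (a : OperatorFunctions n μ) D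
  map_smul' _ _ := rfl
  map_zero' := rfl
  map_add' _ _ := rfl
  map_mul' _ _ := rfl
  map_star' _ := rfl

/-- The representation `π` of the holonomy-diffeomorphism algebra on `L²(M, Ω^{1/2} ⊗ L)` is the
representation `φ_∇` of the unitary connection `∇` on `L`, that is, `π (f e^X) = f e^X_∇` for all
`f ∈ C_c^∞(M)` and all exponentiable `X`. -/
def IsRepOfConnection {L : Subbundle n M} (D : UnitaryConnection L)
    (π : HD n μ →⋆ₙₐ[ℂ] (L2Sections μ L →L[ℂ] L2Sections μ L)) : Prop :=
  ∀ (f : M → ℂ) (X : ExpVectorField n M), ContMDiff (𝓡 n) 𝓘(ℝ, ℂ) ∞ f → HasCompactSupport f →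
    ∀ a : HD n μ, IsFlowOperator μ f X (a : OperatorFunctions n μ) → ∀ ξ : L2Sections μ L,
      ((π a ξ : L2 μ) : M → Fibre) =ᵐ[μ] fun m => f m • flowSection μ D X (ξ : L2 μ) m

end Geometry

end HolDiff

end

/-!
A connection `∇` is compared with its representation `φ_∇` through parallel fields of projections
(`IsParallelField`): smooth fields `Q` of orthogonal projections of the fibre that satisfy
`dQ = [Q, A]` for the connection form `A`. Such fields describe the holonomy invariant subspaces of
the fibre at `m` as well as the closed invariant subspaces of `φ_∇`.

*Invariant subspaces of the fibre.* The manifold is connected by piecewise smooth curves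
(`exists_reach`), and a subspace of the fibre at `m` that is invariant under the holonomy group can
be transported to all other fibres, independently of the curve. The resulting field of projections
commutes with the transports along coordinate segments. To first order, the transport along a short
segment with difference vector `v` is `1 - A(v)`, so a field that commutes with all such transports
is differentiable with `dQ = [Q, A]`, hence smooth by bootstrapping this equation
(`isParallelField_of_chartTransport`). This gives `exists_isParallelField`. Conversely, holonomy preserves the range of a parallel field
(`IsParallelField.hol_mem`).

*Invariant subspaces of the representation.* The square integrable sections of the range of a
parallel field are invariant (`IsParallelField.phi_mem`), again because holonomy preserves the range.
Conversely, the projection `p` onto a closed invariant subspace commutes with `φ_∇`. The algebra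
contains the multiplications by smooth functions with compact support, as `f e^X` for `X = 0`, so
`p` is locally the multiplication by a measurable field of projections (`exists_localField`). It
also contains `f e^X` for coordinate vector fields that are cut off, whose flows are translations
near a given point. Commuting with these says, for each translation vector, that the field
intertwines the transport along almost every coordinate segment with this difference vector. By
Fubini's theorem there is a base point from which the value of the field is transported to almost all
other points, so the field is almost everywhere equal to a continuous one
(`exists_continuous_of_ae_intertwine`), which commutes with the transports along all short coordinate
segments (`exists_chartField`) and is therefore parallel (`exists_isParallelField_of_commute`).

*Conclusion.* On a connected manifold a parallel field that is `0` or `1` at one point is so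
everywhere. Hence `φ_∇` is irreducible if and only if the holonomy group acts irreducibly on one
fibre. If it does not, there is a parallel field `Q` whose ranges are lines. The connection
restricts to the line bundles of `Q` and `1 - Q`, with connection forms `Q A Q` and
`(1 - Q) A (1 - Q)` (`IsParallelField.connection`), and has the same holonomy there
(`IsParallelField.hol_connection`), so the restrictions of `φ_∇` are the representations of these
connections (`IsParallelField.isRepOfConnection_rep`). They are irreducible, since an invariant
subspace comes from a parallel field of projections below `Q`, which is `0` or `Q`
(`IsParallelField.isIrreducibleRep_rep`).

Two devices keep the analysis short. Solutions of the transport equation are studied through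
unitarity and uniqueness (`IsTransport`, `continuous_transport`), and flows are only shown to be
jointly continuous (`ExpVectorField.continuous_flow`). That a flow preserves null sets is never used
in general: a density is only inspected where it does not vanish (`ae_flow`), and for coordinate
translations it is shown not to vanish (`flowDensity_chartVectorField_ne_zero`).
-/

noncomputable section

namespace HolDiff

set_option linter.unusedSectionVars false


/-! ### Linear transport equations -/

theorem eq_left_of_hasDerivAt_zero_off_finset {E : Type*} [NormedAddCommGroup E] [NormedSpace ℝ E]
    [CompleteSpace E] {f : ℝ → E} (hf : ContinuousOn f (Icc 0 1)) (s : Finset ℝ)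
    (h : ∀ t ∈ Ioo (0 : ℝ) 1, t ∉ s → HasDerivAt f 0 t) {t : ℝ} (ht : t ∈ Icc (0 : ℝ) 1) :
    f t = f 0 := by
  have key := integral_eq_of_hasDerivAt_off_countable f (fun _ => (0 : E))
    (a := 0) (b := t) s.countable_toSet
    (hf.mono (by rw [uIcc_of_le ht.1]; exact Icc_subset_Icc_right ht.2))
    (fun x hx => h x ⟨by simpa [ht.1] using hx.1.1, lt_of_lt_of_le
      (by simpa [ht.1] using hx.1.2) ht.2⟩ (by simpa using hx.2)) (by simp)
  simpa [sub_eq_zero, eq_comm (a := (0 : E))] using key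

section Transport

variable {𝔸 : Type*} [NormedRing 𝔸] [StarRing 𝔸] [CStarRing 𝔸] [NormedAlgebra ℝ 𝔸]
  [StarModule ℝ 𝔸] [FiniteDimensional ℝ 𝔸] [IsDedekindFiniteMonoid 𝔸] [Nontrivial 𝔸]

/-- `U : [0,1] → 𝔸` solves `U' = -B U`, `U(0) = 1`, except for finitely many exceptional
times. When `B(t) = A(c'(t))` along a curve `c`, this is the parallel transport of `d + A`. -/
structure IsTransport (B U : ℝ → 𝔸) : Prop where
  zero : U 0 = 1
  cont : ContinuousOn U (Icc 0 1)
  deriv : ∃ s : Finset ℝ, ∀ t ∈ Ioo (0 : ℝ) 1, t ∉ s → HasDerivAt U (-(B t * U t)) t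

theorem IsTransport.congr {B C U : ℝ → 𝔸} (hU : IsTransport B U) (s : Finset ℝ)
    (h : ∀ t ∈ Ioo (0 : ℝ) 1, t ∉ s → B t = C t) : IsTransport C U := by
  classical
  obtain ⟨s', hs'⟩ := hU.deriv
  refine ⟨hU.zero, hU.cont, s ∪ s', fun t ht hts => ?_⟩
  rw [Finset.mem_union, not_or] at hts
  rw [← h t ht hts.1]
  exact hs' t ht hts.2

theorem norm_le_one_of_star_mul {U : 𝔸} (h : star U * U = 1) : ‖U‖ ≤ 1 := by
  have := CStarRing.norm_star_mul_self (x := U)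
  rw [h, norm_one] at this
  nlinarith [norm_nonneg U]

theorem HasDerivAt.star_mul {U V : ℝ → 𝔸} {U' V' : 𝔸} {t : ℝ}
    (hU : HasDerivAt U U' t) (hV : HasDerivAt V V' t) :
    HasDerivAt (fun t => star (U t) * V t) (star U' * V t + star (U t) * V') t :=
  hU.star.mul hV

/-- Transports of skew-adjoint coefficients are unitary. -/
theorem IsTransport.star_mul_self {B U : ℝ → 𝔸} (hU : IsTransport B U)
    (hB : ∀ t, star (B t) = -B t) {t : ℝ} (ht : t ∈ Icc (0 : ℝ) 1) : star (U t) * U t = 1 := by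
  obtain ⟨s, hs⟩ := hU.deriv
  have := eq_left_of_hasDerivAt_zero_off_finset (f := fun t => star (U t) * U t)
    (hU.cont.star.mul hU.cont) s (fun t ht hts => by
      refine (HasDerivAt.star_mul (hs t ht hts) (hs t ht hts)).congr_deriv ?_
      simp [hB, mul_assoc]) ht
  simpa [hU.zero] using this

theorem IsTransport.mul_star_self {B U : ℝ → 𝔸} (hU : IsTransport B U)
    (hB : ∀ t, star (B t) = -B t) {t : ℝ} (ht : t ∈ Icc (0 : ℝ) 1) : U t * star (U t) = 1 :=
  mul_eq_one_symm (hU.star_mul_self hB ht)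

theorem IsTransport.unique {B U V : ℝ → 𝔸} (hU : IsTransport B U) (hV : IsTransport B V)
    (hB : ∀ t, star (B t) = -B t) {t : ℝ} (ht : t ∈ Icc (0 : ℝ) 1) : U t = V t := by
  classical
  obtain ⟨s, hs⟩ := hU.deriv
  obtain ⟨s', hs'⟩ := hV.deriv
  have h := eq_left_of_hasDerivAt_zero_off_finset (f := fun t => star (U t) * V t)
    (hU.cont.star.mul hV.cont) (s ∪ s') (fun t ht hts => by
      rw [Finset.mem_union, not_or] at hts
      refine (HasDerivAt.star_mul (hs t ht hts.1) (hs' t ht hts.2)).congr_deriv ?_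
      simp [hB, mul_assoc]) ht
  calc U t = U t * (star (U t) * V t) := by rw [h, hU.zero, hV.zero]; simp
    _ = V t := by rw [← mul_assoc, hU.mul_star_self hB ht, one_mul]

/-- Transports depend continuously on the coefficients. The bound carries no exponential factor
since both transports are unitary. -/
theorem IsTransport.norm_sub_le {B C U V : ℝ → 𝔸} (hU : IsTransport B U)
    (hV : IsTransport C V) (hB : ∀ t, star (B t) = -B t) (hC : ∀ t, star (C t) = -C t)
    (hBc : Continuous B) (hCc : Continuous C) {δ : ℝ} (h : ∀ t ∈ Icc (0 : ℝ) 1, ‖B t - C t‖ ≤ δ) :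
    ‖U 1 - V 1‖ ≤ δ := by
  classical
  obtain ⟨s, hs⟩ := hU.deriv
  obtain ⟨s', hs'⟩ := hV.deriv
  have h01 : (1 : ℝ) ∈ Icc (0 : ℝ) 1 := by simp
  have key := integral_eq_of_hasDerivAt_off_countable
    (fun t => star (U t) * V t) (fun t => star (U t) * (B t - C t) * V t)
    (a := 0) (b := 1) (s ∪ s').countable_toSet (by
      rw [uIcc_of_le zero_le_one]; exact hU.cont.star.mul hV.cont)
    (fun t ht => by
      have ht' : t ∈ Ioo (0 : ℝ) 1 := by simpa using ht.1
      have hts := ht.2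
      simp only [Finset.coe_union, mem_union, not_or, Finset.mem_coe] at hts
      refine (HasDerivAt.star_mul (hs t ht' hts.1) (hs' t ht' hts.2)).congr_deriv ?_
      simp [hB, mul_assoc, mul_add, add_mul, sub_eq_add_neg]) (by
      apply ContinuousOn.intervalIntegrable
      rw [uIcc_of_le zero_le_one]
      exact (hU.cont.star.mul (hBc.sub hCc).continuousOn).mul hV.cont)
  have hb := intervalIntegral.norm_integral_le_of_norm_le_const (a := (0 : ℝ)) (b := 1) (C := δ)
    (f := fun t => star (U t) * (B t - C t) * V t) (fun t ht => by
      rw [uIoc_of_le zero_le_one] at ht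
      have ht' : t ∈ Icc (0 : ℝ) 1 := ⟨ht.1.le, ht.2⟩
      have h1 := norm_le_one_of_star_mul (hU.star_mul_self hB ht')
      have h2 := norm_le_one_of_star_mul (hV.star_mul_self hC ht')
      calc _ ≤ ‖star (U t)‖ * ‖B t - C t‖ * ‖V t‖ :=
            (norm_mul_le _ _).trans (by gcongr; exact norm_mul_le _ _)
        _ ≤ 1 * ‖B t - C t‖ * 1 := by rw [norm_star]; gcongr
        _ ≤ δ := by simpa using h t ht')
  rw [key] at hb
  have e : U 1 - V 1 = -(U 1 * (star (U 1) * V 1 - star (U 0) * V 0)) := by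
    rw [mul_sub, ← mul_assoc, hU.mul_star_self hB h01, hU.zero, hV.zero]
    simp
  rw [e, norm_neg]
  calc _ ≤ ‖U 1‖ * ‖star (U 1) * V 1 - star (U 0) * V 0‖ := norm_mul_le _ _
    _ ≤ 1 * (δ * |1 - 0|) := by
      gcongr
      exact norm_le_one_of_star_mul (hU.star_mul_self hB h01)
    _ = δ := by simp

open Metric in
/-- Existence of transports. The Picard–Lindelöf theorem is applied to the field `-ψ(U) B U` with a
bump function `ψ`, which is bounded and globally Lipschitz; its solutions are unitary as well, so
that `ψ = 1` along them. -/
theorem exists_isTransport {B : ℝ → 𝔸} (hc : Continuous B)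
    (hB : ∀ t, star (B t) = -B t) :
    ∃ U, IsTransport B U ∧ ∀ t ∈ Icc (0 : ℝ) 1, HasDerivAt U (-(B t * U t)) t := by
  classical
  let ψ : ContDiffBump (0 : 𝔸) := ⟨2, 3, by norm_num, by norm_num⟩
  let g : 𝔸 → 𝔸 := fun U => ψ U • U
  have hg : ContDiff ℝ 1 g := ψ.contDiff.smul contDiff_id
  have hgs : HasCompactSupport g := ψ.hasCompactSupport.smul_right
  obtain ⟨K, hK⟩ := hg.lipschitzWith_of_hasCompactSupport hgs one_ne_zero
  have hψ1 : ∀ U : 𝔸, |ψ U| ≤ 1 := fun U => by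
    rw [abs_of_nonneg ψ.nonneg]; exact ψ.le_one
  have hg3 : ∀ U, ‖g U‖ ≤ 3 := by
    intro U
    by_cases hU : ‖U‖ ≤ 3
    · calc ‖ψ U • U‖ = |ψ U| * ‖U‖ := norm_smul _ _
        _ ≤ 1 * 3 := by gcongr; exact hψ1 U
        _ = 3 := by norm_num
    · have : ψ U = 0 := ψ.zero_of_le_dist (by simpa using (not_le.mp hU).le)
      simp [g, this]
  obtain ⟨C, hC⟩ := (isCompact_Icc (a := (-1 : ℝ)) (b := 2)).exists_bound_of_continuousOn
    hc.continuousOn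
  have hC0 : 0 ≤ C := (norm_nonneg _).trans (hC 0 (by norm_num))
  lift C to NNReal using hC0
  have hpl : IsPicardLindelof (fun t U => -(B t * g U)) (tmin := -1) (tmax := 2)
      (⟨0, by norm_num⟩ : Icc (-1 : ℝ) 2) (1 : 𝔸) (C * 3 * 2) 0 (C * 3) (C * K) := by
    refine ⟨fun t ht => ?_, fun U _ => ?_, fun t ht U _ => ?_, ?_⟩
    · refine LipschitzOnWith.of_dist_le_mul fun U _ V _ => ?_
      rw [dist_eq_norm, neg_sub_neg, ← mul_sub]
      calc _ ≤ ‖B t‖ * ‖g V - g U‖ := norm_mul_le _ _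
        _ ≤ C * (K * ‖U - V‖) := by
          gcongr
          · exact hC t ht
          · rw [← norm_neg, neg_sub]; simpa [dist_eq_norm] using hK.dist_le_mul U V
        _ = _ := by rw [dist_eq_norm]; push_cast; ring
    · exact (hc.mul continuous_const).neg.continuousOn
    · rw [norm_neg]
      calc _ ≤ ‖B t‖ * ‖g U‖ := norm_mul_le _ _
        _ ≤ C * 3 := by gcongr; exacts [hC t ht, hg3 U]
        _ = _ := by push_cast; rfl
    · norm_num
  obtain ⟨U, hU0, hU⟩ := hpl.exists_eq_forall_mem_Icc_hasDerivWithinAt₀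
  have hd : ∀ t ∈ Icc (0 : ℝ) 1, HasDerivAt U (-(B t * g (U t))) t := fun t ht =>
    (hU t ⟨by linarith [ht.1], by linarith [ht.2]⟩).hasDerivAt
      (Icc_mem_nhds (by linarith [ht.1]) (by linarith [ht.2]))
  have hcont : ContinuousOn U (Icc 0 1) := fun t ht => (hd t ht).continuousAt.continuousWithinAt
  have hunit : ∀ t ∈ Icc (0 : ℝ) 1, star (U t) * U t = 1 := by
    intro t ht
    have := eq_left_of_hasDerivAt_zero_off_finset (f := fun t => star (U t) * U t)
      (hcont.star.mul hcont) ∅ (fun t ht _ => by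
        have h1 := hd t ⟨ht.1.le, ht.2.le⟩
        refine (HasDerivAt.star_mul h1 h1).congr_deriv ?_
        simp [hB, mul_assoc, g]) ht
    simpa [hU0] using this
  have hd' : ∀ t ∈ Icc (0 : ℝ) 1, HasDerivAt U (-(B t * U t)) t := by
    intro t ht
    have h1 : ψ (U t) = 1 := ψ.one_of_mem_closedBall (by
      simpa using (norm_le_one_of_star_mul (hunit t ht)).trans one_le_two)
    have := hd t ht
    simpa [g, h1] using this
  exact ⟨U, ⟨hU0, hcont, ∅, fun t ht _ => hd' t ⟨ht.1.le, ht.2.le⟩⟩, hd'⟩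

open Classical in
/-- The value at time `1` of the transport with coefficient `B`. -/
def transport (B : ℝ → 𝔸) : 𝔸 :=
  if h : ∃ U, IsTransport B U then h.choose 1 else 0

theorem IsTransport.transport_eq {B U : ℝ → 𝔸} (hU : IsTransport B U)
    (hB : ∀ t, star (B t) = -B t) : transport B = U 1 := by
  have h : ∃ U, IsTransport B U := ⟨U, hU⟩
  rw [transport, dif_pos h]
  exact h.choose_spec.unique hU hB (by simp)

theorem star_transport_mul_self {B : ℝ → 𝔸} (hc : Continuous B)
    (hB : ∀ t, star (B t) = -B t) : star (transport B) * transport B = 1 := by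
  obtain ⟨U, hU, -⟩ := exists_isTransport hc hB
  rw [hU.transport_eq hB]
  exact hU.star_mul_self hB (by simp)

theorem transport_zero : transport (fun _ => (0 : 𝔸)) = 1 := by
  have : IsTransport (fun _ => (0 : 𝔸)) (fun _ => 1) :=
    ⟨rfl, continuousOn_const, ∅, fun t _ _ => by simpa using hasDerivAt_const t (1 : 𝔸)⟩
  exact this.transport_eq (by simp)

/-- A jointly continuous family of skew-adjoint coefficients has a continuous family of
transports. -/
theorem continuous_transport {X : Type*} [TopologicalSpace X] {B : X → ℝ → 𝔸}
    (hc : Continuous (Function.uncurry B)) (hB : ∀ x t, star (B x t) = -B x t) :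
    Continuous fun x => transport (B x) := by
  have hcx : ∀ x, Continuous (B x) := fun x => hc.comp (Continuous.prodMk_right x)
  rw [continuous_iff_continuousAt]
  intro x
  rw [ContinuousAt, tendsto_iff_norm_sub_tendsto_zero, Metric.tendsto_nhds]
  intro ε hε
  have h1 : ∀ t ∈ Icc (0 : ℝ) 1, ∀ᶠ z : X × ℝ in nhds x ×ˢ nhds t,
      ‖B z.1 z.2 - B x z.2‖ < ε / 2 := by
    intro t _
    have hcont : Continuous fun z : X × ℝ => ‖B z.1 z.2 - B x z.2‖ :=
      (hc.sub ((hcx x).comp continuous_snd)).norm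
    have := hcont.tendsto (x, t)
    rw [nhds_prod_eq] at this
    refine this.eventually_lt_const ?_
    simpa using half_pos hε
  have h2 : ∀ᶠ y in nhds x, ∀ t ∈ Icc (0 : ℝ) 1, ‖B y t - B x t‖ < ε / 2 :=
    isCompact_Icc.eventually_forall_of_forall_eventually (fun t ht => by
      simpa [nhds_prod_eq] using h1 t ht)
  filter_upwards [h2] with y hy
  obtain ⟨U, hU, -⟩ := exists_isTransport (hcx y) (hB y)
  obtain ⟨V, hV, -⟩ := exists_isTransport (hcx x) (hB x)
  have := hU.norm_sub_le hV (hB y) (hB x) (hcx y) (hcx x) (fun t ht => (hy t ht).le)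
  rw [hU.transport_eq (hB y), hV.transport_eq (hB x)]
  simpa using this.trans_lt (half_lt_self hε)

end Transport

instance : StarModule ℝ EndFibre :=
  ⟨fun r T => by
    have h : r • T = (r : ℂ) • T := rfl
    rw [h, star_smul, Complex.star_def, Complex.conj_ofReal]
    rfl⟩

instance : ContinuousStar EndFibre :=
  ⟨(star_isometry (E := EndFibre)).continuous⟩

instance : IsDedekindFiniteMonoid EndFibre :=
  ⟨fun {U V} h => by
    have h1 : U.toLinearMap * V.toLinearMap = 1 := by
      ext1 v
      exact congrArg (fun T : EndFibre => T v) h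
    ext1 v
    exact congrArg (fun T : Fibre →ₗ[ℂ] Fibre => T v) (mul_eq_one_symm h1)⟩

theorem hasDerivAt_apply_vec {U : ℝ → EndFibre} {u : ℝ → Fibre} {U' : EndFibre} {u' : Fibre}
    {t : ℝ} (hU : HasDerivAt U U' t) (hu : HasDerivAt u u' t) :
    HasDerivAt (fun t => U t (u t)) (U' (u t) + U t u') t := by
  have h := ((ContinuousLinearMap.apply ℂ Fibre (E := Fibre)).flip.bilinearRestrictScalars
    ℝ).hasFDerivAt_of_bilinear hU.hasFDerivAt hu.hasFDerivAt
  exact h.hasDerivAt.congr_deriv (by simp [add_comm])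


/-! ### Vector fields in charts -/

section Chart

variable {n : ℕ} {M : Type*} [TopologicalSpace M] [ChartedSpace (EuclideanSpace ℝ (Fin n)) M]

/-- The derivative of the inverse of the chart at `p`, a map from the model space to the tangent
space at `(extChartAt p).symm y`. -/
def chartInvDeriv (p : M) (y : EuclideanSpace ℝ (Fin n)) :
    EuclideanSpace ℝ (Fin n) →L[ℝ] TangentSpace (𝓡 n) ((extChartAt (𝓡 n) p).symm y) :=
  mfderiv 𝓘(ℝ, EuclideanSpace ℝ (Fin n)) (𝓡 n) (extChartAt (𝓡 n) p).symm y

/-- The coordinate vector field with constant coefficients `v` on the domain of the chart at `p`. -/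
def coordField (p : M) (v : EuclideanSpace ℝ (Fin n)) (m : M) : TangentSpace (𝓡 n) m :=
  mfderivWithin 𝓘(ℝ, EuclideanSpace ℝ (Fin n)) (𝓡 n) (extChartAt (𝓡 n) p).symm
    (range (𝓡 n)) (extChartAt (𝓡 n) p m) v

variable [IsManifold (𝓡 n) ∞ M]

theorem hasMFDerivAt_chart_symm {p : M} {y : EuclideanSpace ℝ (Fin n)}
    (hy : y ∈ (extChartAt (𝓡 n) p).target) :
    HasMFDerivAt 𝓘(ℝ, EuclideanSpace ℝ (Fin n)) (𝓡 n) (extChartAt (𝓡 n) p).symm y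
      (chartInvDeriv p y) := by
  have := mdifferentiableWithinAt_extChartAt_symm (I := 𝓡 n) hy
  rw [(𝓡 n).range_eq_univ, mdifferentiableWithinAt_univ] at this
  exact this.hasMFDerivAt

theorem chartInvDeriv_eq {p : M} (y : EuclideanSpace ℝ (Fin n)) :
    chartInvDeriv p y =
      mfderivWithin 𝓘(ℝ, EuclideanSpace ℝ (Fin n)) (𝓡 n) (extChartAt (𝓡 n) p).symm
        (range (𝓡 n)) y := by
  rw [chartInvDeriv, (𝓡 n).range_eq_univ, mfderivWithin_univ]

theorem chartInvDeriv_mfderiv {p : M} {y : EuclideanSpace ℝ (Fin n)}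
    (hy : y ∈ (extChartAt (𝓡 n) p).target)
    (w : TangentSpace (𝓡 n) ((extChartAt (𝓡 n) p).symm y)) :
    chartInvDeriv p y (mfderiv
      (𝓡 n) 𝓘(ℝ, EuclideanSpace ℝ (Fin n)) (extChartAt (𝓡 n) p) ((extChartAt (𝓡 n) p).symm y) w) = w := by
  rw [chartInvDeriv_eq]
  exact congrArg (fun T => T w)
    (mfderivWithin_extChartAt_symm_comp_mfderiv_extChartAt (I := 𝓡 n) hy)

theorem mfderiv_coordField {p m : M} (hm : m ∈ (extChartAt (𝓡 n) p).source)
    (v : EuclideanSpace ℝ (Fin n)) :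
    mfderiv (𝓡 n) 𝓘(ℝ, EuclideanSpace ℝ (Fin n)) (extChartAt (𝓡 n) p) m (coordField p v m) = v :=
  congrArg (fun T => T v) (mfderiv_extChartAt_comp_mfderivWithin_extChartAt_symm' (I := 𝓡 n) hm)

theorem coordField_symm {p : M} {y : EuclideanSpace ℝ (Fin n)}
    (hy : y ∈ (extChartAt (𝓡 n) p).target) (v : EuclideanSpace ℝ (Fin n)) :
    coordField p v ((extChartAt (𝓡 n) p).symm y) = chartInvDeriv p y v := by
  rw [coordField, chartInvDeriv_eq, (extChartAt (𝓡 n) p).right_inv hy]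
  rfl

theorem trivializationAt_snd_eq_mfderiv {p m : M} (hm : m ∈ (extChartAt (𝓡 n) p).source)
    (w : TangentSpace (𝓡 n) m) :
    (trivializationAt (EuclideanSpace ℝ (Fin n)) (TangentSpace (𝓡 n)) p ⟨m, w⟩).2 =
      mfderiv (𝓡 n) 𝓘(ℝ, EuclideanSpace ℝ (Fin n)) (extChartAt (𝓡 n) p) m w := by
  rw [extChartAt_source] at hm
  rw [← TangentBundle.continuousLinearMapAt_trivializationAt hm]
  exact ((trivializationAt (EuclideanSpace ℝ (Fin n)) (TangentSpace (𝓡 n))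
    p).continuousLinearMapAt_apply_of_mem (R := ℝ) (by simpa using hm) w).symm

theorem contMDiffOn_coordField (p : M) (v : EuclideanSpace ℝ (Fin n)) :
    ContMDiffOn (𝓡 n) (𝓡 n).tangent ∞
      (fun m => (⟨m, coordField p v m⟩ : TangentBundle (𝓡 n) M)) (extChartAt (𝓡 n) p).source := by
  have key := Bundle.Trivialization.contMDiffOn_section_baseSet_iff (IB := 𝓡 n) (n := ∞)
    (s := coordField p v)
    (trivializationAt (EuclideanSpace ℝ (Fin n)) (TangentSpace (𝓡 n)) p)
  have hb : (trivializationAt (EuclideanSpace ℝ (Fin n)) (TangentSpace (𝓡 n)) p).baseSet =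
      (extChartAt (𝓡 n) p).source := by
    rw [extChartAt_source]; rfl
  rw [hb] at key
  refine key.mpr (contMDiffOn_const (c := v) |>.congr fun m hm => ?_)
  rw [trivializationAt_snd_eq_mfderiv hm, mfderiv_coordField hm]

/-- The curve in `M` with coordinates `f` has velocity with coordinates `f'`. -/
theorem hasMFDerivAt_chart_symm_comp {p : M} {f : ℝ → EuclideanSpace ℝ (Fin n)}
    {w : EuclideanSpace ℝ (Fin n)} {t : ℝ} (hf : HasDerivAt f w t)
    (ht : f t ∈ (extChartAt (𝓡 n) p).target) :
    HasMFDerivAt 𝓘(ℝ, ℝ) (𝓡 n) (fun s => (extChartAt (𝓡 n) p).symm (f s)) t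
      ((1 : ℝ →L[ℝ] ℝ).smulRight (chartInvDeriv p (f t) w)) := by
  have h := (hasMFDerivAt_chart_symm ht).comp t hf.hasFDerivAt.hasMFDerivAt
  have e : (1 : ℝ →L[ℝ] ℝ).smulRight (chartInvDeriv p (f t) w) =
      (chartInvDeriv p (f t)).comp (ContinuousLinearMap.toSpanSingleton ℝ w) := by
    ext
    change (1 : ℝ) • chartInvDeriv p (f t) w = chartInvDeriv p (f t) ((1 : ℝ) • w)
    rw [one_smul, one_smul]
  rw [e]
  exact h

/-- A smooth vector field in coordinates. -/
theorem exists_contDiffOn_coord {X : ∀ m : M, TangentSpace (𝓡 n) m}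
    (hX : ContMDiff (𝓡 n) (𝓡 n).tangent ∞ fun m => (⟨m, X m⟩ : TangentBundle (𝓡 n) M)) (p : M) :
    ∃ g : EuclideanSpace ℝ (Fin n) → EuclideanSpace ℝ (Fin n),
      ContDiffOn ℝ ∞ g (extChartAt (𝓡 n) p).target ∧
      ∀ y ∈ (extChartAt (𝓡 n) p).target,
        chartInvDeriv p y (g y) = X ((extChartAt (𝓡 n) p).symm y) := by
  have key := Bundle.Trivialization.contMDiffOn_section_baseSet_iff (IB := 𝓡 n) (n := ∞)
    (s := X) (trivializationAt (EuclideanSpace ℝ (Fin n)) (TangentSpace (𝓡 n)) p)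
  have hb : (trivializationAt (EuclideanSpace ℝ (Fin n)) (TangentSpace (𝓡 n)) p).baseSet =
      (extChartAt (𝓡 n) p).source := by
    rw [extChartAt_source]; rfl
  rw [hb] at key
  refine ⟨fun y => (trivializationAt (EuclideanSpace ℝ (Fin n)) (TangentSpace (𝓡 n)) p
    ⟨(extChartAt (𝓡 n) p).symm y, X ((extChartAt (𝓡 n) p).symm y)⟩).2, ?_, fun y hy => ?_⟩
  · rw [← contMDiffOn_iff_contDiffOn]
    exact (key.mp hX.contMDiffOn).comp (contMDiffOn_extChartAt_symm p)
      (extChartAt (𝓡 n) p).mapsTo_symm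
  · beta_reduce
    rw [trivializationAt_snd_eq_mfderiv ((extChartAt (𝓡 n) p).map_target hy),
      chartInvDeriv_mfderiv hy]

/-- Near every point a smooth vector field has a continuous local flow on a time interval that does
not depend on the starting point. -/
theorem exists_local_flow {X : ∀ m : M, TangentSpace (𝓡 n) m}
    (hX : ContMDiff (𝓡 n) (𝓡 n).tangent ∞ fun m => (⟨m, X m⟩ : TangentBundle (𝓡 n) M)) (p : M) :
    ∃ ε > (0 : ℝ), ∃ U ∈ nhds p, ∃ Φ : ℝ → M → M,
      ContinuousOn (Function.uncurry Φ) (Ioo (-ε) ε ×ˢ U) ∧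
      ∀ x ∈ U, Φ 0 x = x ∧ IsMIntegralCurveOn (I := 𝓡 n) (fun t => Φ t x) X (Ioo (-ε) ε) := by
  obtain ⟨g, hg, hgX⟩ := exists_contDiffOn_coord hX p
  set φ := extChartAt (𝓡 n) p with hφ
  have hopen : IsOpen φ.target := isOpen_extChartAt_target p
  have hp : φ p ∈ φ.target := mem_extChartAt_target p
  have hg1 : ContDiffAt ℝ 1 g (φ p) :=
    (hg.contDiffAt (hopen.mem_nhds hp)).of_le (by norm_cast)
  obtain ⟨ε, hε, a, r, L, K, hr, hpl⟩ := IsPicardLindelof.of_contDiffAt_one hg1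
  obtain ⟨α, hα, hαc⟩ := (hpl 0).exists_forall_mem_closedBall_eq_hasDerivWithinAt_continuousOn
  simp only [zero_sub, zero_add] at hα hαc
  have hε0 : (0 : ℝ) ∈ Ioo (-ε) ε := ⟨by linarith, hε⟩
  have hmem : Metric.closedBall (φ p) r ×ˢ Icc (-ε) ε ∈ nhds (φ p, (0 : ℝ)) :=
    prod_mem_nhds (Metric.closedBall_mem_nhds _ hr) (Icc_mem_nhds hε0.1 hε0.2)
  have hα0 : α (φ p, 0) = φ p := (hα _ (Metric.mem_closedBall_self r.2)).1
  have hev : ∀ᶠ z in nhds (φ p, (0 : ℝ)), α z ∈ φ.target :=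
    (hαc.continuousAt hmem).eventually_mem (by rw [hα0]; exact hopen.mem_nhds hp)
  obtain ⟨V, hV, W, hW, hVW⟩ := mem_nhds_prod_iff.mp (Filter.inter_mem hev hmem)
  obtain ⟨δ, hδ, hδW⟩ := Metric.mem_nhds_iff.mp hW
  have hVW' : ∀ y ∈ V, ∀ t ∈ Ioo (-δ) δ, α (y, t) ∈ φ.target ∧
      y ∈ Metric.closedBall (φ p) r ∧ t ∈ Icc (-ε) ε := by
    intro y hy t ht
    have h1 := hVW (show (y, t) ∈ V ×ˢ W from
      ⟨hy, hδW (by rw [Real.ball_eq_Ioo]; simpa using ht)⟩)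
    exact ⟨h1.1, h1.2.1, h1.2.2⟩
  refine ⟨min δ ε, lt_min hδ hε, φ.source ∩ φ ⁻¹' V,
    Filter.inter_mem (extChartAt_source_mem_nhds p) ((continuousAt_extChartAt p) hV),
    fun t x => φ.symm (α (φ x, t)), ?_, ?_⟩
  · refine (continuousOn_extChartAt_symm p).comp (t := φ.target) ?_ ?_
    · refine hαc.comp (f := fun z : ℝ × M => (φ z.2, z.1)) ?_ ?_
      · exact ((continuousOn_extChartAt p).comp continuousOn_snd
          (fun z hz => hz.2.1)).prodMk continuousOn_fst
      · intro z hz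
        have := hVW' (φ z.2) hz.2.2 z.1 ⟨by linarith [hz.1.1, min_le_left δ ε],
          by linarith [hz.1.2, min_le_left δ ε]⟩
        exact ⟨this.2.1, this.2.2⟩
    · intro z hz
      exact (hVW' (φ z.2) hz.2.2 z.1 ⟨by linarith [hz.1.1, min_le_left δ ε],
          by linarith [hz.1.2, min_le_left δ ε]⟩).1
  · intro x hx
    have hx1 := (hVW' (φ x) hx.2 0 ⟨by linarith, hδ⟩).2.1
    refine ⟨?_, fun t ht => ?_⟩
    · simp only [(hα _ hx1).1]
      exact φ.left_inv hx.1
    · have ht1 := hVW' (φ x) hx.2 t ⟨by linarith [ht.1, min_le_left δ ε],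
          by linarith [ht.2, min_le_left δ ε]⟩
      have hd : HasDerivAt (fun s => α (φ x, s)) (g (α (φ x, t))) t :=
        ((hα _ hx1).2 t ht1.2.2).hasDerivAt
          (Icc_mem_nhds (by linarith [ht.1, min_le_right δ ε])
            (by linarith [ht.2, min_le_right δ ε]))
      have := (hasMFDerivAt_chart_symm_comp hd ht1.1).hasMFDerivWithinAt (s := Ioo (-min δ ε) (min δ ε))
      rw [hgX _ ht1.1] at this
      exact this

/-! ### Flows of exponentiable vector fields -/

theorem ContMDiff.tangent_one {X : ∀ m : M, TangentSpace (𝓡 n) m}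
    (hX : ContMDiff (𝓡 n) (𝓡 n).tangent ∞ fun m => (⟨m, X m⟩ : TangentBundle (𝓡 n) M)) :
    ContMDiff (𝓡 n) (𝓡 n).tangent 1 fun m => (⟨m, X m⟩ : TangentBundle (𝓡 n) M) :=
  hX.of_le (by norm_cast)

/-- A smooth vector field that vanishes outside a compact set is complete. -/
theorem exists_isMIntegralCurve_of_isCompact [T2Space M] {X : ∀ m : M, TangentSpace (𝓡 n) m}
    (hX : ContMDiff (𝓡 n) (𝓡 n).tangent ∞ fun m => (⟨m, X m⟩ : TangentBundle (𝓡 n) M))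
    {K : Set M} (hK : IsCompact K) (h0 : ∀ m ∉ K, X m = 0) (m : M) :
    ∃ c : ℝ → M, c 0 = m ∧ IsMIntegralCurve (I := 𝓡 n) c X := by
  have hunif : ∃ ε > (0 : ℝ), ∀ x ∈ K, ∃ γ : ℝ → M, γ 0 = x ∧
      IsMIntegralCurveOn (I := 𝓡 n) γ X (Ioo (-ε) ε) := by
    refine hK.induction_on (p := fun S => ∃ ε > (0 : ℝ), ∀ x ∈ S, ∃ γ : ℝ → M, γ 0 = x ∧
      IsMIntegralCurveOn (I := 𝓡 n) γ X (Ioo (-ε) ε)) ⟨1, one_pos, by simp⟩ ?_ ?_ ?_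
    · rintro S T hST ⟨ε, hε, h⟩
      exact ⟨ε, hε, fun x hx => h x (hST hx)⟩
    · rintro S T ⟨ε, hε, h⟩ ⟨ε', hε', h'⟩
      refine ⟨min ε ε', lt_min hε hε', fun x hx => ?_⟩
      rcases hx with hx | hx
      · obtain ⟨γ, h1, h2⟩ := h x hx
        exact ⟨γ, h1, h2.mono (Ioo_subset_Ioo (neg_le_neg (min_le_left _ _)) (min_le_left _ _))⟩
      · obtain ⟨γ, h1, h2⟩ := h' x hx
        exact ⟨γ, h1, h2.mono (Ioo_subset_Ioo (neg_le_neg (min_le_right _ _)) (min_le_right _ _))⟩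
    · intro x _
      obtain ⟨ε, hε, U, hU, Φ, -, hΦ⟩ := exists_local_flow hX x
      exact ⟨U, mem_nhdsWithin_of_mem_nhds hU, ε, hε, fun y hy => ⟨fun t => Φ t y, hΦ y hy⟩⟩
  obtain ⟨ε, hε, h⟩ := hunif
  have : IsManifold (𝓡 n) 1 M := IsManifold.of_le (n := ∞) (by norm_cast)
  refine exists_isMIntegralCurve_of_isMIntegralCurveOn (ContMDiff.tangent_one hX) hε (fun x => ?_) m
  by_cases hx : x ∈ K
  · exact h x hx
  · exact ⟨fun _ => x, rfl, (isMIntegralCurve_const (h0 x hx)).isMIntegralCurveOn _⟩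

namespace ExpVectorField

variable (X : ExpVectorField n M)

theorem flow_zero (m : M) : X.flow 0 m = m := (X.complete m).choose_spec.1

theorem isMIntegralCurve_flow (m : M) :
    IsMIntegralCurve (I := 𝓡 n) (fun t => X.flow t m) X.toFun := (X.complete m).choose_spec.2

variable [T2Space M]

theorem flow_eq_of_isMIntegralCurveOn {m : M} {c : ℝ → M} {a b : ℝ} (h0 : (0 : ℝ) ∈ Ioo a b)
    (hc : IsMIntegralCurveOn (I := 𝓡 n) c X.toFun (Ioo a b)) (hm : c 0 = m) {t : ℝ}
    (ht : t ∈ Ioo a b) : X.flow t m = c t := by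
  have : IsManifold (𝓡 n) 1 M := IsManifold.of_le (n := ∞) (by norm_cast)
  exact isMIntegralCurveOn_Ioo_eqOn_of_contMDiff_boundaryless h0 (ContMDiff.tangent_one X.smooth)
    ((X.isMIntegralCurve_flow m).isMIntegralCurveOn _) hc (by rw [X.flow_zero, hm]) ht

theorem flow_add (s t : ℝ) (m : M) : X.flow (s + t) m = X.flow s (X.flow t m) := by
  have : IsManifold (𝓡 n) 1 M := IsManifold.of_le (n := ∞) (by norm_cast)
  have h1 := (X.isMIntegralCurve_flow m).comp_add t
  have h2 := X.isMIntegralCurve_flow (X.flow t m)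
  have := isMIntegralCurve_Ioo_eq_of_contMDiff_boundaryless (t₀ := 0)
    (ContMDiff.tangent_one X.smooth) h1 h2 (by simp [X.flow_zero])
  exact congrFun this s

theorem flow_neg_flow (t : ℝ) (m : M) : X.flow (-t) (X.flow t m) = m := by
  rw [← X.flow_add, neg_add_cancel, X.flow_zero]

theorem flow_flow_neg (t : ℝ) (m : M) : X.flow t (X.flow (-t) m) = m := by
  rw [← X.flow_add, add_neg_cancel, X.flow_zero]

theorem exists_continuousOn_flow (p : M) :
    ∃ ε > (0 : ℝ), ∃ U ∈ nhds p,
      ContinuousOn (Function.uncurry X.flow) (Ioo (-ε) ε ×ˢ U) := by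
  obtain ⟨ε, hε, U, hU, Φ, hc, hΦ⟩ := exists_local_flow X.smooth p
  refine ⟨ε, hε, U, hU, hc.congr fun z hz => ?_⟩
  exact X.flow_eq_of_isMIntegralCurveOn ⟨by linarith, hε⟩ (hΦ z.2 hz.2).2 (hΦ z.2 hz.2).1 hz.1

/-- Each time-`t` map is continuous: along an integral curve the local continuity holds on a uniform
time interval, and `exp_t(X)` is the `N`-th iterate of `exp_{t/N}(X)`. -/
theorem continuous_flow_time (t : ℝ) : Continuous (X.flow t) := by
  rw [continuous_iff_continuousAt]
  intro m
  have hcpt : IsCompact ((fun s => X.flow s m) '' uIcc 0 t) :=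
    isCompact_uIcc.image (X.isMIntegralCurve_flow m).continuous
  have hunif : ∃ ε > (0 : ℝ), ∀ x ∈ (fun s => X.flow s m) '' uIcc 0 t, ∀ s ∈ Ioo (-ε) ε,
      ContinuousAt (X.flow s) x := by
    refine hcpt.induction_on (p := fun S => ∃ ε > (0 : ℝ), ∀ x ∈ S, ∀ s ∈ Ioo (-ε) ε,
      ContinuousAt (X.flow s) x) ⟨1, one_pos, by simp⟩ ?_ ?_ ?_
    · rintro S T hST ⟨ε, hε, h⟩
      exact ⟨ε, hε, fun x hx => h x (hST hx)⟩
    · rintro S T ⟨ε, hε, h⟩ ⟨ε', hε', h'⟩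
      refine ⟨min ε ε', lt_min hε hε', fun x hx s hs => ?_⟩
      rcases hx with hx | hx
      · exact h x hx s (Ioo_subset_Ioo (neg_le_neg (min_le_left _ _)) (min_le_left _ _) hs)
      · exact h' x hx s (Ioo_subset_Ioo (neg_le_neg (min_le_right _ _)) (min_le_right _ _) hs)
    · intro x _
      obtain ⟨ε, hε, U, hU, hc⟩ := X.exists_continuousOn_flow x
      refine ⟨interior U, mem_nhdsWithin_of_mem_nhds (interior_mem_nhds.mpr hU), ε, hε,
        fun y hy s hs => ?_⟩
      have h1 : ContinuousAt (Function.uncurry X.flow) (s, y) :=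
        hc.continuousAt (prod_mem_nhds (Ioo_mem_nhds hs.1 hs.2) (mem_interior_iff_mem_nhds.mp hy))
      exact h1.comp (f := fun y => (s, y)) (Continuous.prodMk_right s).continuousAt
  obtain ⟨ε, hε, h⟩ := hunif
  obtain ⟨N, hN⟩ := exists_nat_gt (|t| / ε)
  have hN0 : (0 : ℝ) < N := lt_of_le_of_lt (by positivity) hN
  have hs : t / N ∈ Ioo (-ε) ε := by
    rw [mem_Ioo, ← abs_lt, abs_div, abs_of_pos hN0, div_lt_iff₀ hN0, mul_comm]
    exact (div_lt_iff₀ hε).mp hN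
  have key : ∀ k : ℕ, k ≤ N → ContinuousAt (X.flow (k * (t / N))) m := by
    intro k
    induction k with
    | zero =>
      intro _
      have : X.flow ((0 : ℕ) * (t / N)) = id := by ext x; simp [X.flow_zero]
      rw [this]
      exact continuousAt_id
    | succ k ih =>
      intro hk
      have e : X.flow ((k + 1 : ℕ) * (t / N)) = X.flow (t / N) ∘ X.flow (k * (t / N)) := by
        ext x
        rw [Function.comp_apply, ← X.flow_add]
        congr 1
        push_cast
        ring
      rw [e]
      refine ContinuousAt.comp (h _ ⟨k * (t / N), ?_, rfl⟩ _ hs) (ih (by omega))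
      have hk' : (k : ℝ) / N ∈ Icc (0 : ℝ) 1 :=
        ⟨by positivity, by rw [div_le_one hN0]; exact_mod_cast (by omega : k ≤ N)⟩
      have : (k : ℝ) * (t / N) = (k / N) * t := by ring
      rw [this]
      rcases le_total 0 t with ht | ht
      · rw [uIcc_of_le ht]
        exact ⟨mul_nonneg hk'.1 ht, mul_le_of_le_one_left ht hk'.2⟩
      · rw [uIcc_of_ge ht]
        exact ⟨by nlinarith [hk'.1, hk'.2], mul_nonpos_of_nonneg_of_nonpos hk'.1 ht⟩
  have := key N le_rfl
  rwa [mul_div_cancel₀ _ hN0.ne'] at this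

theorem continuous_flow : Continuous (Function.uncurry X.flow) := by
  rw [continuous_iff_continuousAt]
  rintro ⟨t, m⟩
  obtain ⟨ε, hε, U, hU, hc⟩ := X.exists_continuousOn_flow (X.flow t m)
  have e : Function.uncurry X.flow =
      Function.uncurry X.flow ∘ fun z : ℝ × M => (z.1 - t, X.flow t z.2) := by
    ext ⟨s, x⟩
    simp [← X.flow_add]
  rw [e]
  refine ContinuousAt.comp (hc.continuousAt (prod_mem_nhds
    (Ioo_mem_nhds (by simpa using hε) (by simpa using hε)) hU)) ?_
  exact ((continuous_fst.sub continuous_const).prodMk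
    ((X.continuous_flow_time t).comp continuous_snd)).continuousAt

end ExpVectorField

end Chart


/-! ### Transport along segments and regularity of covariantly constant maps -/

section Flat

variable {𝔸 : Type*} [NormedRing 𝔸] [StarRing 𝔸] [CStarRing 𝔸] [NormedAlgebra ℝ 𝔸]
  [StarModule ℝ 𝔸] [FiniteDimensional ℝ 𝔸] [IsDedekindFiniteMonoid 𝔸] [Nontrivial 𝔸]
  {E : Type*} [NormedAddCommGroup E] [NormedSpace ℝ E]

/-- The coefficient of the transport equation of the one-form `a` along the segment from `y`
to `x`. -/
def segCoef (a : E → E →L[ℝ] 𝔸) (x y : E) (s : ℝ) : 𝔸 := a (y + s • (x - y)) (x - y)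

/-- The parallel transport of `d + a` along the segment from `y` to `x`. -/
def segTransport (a : E → E →L[ℝ] 𝔸) (x y : E) : 𝔸 := transport (segCoef a x y)

variable {a : E → E →L[ℝ] 𝔸}

theorem star_segCoef (ha : ∀ y v, star (a y v) = -a y v) (x y : E) (s : ℝ) :
    star (segCoef a x y s) = -segCoef a x y s := ha _ _

theorem continuous_segCoef (hc : Continuous a) (x y : E) : Continuous (segCoef a x y) :=
  (hc.comp (by fun_prop)).clm_apply continuous_const

theorem continuous_segTransport (hc : Continuous a) (ha : ∀ y v, star (a y v) = -a y v) :
    Continuous fun z : E × E => segTransport a z.1 z.2 :=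
  continuous_transport (B := fun z : E × E => segCoef a z.1 z.2)
    ((hc.comp (by fun_prop)).clm_apply (by fun_prop)) (fun _ _ => ha _ _)

theorem star_segTransport_mul_self (hc : Continuous a) (ha : ∀ y v, star (a y v) = -a y v)
    (x y : E) : star (segTransport a x y) * segTransport a x y = 1 :=
  star_transport_mul_self (continuous_segCoef hc x y) (star_segCoef ha x y)

theorem segTransport_mul_star_self (hc : Continuous a) (ha : ∀ y v, star (a y v) = -a y v)
    (x y : E) : segTransport a x y * star (segTransport a x y) = 1 :=
  mul_eq_one_symm (star_segTransport_mul_self hc ha x y)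

theorem segTransport_self (x : E) : segTransport a x x = 1 := by
  have : segCoef a x x = fun _ => 0 := by ext s; simp [segCoef]
  rw [segTransport, this, transport_zero]

/-- To first order, the transport from `y` to `y + w` is `1 - a(y)(w)`. -/
theorem hasFDerivAt_segTransport (hc : Continuous a) (ha : ∀ y v, star (a y v) = -a y v) (y : E) :
    HasFDerivAt (fun x => segTransport a x y) (-(a y)) y := by
  rw [hasFDerivAt_iff_isLittleO, Asymptotics.isLittleO_iff]
  intro c hc0
  set N := ‖a y‖ + 1 with hN
  have hN1 : 1 ≤ N := by have := norm_nonneg (a y); linarith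
  have hδ : 0 < min 1 (c / 2) := by positivity
  obtain ⟨r, hr, hra⟩ := Metric.continuousAt_iff.mp (hc.continuousAt (x := y)) (min 1 (c / 2)) hδ
  have hr' : 0 < min r (c / (2 * N * N)) := by positivity
  filter_upwards [Metric.ball_mem_nhds y hr'] with x hx
  rw [Metric.mem_ball, dist_eq_norm] at hx
  set w := x - y with hw
  have hw1 : ‖w‖ < r := hx.trans_le (min_le_left _ _)
  have hw2 : ‖w‖ ≤ c / (2 * N * N) := (hx.trans_le (min_le_right _ _)).le
  have hB : ∀ s ∈ Icc (0 : ℝ) 1, ‖a (y + s • w) - a y‖ ≤ min 1 (c / 2) := by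
    intro s hs
    have : dist (y + s • w) y < r := by
      rw [dist_eq_norm, add_sub_cancel_left, norm_smul, Real.norm_eq_abs, abs_of_nonneg hs.1]
      exact (mul_le_of_le_one_left (norm_nonneg _) hs.2).trans_lt hw1
    have := hra this
    rw [dist_eq_norm] at this
    exact this.le
  have hBn : ∀ s ∈ Icc (0 : ℝ) 1, ‖segCoef a x y s‖ ≤ N * ‖w‖ := by
    intro s hs
    refine (ContinuousLinearMap.le_opNorm _ _).trans ?_
    gcongr
    calc ‖a (y + s • w)‖ = ‖(a (y + s • w) - a y) + a y‖ := by rw [sub_add_cancel]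
      _ ≤ 1 + ‖a y‖ := (norm_add_le _ _).trans
        (by gcongr; exact (hB s hs).trans (min_le_left _ _))
      _ = N := by rw [hN, add_comm]
  obtain ⟨U, hU, hUd⟩ := exists_isTransport (continuous_segCoef hc x y) (star_segCoef ha x y)
  have hUn : ∀ s ∈ Icc (0 : ℝ) 1, ‖U s‖ ≤ 1 := fun s hs =>
    norm_le_one_of_star_mul (hU.star_mul_self (star_segCoef ha x y) hs)
  have hU1 : ∀ s ∈ Icc (0 : ℝ) 1, ‖U s - 1‖ ≤ N * ‖w‖ := by
    intro s hs
    have := norm_image_sub_le_of_norm_deriv_le_segment' (f := U) (a := 0) (b := 1)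
      (C := N * ‖w‖) (fun t ht => (hUd t ht).hasDerivWithinAt) (fun t ht => by
        rw [norm_neg]
        have ht' : t ∈ Icc (0 : ℝ) 1 := ⟨ht.1, ht.2.le⟩
        calc _ ≤ ‖segCoef a x y t‖ * ‖U t‖ := norm_mul_le _ _
          _ ≤ (N * ‖w‖) * 1 := mul_le_mul (hBn t ht') (hUn t ht') (norm_nonneg _) (by positivity)
          _ = _ := mul_one _) s hs
    rw [hU.zero] at this
    refine this.trans ?_
    rw [sub_zero]
    exact mul_le_of_le_one_right (by positivity) hs.2
  have key := norm_image_sub_le_of_norm_deriv_le_segment_01' (f := fun s => U s + s • a y w)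
    (f' := fun s => -(segCoef a x y s * U s) + (1 : ℝ) • a y w) (C := c * ‖w‖)
    (fun t ht => ((hUd t ht).add ((hasDerivAt_id t).smul_const _)).hasDerivWithinAt)
    (fun t ht => by
      have ht' : t ∈ Icc (0 : ℝ) 1 := ⟨ht.1, ht.2.le⟩
      have e : -(segCoef a x y t * U t) + (1 : ℝ) • a y w =
          -((a (y + t • w) - a y) w) - segCoef a x y t * (U t - 1) := by
        simp only [segCoef, ← hw, one_smul, mul_sub, mul_one, sub_apply]
        abel
      rw [e]
      have h1 : ‖(a (y + t • w) - a y) w‖ ≤ c / 2 * ‖w‖ :=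
        (ContinuousLinearMap.le_opNorm _ _).trans
          (by gcongr; exact (hB t ht').trans (min_le_right _ _))
      have h2 : ‖segCoef a x y t * (U t - 1)‖ ≤ c / 2 * ‖w‖ := by
        calc _ ≤ ‖segCoef a x y t‖ * ‖U t - 1‖ := norm_mul_le _ _
          _ ≤ (N * ‖w‖) * (N * ‖w‖) :=
            mul_le_mul (hBn t ht') (hU1 t ht') (norm_nonneg _) (by positivity)
          _ = (N * N * ‖w‖) * ‖w‖ := by ring
          _ ≤ c / 2 * ‖w‖ := by
            gcongr
            calc N * N * ‖w‖ ≤ N * N * (c / (2 * N * N)) := by gcongr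
              _ = c / 2 := by field_simp
      calc _ ≤ ‖(a (y + t • w) - a y) w‖ + ‖segCoef a x y t * (U t - 1)‖ := by
            refine (norm_sub_le _ _).trans ?_
            rw [norm_neg]
        _ ≤ c * ‖w‖ := by linarith)
  rw [segTransport_self, segTransport, hU.transport_eq (star_segCoef ha x y)]
  rw [hU.zero] at key
  refine (le_of_eq (congrArg norm ?_)).trans key
  rw [one_smul, zero_smul, add_zero, neg_apply]
  abel

/-- A map that commutes with the transports along all segments in a ball is covariantly constant
there. No regularity is assumed. -/
theorem hasFDerivAt_of_segTransport (hc : Continuous a) (ha : ∀ y v, star (a y v) = -a y v)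
    {Q : E → 𝔸} {y₀ : E} {r : ℝ}
    (hQ : ∀ x ∈ Metric.ball y₀ r, ∀ y ∈ Metric.ball y₀ r,
      Q x * segTransport a x y = segTransport a x y * Q y) {y : E} (hy : y ∈ Metric.ball y₀ r) :
    HasFDerivAt Q ((ContinuousLinearMap.mul ℝ 𝔸 (Q y)).comp (a y) -
      ((ContinuousLinearMap.mul ℝ 𝔸).flip (Q y)).comp (a y)) y := by
  have h := hasFDerivAt_segTransport hc ha y
  have h2 := (h.mul_const' (Q y)).mul' h.star
  refine (h2.congr_of_eventuallyEq (f₁ := Q) ?_).congr_fderiv ?_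
  · filter_upwards [Metric.isOpen_ball.mem_nhds hy] with x hx
    change Q x = segTransport a x y * Q y * star (segTransport a x y)
    rw [← hQ x hx y hy, mul_assoc, segTransport_mul_star_self hc ha, mul_one]
  · ext v
    simp [segTransport_self, ha]
    abel

/-- Bootstrapping the equation `dQ = [Q, a]` gives smoothness. -/
theorem contDiffOn_of_segTransport (hc : ContDiff ℝ ∞ a) (ha : ∀ y v, star (a y v) = -a y v)
    {Q : E → 𝔸} {y₀ : E} {r : ℝ}
    (hQ : ∀ x ∈ Metric.ball y₀ r, ∀ y ∈ Metric.ball y₀ r,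
      Q x * segTransport a x y = segTransport a x y * Q y) :
    ContDiffOn ℝ ∞ Q (Metric.ball y₀ r) := by
  have hd := fun y (hy : y ∈ Metric.ball y₀ r) =>
    hasFDerivAt_of_segTransport hc.continuous ha hQ hy
  rw [contDiffOn_infty]
  intro k
  induction k with
  | zero =>
    exact contDiffOn_zero.mpr fun y hy => (hd y hy).continuousAt.continuousWithinAt
  | succ k ih =>
    have : ((k + 1 : ℕ) : WithTop ℕ∞) = (k : WithTop ℕ∞) + 1 := by push_cast; rfl
    rw [this, contDiffOn_succ_iff_fderiv_of_isOpen Metric.isOpen_ball]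
    refine ⟨fun y hy => (hd y hy).differentiableAt.differentiableWithinAt, by simp, ?_⟩
    have hak : ContDiffOn ℝ k a (Metric.ball y₀ r) :=
      (hc.of_le (by exact_mod_cast le_top)).contDiffOn
    refine ContDiffOn.congr (f := fun y => (ContinuousLinearMap.mul ℝ 𝔸 (Q y)).comp (a y) -
      ((ContinuousLinearMap.mul ℝ 𝔸).flip (Q y)).comp (a y)) ?_ fun y hy => (hd y hy).fderiv
    exact (((ContinuousLinearMap.mul ℝ 𝔸).contDiff.comp_contDiffOn ih).clm_comp hak).sub
      (((ContinuousLinearMap.mul ℝ 𝔸).flip.contDiff.comp_contDiffOn ih).clm_comp hak)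

end Flat


/-! ### Holonomy and parallel fields -/

theorem zero_sub_commutator {R : Type*} [Ring R] (P A : R) :
    0 - (P * A - A * P) = (1 - P) * A - A * (1 - P) := by
  noncomm_ring

theorem star_conj_skew {R : Type*} [Ring R] [StarRing R] {P A : R} (hP : star P = P)
    (hA : star A = -A) : star (P * A * P) = -(P * A * P) := by
  rw [star_mul, star_mul, hP, hA, neg_mul, mul_neg, mul_assoc]

section Holonomy

variable {n : ℕ} {M : Type*} [TopologicalSpace M] [ChartedSpace (EuclideanSpace ℝ (Fin n)) M]
  [IsManifold (𝓡 n) ∞ M]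

namespace UnitaryConnection

/-- The coefficient of the transport equation along `c`: the connection form evaluated on the
velocity of `c`. -/
def coef {L : Subbundle n M} (D : UnitaryConnection L) (c : ℝ → M) (t : ℝ) : EndFibre :=
  D.form (c t) (mfderiv 𝓘(ℝ, ℝ) (𝓡 n) c t (1 : ℝ))

variable {L : Subbundle n M} (D : UnitaryConnection L)

theorem star_coef (c : ℝ → M) (t : ℝ) : star (D.coef c t) = -D.coef c t := D.skew _ _

theorem IsParallelAlong.sub {c : ℝ → M} {u v : ℝ → Fibre} (hu : D.IsParallelAlong c u)
    (hv : D.IsParallelAlong c v) : D.IsParallelAlong c (fun t => u t - v t) := by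
  classical
  obtain ⟨hu1, hu2, s, hs⟩ := hu
  obtain ⟨hv1, hv2, s', hs'⟩ := hv
  refine ⟨hu1.sub hv1, fun t ht => by rw [map_sub, hu2 t ht, hv2 t ht], s ∪ s', fun t ht hts => ?_⟩
  rw [Finset.mem_union, not_or] at hts
  obtain ⟨h1, h2⟩ := hs t ht hts.1
  obtain ⟨h3, h4⟩ := hs' t ht hts.2
  refine ⟨h1.sub h3, ?_⟩
  have : deriv (fun t => u t - v t) t = deriv u t - deriv v t := deriv_fun_sub h1 h3
  rw [this, map_sub, map_sub]
  rw [sub_add_sub_comm]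
  refine (congrArg₂ (· - ·) h2 h4).trans (sub_zero _)

/-- Parallel sections have constant norm, since the connection is unitary. -/
theorem IsParallelAlong.norm_eq {c : ℝ → M} {u : ℝ → Fibre} (hu : D.IsParallelAlong c u) {t : ℝ}
    (ht : t ∈ Icc (0 : ℝ) 1) : ‖u t‖ = ‖u 0‖ := by
  obtain ⟨hu1, hu2, s, hs⟩ := hu
  have key := eq_left_of_hasDerivAt_zero_off_finset (f := fun t => inner ℂ (u t) (u t))
    (hu1.inner hu1) s (fun t ht hts => by
      obtain ⟨h1, h2⟩ := hs t ht hts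
      refine (h1.hasDerivAt.inner ℂ h1.hasDerivAt).congr_deriv ?_
      have hP : star (L.proj (c t)) = L.proj (c t) := (L.isStarProjection (c t)).isSelfAdjoint
      have hPu := hu2 t ⟨ht.1.le, ht.2.le⟩
      have e1 : L.proj (c t) (deriv u t) = -(D.coef c t (u t)) := eq_neg_of_add_eq_zero_left h2
      have e2 : inner ℂ (u t) (deriv u t) = -inner ℂ (u t) (D.coef c t (u t)) := by
        rw [← inner_neg_right, ← e1]
        conv_lhs => rw [← hPu]
        rw [← ContinuousLinearMap.adjoint_inner_right, ← ContinuousLinearMap.star_eq_adjoint, hP]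
      have e3 : inner ℂ (deriv u t) (u t) = inner ℂ (u t) (D.coef c t (u t)) := by
        rw [← inner_conj_symm, e2, map_neg, inner_conj_symm,
          ← ContinuousLinearMap.adjoint_inner_right, ← ContinuousLinearMap.star_eq_adjoint,
          D.star_coef]
        simp
      rw [e2, e3, neg_add_cancel]) ht
  simp only [inner_self_eq_norm_sq_to_K] at key
  have h2 : ‖u t‖ ^ 2 = ‖u 0‖ ^ 2 := by exact_mod_cast key
  exact (pow_left_inj₀ (norm_nonneg _) (norm_nonneg _) two_ne_zero).mp h2

theorem hol_eq {c : ℝ → M} {u : ℝ → Fibre} (hu : D.IsParallelAlong c u) :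
    D.hol c (u 0) = u 1 := by
  have h : ∃ v, D.IsParallelAlong c v ∧ v 0 = u 0 := ⟨u, hu, rfl⟩
  rw [hol, dif_pos h]
  have h1 : (1 : ℝ) ∈ Icc (0 : ℝ) 1 := by simp
  have := IsParallelAlong.norm_eq D (IsParallelAlong.sub D h.choose_spec.1 hu) h1
  rw [h.choose_spec.2, sub_self, norm_zero, norm_eq_zero] at this
  exact sub_eq_zero.mp this

end UnitaryConnection

variable (D : UnitaryConnection (trivialBundle n M))

theorem isParallelAlong_of_isTransport {c : ℝ → M} {U : ℝ → EndFibre}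
    (hU : IsTransport (D.coef c) U) (v : Fibre) : D.IsParallelAlong c (fun t => U t v) := by
  obtain ⟨s, hs⟩ := hU.deriv
  refine ⟨hU.cont.clm_apply continuousOn_const, fun t _ => rfl, s, fun t ht hts => ?_⟩
  have h := hasDerivAt_apply_vec (hs t ht hts) (hasDerivAt_const t v)
  refine ⟨h.differentiableAt, ?_⟩
  rw [h.deriv]
  change (-(D.coef c t * U t)) v + U t 0 + D.coef c t (U t v) = 0
  simp

theorem hol_eq_of_isTransport {c : ℝ → M} {U : ℝ → EndFibre} (hU : IsTransport (D.coef c) U)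
    (v : Fibre) : D.hol c v = U 1 v := by
  have := D.hol_eq (isParallelAlong_of_isTransport D hU v)
  simpa [hU.zero] using this

/-- A field of projections in the fibres of the trivial bundle that is parallel for the connection
induced on the endomorphism bundle. -/
structure IsParallelField (Q : M → EndFibre) : Prop where
  smooth : ContMDiff (𝓡 n) 𝓘(ℝ, EndFibre) ∞ Q
  isStarProjection : ∀ m, IsStarProjection (Q m)
  mfderiv_eq : ∀ m (v : TangentSpace (𝓡 n) m),
    mfderiv (𝓡 n) 𝓘(ℝ, EndFibre) Q m v = Q m * D.form m v - D.form m v * Q m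

namespace IsParallelField

variable {D} {Q : M → EndFibre} (hQ : IsParallelField D Q)
include hQ

theorem one_sub : IsParallelField D (fun m => 1 - Q m) where
  smooth := contMDiff_const.sub hQ.smooth
  isStarProjection m := (hQ.isStarProjection m).one_sub
  mfderiv_eq m v := by
    have h := (hQ.smooth.mdifferentiableAt (by simp) : MDifferentiableAt _ _ Q m).hasMFDerivAt
    have h2 := (hasMFDerivAt_const (I := 𝓡 n) (I' := 𝓘(ℝ, EndFibre)) (1 : EndFibre) m).sub h
    have h3 := h2.mfderiv
    change mfderiv (𝓡 n) 𝓘(ℝ, EndFibre) (fun m => 1 - Q m) m = _ at h3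
    rw [h3]
    refine (congrArg (fun T : EndFibre => (0 : EndFibre) - T) (hQ.mfderiv_eq m v)).trans ?_
    exact zero_sub_commutator _ _

theorem hasDerivAt_comp {c : ℝ → M} {t : ℝ} (hc : MDifferentiableAt 𝓘(ℝ, ℝ) (𝓡 n) c t) :
    HasDerivAt (fun s => Q (c s)) (Q (c t) * D.coef c t - D.coef c t * Q (c t)) t := by
  have h := (hQ.smooth.mdifferentiableAt (by simp) : MDifferentiableAt _ _ Q (c t)).hasMFDerivAt
  have h2 : HasFDerivAt (𝕜 := ℝ) (E := ℝ) (F := EndFibre) (fun s => Q (c s)) _ t :=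
    (h.comp t hc.hasMFDerivAt).hasFDerivAt
  refine h2.hasDerivAt.congr_deriv ?_
  exact hQ.mfderiv_eq (c t) _

theorem isParallelAlong {c : ℝ → M} (hc : ContinuousOn c (Icc 0 1)) {s : Finset ℝ}
    (hcd : ∀ t ∈ Ioo (0 : ℝ) 1, t ∉ s → MDifferentiableAt 𝓘(ℝ, ℝ) (𝓡 n) c t) {u : ℝ → Fibre}
    (hu : D.IsParallelAlong c u) : D.IsParallelAlong c (fun t => Q (c t) (u t)) := by
  classical
  obtain ⟨hu1, hu2, s', hs'⟩ := hu
  refine ⟨(hQ.smooth.continuous.comp_continuousOn hc).clm_apply hu1, fun t _ => rfl, s ∪ s',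
    fun t ht hts => ?_⟩
  rw [Finset.mem_union, not_or] at hts
  obtain ⟨h1, h2⟩ := hs' t ht hts.2
  have h := hasDerivAt_apply_vec (hQ.hasDerivAt_comp (hcd t ht hts.1)) h1.hasDerivAt
  have e1 : deriv u t = -(D.coef c t (u t)) := eq_neg_of_add_eq_zero_left h2
  refine ⟨h.differentiableAt, ?_⟩
  rw [h.deriv, e1]
  change (Q (c t) * D.coef c t - D.coef c t * Q (c t)) (u t) + Q (c t) (-(D.coef c t (u t))) +
    D.coef c t (Q (c t) (u t)) = 0
  simp only [sub_apply, mul_apply_eq_comp, map_neg]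
  abel

/-- Holonomy preserves the ranges of a parallel field. -/
theorem hol_mem {c : ℝ → M} (hc : ContinuousOn c (Icc 0 1)) {s : Finset ℝ}
    (hcd : ∀ t ∈ Ioo (0 : ℝ) 1, t ∉ s → MDifferentiableAt 𝓘(ℝ, ℝ) (𝓡 n) c t) {v : Fibre}
    (hv : Q (c 0) v = v) : Q (c 1) (D.hol c v) = D.hol c v := by
  by_cases h : ∃ u, D.IsParallelAlong c u ∧ u 0 = v
  · obtain ⟨u, hu, rfl⟩ := h
    have h1 := D.hol_eq (hQ.isParallelAlong hc hcd hu)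
    rw [hv] at h1
    rw [h1]
    exact congrArg (fun T : EndFibre => T (u 1)) (hQ.isStarProjection (c 1)).isIdempotentElem
  · -- without a parallel section the holonomy is `0` by definition
    rw [UnitaryConnection.hol, dif_neg h, map_zero]

end IsParallelField

/-- The range of a parallel field as a subbundle. -/
def IsParallelField.subbundle {D : UnitaryConnection (trivialBundle n M)} {Q : M → EndFibre}
    (hQ : IsParallelField D Q) : Subbundle n M :=
  ⟨Q, hQ.smooth, hQ.isStarProjection⟩

/-- The restriction of a connection on the trivial bundle to the range of a parallel field `Q`. Its
one-form is `Q A Q`. -/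
def IsParallelField.connection {D : UnitaryConnection (trivialBundle n M)} {Q : M → EndFibre}
    (hQ : IsParallelField D Q) : UnitaryConnection hQ.subbundle where
  form m := ((ContinuousLinearMap.mul ℝ EndFibre).flip (Q m)).comp
    (((ContinuousLinearMap.mul ℝ EndFibre) (Q m)).comp (D.form m))
  smooth := by
    have h1 : ContMDiff (𝓡 n).tangent 𝓘(ℝ, EndFibre) ∞
        fun p : TangentBundle (𝓡 n) M => Q p.1 := hQ.smooth.comp (Bundle.contMDiff_proj _)
    have h2 : ContDiff ℝ ∞ fun z : EndFibre × EndFibre => z.1 * z.2 * z.1 :=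
      (contDiff_fst.mul contDiff_snd).mul contDiff_fst
    exact h2.contMDiff.comp (h1.prodMk_space D.smooth)
  skew m v := by
    have h := (hQ.isStarProjection m).isSelfAdjoint.star_eq
    exact star_conj_skew h (D.skew m v)
  compress m v := by
    have h : Q m * Q m = Q m := (hQ.isStarProjection m).isIdempotentElem
    change Q m * (Q m * D.form m v * Q m) * Q m = Q m * D.form m v * Q m
    rw [mul_assoc, mul_assoc _ (Q m) (Q m), h, ← mul_assoc, ← mul_assoc, h]

/-- On the range of a parallel field, the holonomies of the connection and of its restriction
agree. -/
theorem IsParallelField.hol_connection {D : UnitaryConnection (trivialBundle n M)}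
    {Q : M → EndFibre} (hQ : IsParallelField D Q) {c : ℝ → M} (hc : ContinuousOn c (Icc 0 1))
    {s : Finset ℝ}
    (hcd : ∀ t ∈ Ioo (0 : ℝ) 1, t ∉ s → MDifferentiableAt 𝓘(ℝ, ℝ) (𝓡 n) c t)
    {U : ℝ → EndFibre} (hU : IsTransport (D.coef c) U) {v : Fibre} (hv : Q (c 0) v = v) :
    hQ.connection.hol c v = D.hol c v := by
  have hpar := isParallelAlong_of_isTransport D hU v
  have hsub := UnitaryConnection.IsParallelAlong.sub D hpar (hQ.isParallelAlong hc hcd hpar)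
  have hQu : ∀ t ∈ Icc (0 : ℝ) 1, Q (c t) (U t v) = U t v := by
    intro t ht
    have := UnitaryConnection.IsParallelAlong.norm_eq D hsub ht
    rw [hU.zero] at this
    change _ = ‖v - Q (c 0) v‖ at this
    rw [hv, sub_self, norm_zero, norm_eq_zero, sub_eq_zero] at this
    exact this.symm
  have hpar' : hQ.connection.IsParallelAlong c (fun t => U t v) := by
    obtain ⟨h1, -, s', h3⟩ := hpar
    refine ⟨h1, hQu, s', fun t ht hts => ⟨(h3 t ht hts).1, ?_⟩⟩
    have h4 := (h3 t ht hts).2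
    change deriv (fun t => U t v) t + D.coef c t (U t v) = 0 at h4
    change Q (c t) (deriv (fun t => U t v) t) + Q (c t) (D.coef c t (Q (c t) (U t v))) = 0
    rw [hQu t ⟨ht.1.le, ht.2.le⟩, ← map_add, h4, map_zero]
  have := hQ.connection.hol_eq hpar'
  rw [hU.zero] at this
  rw [hol_eq_of_isTransport D hU]
  exact this

end Holonomy


/-! ### Connection forms in charts -/

theorem contDiff_smul_of_tsupport_subset {E F : Type*} [NormedAddCommGroup E] [NormedSpace ℝ E]
    [NormedAddCommGroup F] [NormedSpace ℝ F] {b : E → ℝ} {A : E → F} {U : Set E} (hU : IsOpen U)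
    (hb : ContDiff ℝ ∞ b) (hbU : tsupport b ⊆ U) (hA : ContDiffOn ℝ ∞ A U) :
    ContDiff ℝ ∞ fun y => b y • A y := by
  rw [contDiff_iff_contDiffAt]
  intro y
  by_cases hy : y ∈ U
  · exact hb.contDiffAt.smul (hA.contDiffAt (hU.mem_nhds hy))
  · refine (contDiffAt_const (c := 0)).congr_of_eventuallyEq ?_
    filter_upwards [(isClosed_tsupport b).isOpen_compl.mem_nhds fun h => hy (hbU h)] with z hz
    rw [image_eq_zero_of_notMem_tsupport hz, zero_smul]

section ChartForm

variable {n : ℕ} {M : Type*} [TopologicalSpace M] [ChartedSpace (EuclideanSpace ℝ (Fin n)) M]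

variable (n) in
theorem exists_chartRadius (p : M) : ∃ r > (0 : ℝ),
    Metric.closedBall (extChartAt (𝓡 n) p p) (2 * r) ⊆ (extChartAt (𝓡 n) p).target := by
  obtain ⟨r, hr, h⟩ := Metric.nhds_basis_closedBall.mem_iff.mp
    ((isOpen_extChartAt_target (I := 𝓡 n) p).mem_nhds (mem_extChartAt_target p))
  exact ⟨r / 2, by positivity, by rwa [mul_div_cancel₀ _ two_ne_zero]⟩

variable (n) in
/-- A radius such that the chart at `p` contains the closed ball of twice this radius. -/
def chartRadius (p : M) : ℝ := (exists_chartRadius n p).choose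

theorem chartRadius_pos (p : M) : 0 < chartRadius n p := (exists_chartRadius n p).choose_spec.1

theorem closedBall_subset_target (p : M) :
    Metric.closedBall (extChartAt (𝓡 n) p p) (2 * chartRadius n p) ⊆
      (extChartAt (𝓡 n) p).target := (exists_chartRadius n p).choose_spec.2

variable (n) in
/-- The ball around `p` in the coordinates of the chart at `p` on which calculations take place. -/
def chartBall (p : M) : Set (EuclideanSpace ℝ (Fin n)) :=
  Metric.ball (extChartAt (𝓡 n) p p) (chartRadius n p)

theorem chartBall_subset_target (p : M) : chartBall n p ⊆ (extChartAt (𝓡 n) p).target :=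
  (Metric.ball_subset_closedBall.trans (Metric.closedBall_subset_closedBall
    (by linarith [chartRadius_pos (n := n) p]))).trans (closedBall_subset_target p)

theorem center_mem_chartBall (p : M) : extChartAt (𝓡 n) p p ∈ chartBall n p :=
  Metric.mem_ball_self (chartRadius_pos p)

variable [IsManifold (𝓡 n) ∞ M] (D : UnitaryConnection (trivialBundle n M))

theorem exists_chartForm (p : M) :
    ∃ a : EuclideanSpace ℝ (Fin n) → EuclideanSpace ℝ (Fin n) →L[ℝ] EndFibre,
      ContDiff ℝ ∞ a ∧ (∀ y v, star (a y v) = -a y v) ∧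
      ∀ y ∈ chartBall n p, ∀ v,
        a y v = D.form ((extChartAt (𝓡 n) p).symm y) (chartInvDeriv p y v) := by
  set φ := extChartAt (𝓡 n) p with hφ
  have hr := chartRadius_pos (n := n) p
  let b : ContDiffBump (φ p) := ⟨chartRadius n p, 2 * chartRadius n p, hr, by linarith⟩
  let A : EuclideanSpace ℝ (Fin n) → EuclideanSpace ℝ (Fin n) →L[ℝ] EndFibre :=
    fun y => (D.form (φ.symm y)).comp (chartInvDeriv p y)
  have hA : ContDiffOn ℝ ∞ A φ.target := by
    rw [contDiffOn_clm_apply]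
    intro v
    have h1 := D.smooth.comp_contMDiffOn ((contMDiffOn_coordField p v).comp
      (contMDiffOn_extChartAt_symm p) φ.mapsTo_symm)
    rw [← contMDiffOn_iff_contDiffOn]
    refine h1.congr fun y hy => ?_
    change D.form (φ.symm y) (chartInvDeriv p y v) =
      D.form (φ.symm y) (coordField p v (φ.symm y))
    rw [coordField_symm hy]
  refine ⟨fun y => b y • A y, ?_, fun y v => ?_, fun y hy v => ?_⟩
  · refine contDiff_smul_of_tsupport_subset (isOpen_extChartAt_target p) b.contDiff ?_ hA
    rw [b.tsupport_eq]
    exact closedBall_subset_target p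
  · change star (b y • D.form _ _) = -(b y • D.form _ _)
    rw [star_smul, D.skew, smul_neg]
    rfl
  · have : b y = 1 := b.one_of_mem_closedBall (Metric.ball_subset_closedBall hy)
    change b y • D.form _ _ = _
    rw [this, one_smul]
    rfl

/-- The connection form in the coordinates of the chart at `p`, extended to a smooth one-form on the
whole model space. The extension agrees with the connection form on `chartBall n p`. -/
def chartForm (p : M) :
    EuclideanSpace ℝ (Fin n) → EuclideanSpace ℝ (Fin n) →L[ℝ] EndFibre :=
  (exists_chartForm D p).choose

theorem contDiff_chartForm (p : M) : ContDiff ℝ ∞ (chartForm D p) :=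
  (exists_chartForm D p).choose_spec.1

theorem continuous_chartForm (p : M) : Continuous (chartForm D p) :=
  (contDiff_chartForm D p).continuous

theorem star_chartForm (p : M) (y v : EuclideanSpace ℝ (Fin n)) :
    star (chartForm D p y v) = -chartForm D p y v :=
  (exists_chartForm D p).choose_spec.2.1 y v

theorem chartForm_eq {p : M} {y : EuclideanSpace ℝ (Fin n)} (hy : y ∈ chartBall n p)
    (v : EuclideanSpace ℝ (Fin n)) :
    chartForm D p y v = D.form ((extChartAt (𝓡 n) p).symm y) (chartInvDeriv p y v) :=
  (exists_chartForm D p).choose_spec.2.2 y hy v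

/-- Along a curve in the chart at `p`, the coefficient of the transport equation is given by the
coordinate expression of the connection form. -/
theorem coef_chart_symm {p : M} {f : ℝ → EuclideanSpace ℝ (Fin n)}
    {w : EuclideanSpace ℝ (Fin n)} {t : ℝ} (hf : HasDerivAt f w t) (ht : f t ∈ chartBall n p) :
    D.coef (fun s => (extChartAt (𝓡 n) p).symm (f s)) t = chartForm D p (f t) w := by
  rw [UnitaryConnection.coef,
    (hasMFDerivAt_chart_symm_comp hf (chartBall_subset_target p ht)).mfderiv, chartForm_eq D ht]
  change D.form _ ((1 : ℝ) • _) = _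
  rw [one_smul]

theorem segment_mem_chartBall {p : M} {x y : EuclideanSpace ℝ (Fin n)} (hx : x ∈ chartBall n p)
    (hy : y ∈ chartBall n p) {t : ℝ} (ht : t ∈ Icc (0 : ℝ) 1) :
    y + t • (x - y) ∈ chartBall n p := by
  have := (convex_ball (extChartAt (𝓡 n) p p) (chartRadius n p)).add_smul_sub_mem hy hx ht
  exact this

/-- The transport along the coordinate segment from `y` to `x` in the chart at `p`. -/
def chartTransport (p : M) (x y : EuclideanSpace ℝ (Fin n)) : EndFibre :=
  segTransport (chartForm D p) x y

theorem star_chartTransport_mul_self (p : M) (x y : EuclideanSpace ℝ (Fin n)) :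
    star (chartTransport D p x y) * chartTransport D p x y = 1 :=
  star_segTransport_mul_self (continuous_chartForm D p) (star_chartForm D p) x y

theorem chartTransport_mul_star_self (p : M) (x y : EuclideanSpace ℝ (Fin n)) :
    chartTransport D p x y * star (chartTransport D p x y) = 1 :=
  segTransport_mul_star_self (continuous_chartForm D p) (star_chartForm D p) x y

theorem continuous_chartTransport (p : M) : Continuous
    fun z : EuclideanSpace ℝ (Fin n) × EuclideanSpace ℝ (Fin n) => chartTransport D p z.1 z.2 :=
  continuous_segTransport (continuous_chartForm D p) (star_chartForm D p)

/-- A field of projections that commutes with the transports along all short coordinate segments is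
smooth and parallel. -/
theorem isParallelField_of_chartTransport {Q : M → EndFibre} (hQ : ∀ m, IsStarProjection (Q m))
    (h : ∀ p : M, ∃ r > 0, r ≤ chartRadius n p ∧
      ∀ x ∈ Metric.ball (extChartAt (𝓡 n) p p) r, ∀ y ∈ Metric.ball (extChartAt (𝓡 n) p p) r,
        Q ((extChartAt (𝓡 n) p).symm x) * chartTransport D p x y =
          chartTransport D p x y * Q ((extChartAt (𝓡 n) p).symm y)) :
    IsParallelField D Q := by
  have key : ∀ p : M, ContMDiffAt (𝓡 n) 𝓘(ℝ, EndFibre) ∞ Q p ∧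
      ∀ v : TangentSpace (𝓡 n) p, mfderiv (𝓡 n) 𝓘(ℝ, EndFibre) Q p v =
        Q p * D.form p v - D.form p v * Q p := by
    intro p
    obtain ⟨r, hr, hrp, hQr⟩ := h p
    set φ := extChartAt (𝓡 n) p with hφ
    have hφp : φ.symm (φ p) = p := φ.left_inv (mem_extChartAt_source p)
    have hev : Q =ᶠ[nhds p] (fun y => Q (φ.symm y)) ∘ φ := by
      filter_upwards [extChartAt_source_mem_nhds (I := 𝓡 n) p] with m hm
      exact congrArg Q (φ.left_inv hm).symm
    have hs : ContDiffAt ℝ ∞ (fun y => Q (φ.symm y)) (φ p) :=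
      (contDiffOn_of_segTransport (Q := fun y => Q (φ.symm y)) (contDiff_chartForm D p)
        (star_chartForm D p) hQr).contDiffAt (Metric.ball_mem_nhds _ hr)
    have hd := hasFDerivAt_of_segTransport (Q := fun y => Q (φ.symm y)) (continuous_chartForm D p)
        (star_chartForm D p) hQr (Metric.mem_ball_self hr)
    refine ⟨((hs.contMDiffAt.comp p (contMDiffAt_extChartAt (I := 𝓡 n))).congr_of_eventuallyEq
      hev), fun v => ?_⟩
    have hφd := (mdifferentiableAt_extChartAt (I := 𝓡 n) (x := p)
      (mem_chart_source _ p)).hasMFDerivAt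
    have hcomp := ((hd.hasMFDerivAt).comp p hφd).congr_of_eventuallyEq hev
    rw [hcomp.mfderiv]
    let dv : EuclideanSpace ℝ (Fin n) :=
      mfderiv (𝓡 n) 𝓘(ℝ, EuclideanSpace ℝ (Fin n)) (extChartAt (𝓡 n) p) p v
    have hv : chartForm D p (φ p) dv = D.form p v := by
      have h2 : ∀ q : M, ∀ hq : q = p, ∀ w : EuclideanSpace ℝ (Fin n),
          D.form q w = D.form p w := by
        rintro q rfl w
        rfl
      refine ((chartForm_eq D (center_mem_chartBall p) dv).trans (h2 _ hφp _)).trans ?_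
      refine congrArg (D.form p) ?_
      rw [chartInvDeriv_eq]
      exact congrArg (fun T => T v) (mfderivWithin_extChartAt_symm_comp_mfderiv_extChartAt'
        (I := 𝓡 n) (mem_extChartAt_source (I := 𝓡 n) p))
    have hfin : Q (φ.symm (φ p)) * chartForm D p (φ p) dv -
        chartForm D p (φ p) dv * Q (φ.symm (φ p)) = Q p * D.form p v - D.form p v * Q p := by
      rw [hv, hφp]
    exact hfin
  exact ⟨fun p => (key p).1, hQ, fun p => (key p).2⟩

end ChartForm


/-! ### Concatenation and reversal of curves -/

/-- The concatenation of two maps on `[0,1]`, run through at double speed. -/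
def concat {X : Type*} (f g : ℝ → X) (t : ℝ) : X := if t ≤ 1 / 2 then f (2 * t) else g (2 * t - 1)

theorem concat_left {X : Type*} {f g : ℝ → X} {t : ℝ} (ht : t ≤ 1 / 2) :
    concat f g t = f (2 * t) := if_pos ht

theorem concat_right {X : Type*} {f g : ℝ → X} (h : f 1 = g 0) {t : ℝ} (ht : 1 / 2 ≤ t) :
    concat f g t = g (2 * t - 1) := by
  rcases ht.eq_or_lt with rfl | ht
  · rw [concat_left le_rfl]
    norm_num [h]
  · exact if_neg (not_le.mpr ht)

theorem continuousOn_concat {X : Type*} [TopologicalSpace X] {f g : ℝ → X}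
    (hf : ContinuousOn f (Icc 0 1)) (hg : ContinuousOn g (Icc 0 1)) (h : f 1 = g 0) :
    ContinuousOn (concat f g) (Icc 0 1) := by
  have e : Icc (0 : ℝ) 1 = Icc 0 (1 / 2) ∪ Icc (1 / 2) 1 :=
    (Icc_union_Icc_eq_Icc (by norm_num) (by norm_num)).symm
  rw [e]
  refine ContinuousOn.union_of_isClosed ?_ ?_ isClosed_Icc isClosed_Icc
  · refine (hf.comp (f := fun t => 2 * t) (by fun_prop) ?_).congr fun t ht => concat_left ht.2
    intro t ht
    exact ⟨by linarith [ht.1], by linarith [ht.2]⟩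
  · refine (hg.comp (f := fun t => 2 * t - 1) (by fun_prop) ?_).congr
      fun t ht => concat_right h ht.1
    intro t ht
    exact ⟨by linarith [ht.1], by linarith [ht.2]⟩

theorem concat_eventuallyEq_left {X : Type*} (f g : ℝ → X) {t : ℝ} (ht : t < 1 / 2) :
    concat f g =ᶠ[nhds t] fun s => f (2 * s + 0) := by
  filter_upwards [Iio_mem_nhds ht] with s hs
  rw [concat_left (le_of_lt hs), add_zero]

theorem concat_eventuallyEq_right {X : Type*} {f g : ℝ → X} (h : f 1 = g 0) {t : ℝ}
    (ht : 1 / 2 < t) : concat f g =ᶠ[nhds t] fun s => g (2 * s + -1) := by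
  filter_upwards [Ioi_mem_nhds ht] with s hs
  rw [concat_right h (le_of_lt hs), sub_eq_add_neg]

theorem smul_neg_mul {R : Type*} [Ring R] [Algebra ℝ R] (r : ℝ) (b v : R) :
    r • (-(b * v)) = -(r • b * v) := by
  simp

theorem smul_neg_mul_mul {R : Type*} [Ring R] [Algebra ℝ R] (r : ℝ) (b v w : R) :
    r • (-(b * v)) * w = -(r • b * (v * w)) := by
  simp [mul_assoc]

section Reach

variable {n : ℕ} {M : Type*} [TopologicalSpace M] [ChartedSpace (EuclideanSpace ℝ (Fin n)) M]
  [IsManifold (𝓡 n) ∞ M]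

theorem IsPiecewiseSmooth.exists_mdifferentiableAt {c : ℝ → M} (hc : IsPiecewiseSmooth n c) :
    ∃ s : Finset ℝ, ∀ t ∈ Ioo (0 : ℝ) 1, t ∉ s → MDifferentiableAt 𝓘(ℝ, ℝ) (𝓡 n) c t := by
  obtain ⟨-, s, hs⟩ := hc
  refine ⟨s, fun t ht hts => ?_⟩
  have hnhds : Ioo (0 : ℝ) 1 ∩ (s : Set ℝ)ᶜ ∈ nhds t :=
    Filter.inter_mem (Ioo_mem_nhds ht.1 ht.2)
      (s.finite_toSet.isClosed.isOpen_compl.mem_nhds (by simpa using hts))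
  obtain ⟨ε, hε, h⟩ := Metric.mem_nhds_iff.mp hnhds
  have hsub : Ioo (t - ε) (t + ε) ⊆ Ioo (0 : ℝ) 1 ∩ (s : Set ℝ)ᶜ := by
    rwa [← Real.ball_eq_Ioo]
  have hin : ∀ r, |r - t| < ε → r ∈ Ioo (0 : ℝ) 1 ∩ (s : Set ℝ)ᶜ := fun r hr =>
    hsub ⟨by linarith [(abs_lt.mp hr).1], by linarith [(abs_lt.mp hr).2]⟩
  have h1 := hin (t - ε / 2) (by rw [abs_lt]; constructor <;> linarith)
  have h2 := hin (t + ε / 2) (by rw [abs_lt]; constructor <;> linarith)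
  have := hs (t - ε / 2) (t + ε / 2) h1.1.1.le (by linarith) h2.1.2.le (fun r hr hr' =>
    (hin r (by rw [abs_lt]; constructor <;> linarith [hr'.1, hr'.2])).2 hr)
  exact (this.contMDiffAt (Icc_mem_nhds (by linarith) (by linarith))).mdifferentiableAt (by simp)

/-- The coefficient of the transport equation after an affine change of the parameter. -/
theorem coef_comp_affine {L : Subbundle n M} (D : UnitaryConnection L) {c γ : ℝ → M} {α β t : ℝ}
    (hc : MDifferentiableAt 𝓘(ℝ, ℝ) (𝓡 n) c (α * t + β))
    (hγ : γ =ᶠ[nhds t] fun s => c (α * s + β)) :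
    D.coef γ t = α • D.coef c (α * t + β) := by
  have haff : HasDerivAt (fun s : ℝ => α * s + β) α t := by
    simpa using ((hasDerivAt_id t).const_mul α).add_const β
  have h := (hc.hasMFDerivAt.comp t haff.hasFDerivAt.hasMFDerivAt).congr_of_eventuallyEq hγ
  rw [UnitaryConnection.coef, h.mfderiv]
  have hpt : γ t = c (α * t + β) := hγ.eq_of_nhds
  have h2 : ∀ q : M, ∀ hq : q = c (α * t + β), ∀ w : EuclideanSpace ℝ (Fin n),
      D.form q w = D.form (c (α * t + β)) w := by
    rintro q rfl w
    rfl
  refine (h2 _ hpt _).trans ?_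
  have h3 : ∀ T : ℝ →L[ℝ] TangentSpace (𝓡 n) (c (α * t + β)),
      D.form (c (α * t + β)) (T ((1 : ℝ) • α)) = α • D.form (c (α * t + β)) (T 1) := by
    intro T
    rw [one_smul, ← map_smul, ← map_smul, smul_eq_mul, mul_one]
  exact h3 _

variable (D : UnitaryConnection (trivialBundle n M))

/-- `U` is the parallel transport along some piecewise smooth curve from `x` to `y`. -/
def Reach (x y : M) (U : EndFibre) : Prop :=
  ∃ c : ℝ → M, IsPiecewiseSmooth n c ∧ c 0 = x ∧ c 1 = y ∧
    ∃ V : ℝ → EndFibre, IsTransport (D.coef c) V ∧ V 1 = U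

variable {D}

theorem Reach.star_mul_self {x y : M} {U : EndFibre} (h : Reach D x y U) : star U * U = 1 := by
  obtain ⟨c, -, -, -, V, hV, rfl⟩ := h
  exact hV.star_mul_self (D.star_coef c) (by simp)

theorem Reach.mul_star_self {x y : M} {U : EndFibre} (h : Reach D x y U) : U * star U = 1 :=
  mul_eq_one_symm h.star_mul_self

theorem Reach.symm {x y : M} {U : EndFibre} (h : Reach D x y U) : Reach D y x (star U) := by
  classical
  obtain ⟨c, hc, hc0, hc1, V, hV, hVU⟩ := h
  obtain ⟨s', hs'⟩ := hc.exists_mdifferentiableAt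
  obtain ⟨hcc, s, hs⟩ := hc
  have hmaps : MapsTo (fun t : ℝ => 1 - t) (Icc 0 1) (Icc 0 1) := fun t ht =>
    ⟨by linarith [ht.2], by linarith [ht.1]⟩
  have hU := hV.mul_star_self (D.star_coef c) (t := 1) (by simp)
  refine ⟨fun t => c (1 - t), ⟨hcc.comp (by fun_prop) hmaps, s.image (fun t => 1 - t), ?_⟩,
    by simp [hc1], by simp [hc0], fun t => V (1 - t) * star (V 1), ⟨?_, ?_, ?_⟩, ?_⟩
  · intro a b ha hab hb hst
    have h1 := hs (1 - b) (1 - a) (by linarith) (by linarith) (by linarith) (fun t ht ht' =>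
      hst (1 - t) (Finset.mem_image_of_mem _ ht) ⟨by linarith [ht'.2], by linarith [ht'.1]⟩)
    have h2 : ContMDiff 𝓘(ℝ, ℝ) 𝓘(ℝ, ℝ) ∞ fun t : ℝ => 1 - t :=
      (contDiff_const.sub contDiff_id).contMDiff
    exact h1.comp h2.contMDiffOn fun t ht => ⟨by linarith [ht.2], by linarith [ht.1]⟩
  · simpa using hU
  · exact (hV.cont.comp (f := fun t => 1 - t) (by fun_prop) hmaps).mul continuousOn_const
  · obtain ⟨s2, hs2⟩ := hV.deriv
    refine ⟨s'.image (fun t => 1 - t) ∪ s2.image (fun t => 1 - t), fun t ht hts => ?_⟩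
    rw [Finset.mem_union, not_or] at hts
    have ht1 : (1 : ℝ) - t ∈ Ioo (0 : ℝ) 1 := ⟨by linarith [ht.2], by linarith [ht.1]⟩
    have hn : ∀ u : Finset ℝ, t ∉ u.image (fun t => 1 - t) → 1 - t ∉ u := fun u hu h =>
      hu (Finset.mem_image.mpr ⟨1 - t, h, by ring⟩)
    have hd := hs2 (1 - t) ht1 (hn _ hts.2)
    have hd2 := (hd.scomp t ((hasDerivAt_id t).const_sub 1)).mul_const (star (V 1))
    have hcoef : D.coef (fun t => c (1 - t)) t = (-1 : ℝ) • D.coef c (1 - t) := by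
      have e : (1 : ℝ) - t = -1 * t + 1 := by ring
      have := coef_comp_affine D (c := c) (γ := fun t => c (1 - t)) (α := -1) (β := 1) (t := t)
        (by rw [← e]; exact hs' _ ht1 (hn _ hts.1))
        (Filter.Eventually.of_forall fun s => by
          change c (1 - s) = c (-1 * s + 1)
          congr 1; ring)
      rw [this, ← e]
    exact hd2.congr_deriv (by rw [hcoef]; exact smul_neg_mul_mul _ _ _ _)
  · simp [hV.zero, hVU]

theorem Reach.trans {x y z : M} {U U' : EndFibre} (h : Reach D x y U) (h' : Reach D y z U') :
    Reach D x z (U' * U) := by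
  classical
  obtain ⟨c₁, hc₁, hx, hy, V₁, hV₁, rfl⟩ := h
  obtain ⟨c₂, hc₂, hy', hz, V₂, hV₂, rfl⟩ := h'
  obtain ⟨d₁, hd₁⟩ := hc₁.exists_mdifferentiableAt
  obtain ⟨d₂, hd₂⟩ := hc₂.exists_mdifferentiableAt
  obtain ⟨hcc₁, s₁, hs₁⟩ := hc₁
  obtain ⟨hcc₂, s₂, hs₂⟩ := hc₂
  obtain ⟨r₁, hr₁⟩ := hV₁.deriv
  obtain ⟨r₂, hr₂⟩ := hV₂.deriv
  have hcc : c₁ 1 = c₂ 0 := by rw [hy, hy']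
  have hVV : V₁ 1 = V₂ 0 * V₁ 1 := by rw [hV₂.zero, one_mul]
  let i₁ : ℝ → ℝ := fun t => t / 2
  let i₂ : ℝ → ℝ := fun t => (t + 1) / 2
  have hi₁ : ∀ (u : Finset ℝ) (t : ℝ), t ∉ u.image i₁ → 2 * t ∉ u := fun u t hu h =>
    hu (Finset.mem_image.mpr ⟨2 * t, h, by simp [i₁]⟩)
  have hi₂ : ∀ (u : Finset ℝ) (t : ℝ), t ∉ u.image i₂ → 2 * t - 1 ∉ u := fun u t hu h =>
    hu (Finset.mem_image.mpr ⟨2 * t - 1, h, by simp [i₂]⟩)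
  refine ⟨concat c₁ c₂, ⟨continuousOn_concat hcc₁ hcc₂ hcc,
    (s₁.image i₁ ∪ s₂.image i₂) ∪ {1 / 2}, ?_⟩, ?_, ?_,
    concat V₁ (fun t => V₂ t * V₁ 1), ⟨?_, ?_, ?_⟩, ?_⟩
  · intro a b ha hab hb hst
    have hhalf := hst (1 / 2) (by simp)
    rcases le_or_gt b (1 / 2) with hb2 | hb2
    · have h1 := hs₁ (2 * a) (2 * b) (by linarith) (by linarith) (by linarith) (fun t ht ht' =>
        hst (t / 2) (Finset.mem_union_left _ (Finset.mem_union_left _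
          (Finset.mem_image_of_mem i₁ ht))) ⟨by linarith [ht'.1], by linarith [ht'.2]⟩)
      have h2 : ContMDiff 𝓘(ℝ, ℝ) 𝓘(ℝ, ℝ) ∞ fun t : ℝ => 2 * t :=
        (contDiff_const.mul contDiff_id).contMDiff
      refine (h1.comp h2.contMDiffOn fun t ht =>
        ⟨by linarith [ht.1], by linarith [ht.2]⟩).congr fun t ht => ?_
      exact concat_left (ht.2.trans hb2)
    · have ha2 : 1 / 2 ≤ a := by
        by_contra hcon
        exact hhalf ⟨not_le.mp hcon, hb2⟩
      have h1 := hs₂ (2 * a - 1) (2 * b - 1) (by linarith) (by linarith) (by linarith)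
        (fun t ht ht' => hst ((t + 1) / 2) (Finset.mem_union_left _ (Finset.mem_union_right _
          (Finset.mem_image_of_mem i₂ ht))) ⟨by linarith [ht'.1], by linarith [ht'.2]⟩)
      have h2 : ContMDiff 𝓘(ℝ, ℝ) 𝓘(ℝ, ℝ) ∞ fun t : ℝ => 2 * t - 1 :=
        ((contDiff_const.mul contDiff_id).sub contDiff_const).contMDiff
      refine (h1.comp h2.contMDiffOn fun t ht =>
        ⟨by linarith [ht.1], by linarith [ht.2]⟩).congr fun t ht => ?_
      exact concat_right hcc (ha2.trans ht.1)
  · rw [concat_left (by norm_num), mul_zero, hx]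
  · rw [concat_right hcc (by norm_num)]
    norm_num [hz]
  · rw [concat_left (by norm_num), mul_zero, hV₁.zero]
  · exact continuousOn_concat hV₁.cont (hV₂.cont.mul continuousOn_const) hVV
  · refine ⟨((d₁ ∪ r₁).image i₁ ∪ (d₂ ∪ r₂).image i₂) ∪ {1 / 2}, fun t ht hts => ?_⟩
    simp only [Finset.mem_union, not_or, Finset.mem_singleton] at hts
    obtain ⟨⟨ht₁, ht₂⟩, hth⟩ := hts
    rcases lt_or_gt_of_ne hth with hlt | hgt
    · have hmem : 2 * t ∈ Ioo (0 : ℝ) 1 := ⟨by linarith [ht.1], by linarith⟩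
      have hnot := hi₁ _ _ ht₁
      rw [Finset.mem_union, not_or] at hnot
      have e : (2 : ℝ) * t + 0 = 2 * t := add_zero _
      have hcoef := coef_comp_affine D (α := 2) (β := 0) (by rw [e]; exact hd₁ _ hmem hnot.1)
        (concat_eventuallyEq_left c₁ c₂ hlt)
      have haff : HasDerivAt (fun s : ℝ => 2 * s + 0) 2 t := by
        simpa using ((hasDerivAt_id t).const_mul 2).add_const 0
      have hd := (HasDerivAt.scomp t (by rw [e]; exact hr₁ _ hmem hnot.2) haff).congr_of_eventuallyEq
        (concat_eventuallyEq_left V₁ (fun t => V₂ t * V₁ 1) hlt)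
      refine hd.congr_deriv ?_
      rw [hcoef, concat_left hlt.le, e]
      exact smul_neg_mul _ _ _
    · have hmem : 2 * t - 1 ∈ Ioo (0 : ℝ) 1 := ⟨by linarith, by linarith [ht.2]⟩
      have hnot := hi₂ _ _ ht₂
      rw [Finset.mem_union, not_or] at hnot
      have e : (2 : ℝ) * t + -1 = 2 * t - 1 := (sub_eq_add_neg _ _).symm
      have hcoef := coef_comp_affine D (α := 2) (β := -1) (by rw [e]; exact hd₂ _ hmem hnot.1)
        (concat_eventuallyEq_right hcc hgt)
      have haff : HasDerivAt (fun s : ℝ => 2 * s + -1) 2 t := by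
        simpa using ((hasDerivAt_id t).const_mul 2).add_const (-1)
      have hd := ((HasDerivAt.scomp t (by rw [e]; exact hr₂ _ hmem hnot.2) haff).mul_const
        (V₁ 1)).congr_of_eventuallyEq (concat_eventuallyEq_right (g := fun t => V₂ t * V₁ 1) hVV hgt)
      refine hd.congr_deriv ?_
      rw [hcoef, concat_right hVV hgt.le, e]
      exact smul_neg_mul_mul _ _ _ _
  · rw [concat_right hVV (by norm_num)]
    norm_num

/-- Coordinate segments are smooth curves, with the transport computed in coordinates. -/
theorem reach_chartTransport (p : M) {x y : EuclideanSpace ℝ (Fin n)} (hx : x ∈ chartBall n p)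
    (hy : y ∈ chartBall n p) :
    Reach D ((extChartAt (𝓡 n) p).symm y) ((extChartAt (𝓡 n) p).symm x)
      (chartTransport D p x y) := by
  have hmem : ∀ t ∈ Icc (0 : ℝ) 1, y + t • (x - y) ∈ chartBall n p := fun t ht =>
    segment_mem_chartBall hx hy ht
  have hsm : ContMDiffOn 𝓘(ℝ, ℝ) (𝓡 n) ∞
      (fun t : ℝ => (extChartAt (𝓡 n) p).symm (y + t • (x - y))) (Icc 0 1) := by
    have h2 : ContMDiff 𝓘(ℝ, ℝ) 𝓘(ℝ, EuclideanSpace ℝ (Fin n)) ∞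
        fun t : ℝ => y + t • (x - y) :=
      (contDiff_const.add (contDiff_id.smul contDiff_const)).contMDiff
    exact (contMDiffOn_extChartAt_symm p).comp h2.contMDiffOn
      fun t ht => chartBall_subset_target p (hmem t ht)
  obtain ⟨V, hV, -⟩ := exists_isTransport (continuous_segCoef (continuous_chartForm D p) x y)
    (star_segCoef (star_chartForm D p) x y)
  refine ⟨fun t => (extChartAt (𝓡 n) p).symm (y + t • (x - y)),
    ⟨hsm.continuousOn, ∅, fun a b ha _ hb _ => hsm.mono (Icc_subset_Icc ha hb)⟩,
    by simp, by simp, V, hV.congr ∅ fun t ht _ => ?_, ?_⟩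
  · have hd : HasDerivAt (fun t : ℝ => y + t • (x - y)) (x - y) t := by
      simpa using ((hasDerivAt_id t).smul_const (x - y)).const_add y
    exact (coef_chart_symm D hd (hmem t ⟨ht.1.le, ht.2.le⟩)).symm
  · exact (hV.transport_eq (star_segCoef (star_chartForm D p) x y)).symm

theorem exists_reach_of_mem {p x y : M} (hx : x ∈ (extChartAt (𝓡 n) p).source)
    (hxb : extChartAt (𝓡 n) p x ∈ chartBall n p) (hy : y ∈ (extChartAt (𝓡 n) p).source)
    (hyb : extChartAt (𝓡 n) p y ∈ chartBall n p) : ∃ U, Reach D x y U := by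
  have := reach_chartTransport (D := D) p hyb hxb
  rw [(extChartAt (𝓡 n) p).left_inv hx, (extChartAt (𝓡 n) p).left_inv hy] at this
  exact ⟨_, this⟩

theorem chartBall_mem_nhds (p : M) :
    (extChartAt (𝓡 n) p).source ∩ extChartAt (𝓡 n) p ⁻¹' chartBall n p ∈ nhds p :=
  Filter.inter_mem (extChartAt_source_mem_nhds p)
    ((continuousAt_extChartAt p) (Metric.isOpen_ball.mem_nhds (center_mem_chartBall p)))

/-- A connected manifold is connected by piecewise smooth curves. -/
theorem exists_reach [ConnectedSpace M] (x y : M) : ∃ U, Reach D x y U := by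
  have hclopen : IsClopen {z | ∃ U, Reach D x z U} := by
    constructor
    · rw [← closure_subset_iff_isClosed]
      intro z hz
      obtain ⟨w, hw, U, hU⟩ := mem_closure_iff_nhds.mp hz _ (chartBall_mem_nhds (n := n) z)
      obtain ⟨V, hV⟩ := exists_reach_of_mem (D := D) hw.1 hw.2 (mem_extChartAt_source z)
        (center_mem_chartBall z)
      exact ⟨_, hU.trans hV⟩
    · rw [isOpen_iff_mem_nhds]
      rintro z ⟨U, hU⟩
      filter_upwards [chartBall_mem_nhds (n := n) z] with w hw
      obtain ⟨V, hV⟩ := exists_reach_of_mem (D := D) (mem_extChartAt_source z)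
        (center_mem_chartBall z) hw.1 hw.2
      exact ⟨_, hU.trans hV⟩
  have hne : {z | ∃ U, Reach D x z U}.Nonempty := by
    obtain ⟨V, hV⟩ := exists_reach_of_mem (D := D) (mem_extChartAt_source x)
        (center_mem_chartBall x) (mem_extChartAt_source x) (center_mem_chartBall x)
    exact ⟨x, V, hV⟩
  have := hclopen.eq_univ hne
  have h : y ∈ {z | ∃ U, Reach D x z U} := by
    rw [this]
    exact mem_univ y
  exact h

end Reach

/-- An operator commutes with the orthogonal projection onto a subspace that is invariant under the
operator and its adjoint. -/
theorem starProjection_apply_comm {H : Type*} [NormedAddCommGroup H] [InnerProductSpace ℂ H]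
    [CompleteSpace H] (K : Submodule ℂ H) [K.HasOrthogonalProjection] {T : H →L[ℂ] H}
    (h : ∀ x ∈ K, T x ∈ K) (h' : ∀ x ∈ K, star T x ∈ K) (x : H) :
    K.starProjection (T x) = T (K.starProjection x) := by
  refine Submodule.eq_starProjection_of_mem_orthogonal (h _ (K.starProjection_apply_mem x)) ?_
  rw [← map_sub, Submodule.mem_orthogonal]
  intro u hu
  rw [← ContinuousLinearMap.adjoint_inner_left, ← ContinuousLinearMap.star_eq_adjoint]
  exact (Submodule.mem_orthogonal _ _).mp (Submodule.sub_starProjection_mem_orthogonal x) _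
    (h' u hu)

section ParallelOfHolonomy

variable {n : ℕ} {M : Type*} [TopologicalSpace M] [ChartedSpace (EuclideanSpace ℝ (Fin n)) M]
  [IsManifold (𝓡 n) ∞ M]

theorem isStarProjection_conj {R : Type*} [Ring R] [StarRing R] {P U : R} (hP : IsStarProjection P)
    (hU : star U * U = 1) : IsStarProjection (U * P * star U) := by
  constructor
  · change U * P * star U * (U * P * star U) = U * P * star U
    have : P * P = P := hP.isIdempotentElem
    calc _ = U * P * (star U * U) * P * star U := by noncomm_ring
      _ = U * (P * P) * star U := by rw [hU]; noncomm_ring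
      _ = _ := by rw [this]
  · have h : star P = P := hP.isSelfAdjoint
    rw [IsSelfAdjoint, star_mul, star_mul, star_star, h, mul_assoc]

theorem conj_intertwine {R : Type*} [Ring R] [StarRing R] {P U V h : R}
    (hV : V * star V = 1) (hU : U * star U = 1)
    (hc : P * (star U * h * V) = star U * h * V * P) :
    U * P * star U * h = h * (V * P * star V) := by
  calc U * P * star U * h = U * P * star U * h * (V * star V) := by rw [hV, mul_one]
    _ = U * (P * (star U * h * V)) * star V := by noncomm_ring
    _ = (U * star U) * h * V * P * star V := by rw [hc]; noncomm_ring
    _ = h * (V * P * star V) := by rw [hU]; noncomm_ring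

/-- A subspace of the fibre at `m` that is invariant under the holonomy group extends to a parallel
field of projections. -/
theorem exists_isParallelField [ConnectedSpace M] (D : SU2Connection n M) (m : M)
    (W : Submodule ℂ Fibre) (hW : ∀ g ∈ D.holonomyGroup m, ∀ x ∈ W, g x ∈ W) :
    ∃ Q : M → EndFibre, IsParallelField D.toUnitaryConnection Q ∧ Q m = W.starProjection := by
  have hinv : ∀ U, Reach D.toUnitaryConnection m m U → ∀ x ∈ W, U x ∈ W := by
    rintro U ⟨c, hc, h0, h1, V, hV, rfl⟩ x hx
    have := hW _ ⟨c, hc, h0, h1, rfl⟩ x hx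
    rwa [hol_eq_of_isTransport _ hV] at this
  have hcomm : ∀ U, Reach D.toUnitaryConnection m m U →
      W.starProjection * U = U * W.starProjection := by
    intro U hU
    ext1 x
    exact starProjection_apply_comm W (hinv U hU) (hinv _ hU.symm) x
  choose U hU using fun x => exists_reach (D := D.toUnitaryConnection) m x
  have hP : IsStarProjection (W.starProjection : EndFibre) := isStarProjection_starProjection
  refine ⟨fun x => U x * W.starProjection * star (U x), ?_, ?_⟩
  · refine isParallelField_of_chartTransport _
      (fun x => isStarProjection_conj hP (hU x).star_mul_self)
      fun p => ⟨_, chartRadius_pos p, le_rfl, fun x hx y hy => ?_⟩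
    exact conj_intertwine (hU _).mul_star_self (hU _).mul_star_self
      (hcomm _ (((hU _).trans (reach_chartTransport p hx hy)).trans (hU _).symm) |> fun h => by
        simpa only [mul_assoc] using h)
  · change U m * W.starProjection * star (U m) = _
    rw [← hcomm _ (hU m), mul_assoc, (hU m).mul_star_self, mul_one]

end ParallelOfHolonomy


/-! ### Smooth positive measures -/

section SmoothMeasure

variable {n : ℕ} {M : Type*} [TopologicalSpace M] [ChartedSpace (EuclideanSpace ℝ (Fin n)) M]
  [IsManifold (𝓡 n) ∞ M] [MeasurableSpace M] [BorelSpace M] {μ : Measure M}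

theorem measurableSet_inter_preimage {α β : Type*} [TopologicalSpace α] [MeasurableSpace α]
    [OpensMeasurableSpace α] [TopologicalSpace β] [MeasurableSpace β] [BorelSpace β] {f : α → β}
    {s : Set α} (hf : ContinuousOn f s) (hs : MeasurableSet s) {t : Set β} (ht : MeasurableSet t) :
    MeasurableSet (s ∩ f ⁻¹' t) := by
  have h := hs.subtype_image ((continuousOn_iff_continuous_domRestrict.mp hf).measurable ht)
  convert h using 1
  ext x
  simp [and_comm]

namespace IsSmoothPositiveMeasure

variable (hμ : IsSmoothPositiveMeasure n M μ)
include hμ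

/-- The densities in charts are positive, so a set in a chart is null exactly if its image is null
for Lebesgue measure. -/
theorem null_iff {e : OpenPartialHomeomorph M (EuclideanSpace ℝ (Fin n))}
    (he : e ∈ IsManifold.maximalAtlas (𝓡 n) ∞ M) {B : Set (EuclideanSpace ℝ (Fin n))}
    (hB : MeasurableSet B) : μ (e ⁻¹' B ∩ e.source) = 0 ↔ volume (B ∩ e.target) = 0 := by
  obtain ⟨ρ, hρ, hpos, hmap⟩ := hμ e he
  have hem : AEMeasurable e (μ.restrict e.source) :=
    e.continuousOn.aemeasurable e.open_source.measurableSet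
  have hρm : AEMeasurable (fun x => ENNReal.ofReal (ρ x)) (volume.restrict e.target) :=
    (hρ.continuousOn.aemeasurable e.open_target.measurableSet).ennreal_ofReal
  have h1 : (μ.restrict e.source).map e B = μ (e ⁻¹' B ∩ e.source) := by
    rw [Measure.map_apply_of_aemeasurable hem hB, Measure.restrict_apply']
    exact e.open_source.measurableSet
  have h2 : volume.restrict e.target B = volume (B ∩ e.target) :=
    Measure.restrict_apply hB
  rw [← h1, ← h2, hmap]
  constructor
  · intro h
    refine withDensity_absolutelyContinuous' hρm ?_ h
    rw [ae_restrict_iff' e.open_target.measurableSet]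
    exact Filter.Eventually.of_forall fun x hx => (ENNReal.ofReal_pos.mpr (hpos x hx)).ne'
  · intro h
    exact withDensity_absolutelyContinuous _ _ h

/-- A smooth positive measure has the null sets of Lebesgue measure in every chart. -/
theorem ae_iff {e : OpenPartialHomeomorph M (EuclideanSpace ℝ (Fin n))}
    (he : e ∈ IsManifold.maximalAtlas (𝓡 n) ∞ M) {P : M → Prop} :
    (∀ᵐ x ∂μ, x ∈ e.source → P x) ↔ ∀ᵐ y, y ∈ e.target → P (e.symm y) := by
  constructor
  · intro h
    obtain ⟨N, hN, hNm, hN0⟩ := exists_measurable_superset_of_null (MeasureTheory.ae_iff.mp h)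
    have hB : MeasurableSet (e.target ∩ e.symm ⁻¹' N) :=
      measurableSet_inter_preimage e.symm.continuousOn e.open_target.measurableSet hNm
    have h0 : volume ((e.target ∩ e.symm ⁻¹' N) ∩ e.target) = 0 := by
      rw [← hμ.null_iff he hB]
      refine measure_mono_null ?_ hN0
      rintro x ⟨hx, hxs⟩
      have := hx.2
      rwa [mem_preimage, e.left_inv hxs] at this
    refine MeasureTheory.ae_iff.mpr (measure_mono_null (fun y hy => ?_) h0)
    simp only [mem_ofPred_eq, not_forall] at hy
    obtain ⟨hyt, hyP⟩ := hy
    refine ⟨⟨hyt, hN ?_⟩, hyt⟩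
    exact fun h => hyP (h (e.map_target hyt))
  · intro h
    obtain ⟨B, hB, hBm, hB0⟩ := exists_measurable_superset_of_null (MeasureTheory.ae_iff.mp h)
    have h0 := (hμ.null_iff he hBm).mpr (measure_mono_null inter_subset_left hB0)
    refine MeasureTheory.ae_iff.mpr (measure_mono_null (fun x hx => ?_) h0)
    simp only [mem_ofPred_eq, not_forall] at hx
    obtain ⟨hxs, hxP⟩ := hx
    refine ⟨hB ?_, hxs⟩
    exact fun h => hxP (by simpa [e.left_inv hxs] using h (e.map_source hxs))

theorem isLocallyFiniteMeasure : IsLocallyFiniteMeasure μ := by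
  refine ⟨fun p => ?_⟩
  set e := chartAt (EuclideanSpace ℝ (Fin n)) p
  have he : e ∈ IsManifold.maximalAtlas (𝓡 n) ∞ M := IsManifold.chart_mem_maximalAtlas p
  obtain ⟨ρ, hρ, hpos, hmap⟩ := hμ e he
  have hp : e p ∈ e.target := mem_chart_target _ p
  obtain ⟨K, hK, hpK, hKt⟩ := exists_compact_subset e.open_target hp
  have hem : AEMeasurable e (μ.restrict e.source) :=
    e.continuousOn.aemeasurable e.open_source.measurableSet
  refine ⟨e ⁻¹' K ∩ e.source, ?_, ?_⟩
  · refine Filter.inter_mem ?_ (e.open_source.mem_nhds (mem_chart_source _ p))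
    exact (e.continuousAt (mem_chart_source _ p)) (mem_interior_iff_mem_nhds.mp hpK)
  · have h1 : (μ.restrict e.source).map e K = μ (e ⁻¹' K ∩ e.source) := by
      rw [Measure.map_apply_of_aemeasurable hem hK.measurableSet, Measure.restrict_apply']
      exact e.open_source.measurableSet
    rw [← h1, hmap, withDensity_apply _ hK.measurableSet]
    obtain ⟨C, hC⟩ := hK.exists_bound_of_continuousOn (hρ.continuousOn.mono hKt)
    refine (setLIntegral_mono' (g := fun _ => ENNReal.ofReal C) hK.measurableSet
      fun x hx => ENNReal.ofReal_le_ofReal ((le_abs_self _).trans (hC x hx))).trans_lt ?_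
    rw [setLIntegral_const]
    refine ENNReal.mul_lt_top ENNReal.ofReal_lt_top ?_
    exact (Measure.restrict_apply_le _ _).trans_lt hK.measure_lt_top

theorem isOpenPosMeasure : μ.IsOpenPosMeasure := by
  refine ⟨fun U hU ⟨p, hp⟩ h0 => ?_⟩
  set e := chartAt (EuclideanSpace ℝ (Fin n)) p
  have he : e ∈ IsManifold.maximalAtlas (𝓡 n) ∞ M := IsManifold.chart_mem_maximalAtlas p
  have hopen : IsOpen (e.target ∩ e.symm ⁻¹' U) :=
    e.symm.isOpen_inter_preimage hU
  have h1 : μ (e ⁻¹' (e.target ∩ e.symm ⁻¹' U) ∩ e.source) = 0 := by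
    refine measure_mono_null ?_ h0
    rintro x ⟨hx, hxs⟩
    have := hx.2
    rwa [mem_preimage, e.left_inv hxs] at this
  rw [hμ.null_iff he hopen.measurableSet] at h1
  have hne : (e.target ∩ e.symm ⁻¹' U ∩ e.target).Nonempty := by
    refine ⟨e p, ⟨mem_chart_target _ p, ?_⟩, mem_chart_target _ p⟩
    rwa [mem_preimage, e.left_inv (mem_chart_source _ p)]
  exact ((hopen.inter e.open_target).measure_pos volume hne).ne' h1

end IsSmoothPositiveMeasure

end SmoothMeasure

/-! ### Flow operators -/

section FlowOperator

variable {n : ℕ} {M : Type*} [TopologicalSpace M] [ChartedSpace (EuclideanSpace ℝ (Fin n)) M]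
  [IsManifold (𝓡 n) ∞ M]

theorem star_neg_skew {R : Type*} [Ring R] [StarRing R] {A : R} (hA : star A = -A) :
    star (-A) = -(-A) := by
  rw [star_neg, hA]

/-- The coefficient of the transport equation along the reversed flow line that ends at `m`. -/
def flowCoef (D : UnitaryConnection (trivialBundle n M)) (X : ExpVectorField n M) (m : M) (t : ℝ) :
    EndFibre :=
  -D.form (X.flow (1 - t) m) (X.toFun (X.flow (1 - t) m))

/-- The holonomy along the reversed flow line from `X.flow 1 m` to `m`, as an operator. -/
def flowTransport (D : UnitaryConnection (trivialBundle n M)) (X : ExpVectorField n M) (m : M) :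
    EndFibre :=
  transport (flowCoef D X m)

variable (D : UnitaryConnection (trivialBundle n M)) (X : ExpVectorField n M)

theorem star_flowCoef (m : M) (t : ℝ) : star (flowCoef D X m t) = -flowCoef D X m t := by
  exact star_neg_skew (D.skew _ _)

theorem hasMFDerivAt_flow_one_sub (m : M) (t : ℝ) :
    HasMFDerivAt 𝓘(ℝ, ℝ) (𝓡 n) (fun t => X.flow (1 - t) m) t
      ((1 : ℝ →L[ℝ] ℝ).smulRight (-X.toFun (X.flow (1 - t) m))) := by
  have haff : HasDerivAt (fun s : ℝ => 1 - s) (-1) t := by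
    simpa using (hasDerivAt_id t).const_sub 1
  have h := (X.isMIntegralCurve_flow m (1 - t)).comp t haff.hasFDerivAt.hasMFDerivAt
  have e : ∀ v : EuclideanSpace ℝ (Fin n), (1 : ℝ →L[ℝ] ℝ).smulRight (-v) =
      ((1 : ℝ →L[ℝ] ℝ).smulRight v).comp (ContinuousLinearMap.toSpanSingleton ℝ (-1 : ℝ)) := by
    intro v
    ext
    simp
  have e' := e (X.toFun (X.flow (1 - t) m))
  exact e' ▸ h

theorem coef_flow (m : M) : D.coef (fun t => X.flow (1 - t) m) = flowCoef D X m := by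
  funext t
  rw [UnitaryConnection.coef, (hasMFDerivAt_flow_one_sub X m t).mfderiv]
  have h3 : ∀ (q : M) (v : TangentSpace (𝓡 n) q),
      D.form q (((1 : ℝ →L[ℝ] ℝ).smulRight (-v)) (1 : ℝ)) = -D.form q v := by
    intro q v
    rw [← map_neg]
    exact congrArg (D.form q) (one_smul ℝ (-v))
  exact h3 _ _

variable [T2Space M]

theorem continuous_flowCoef : Continuous (Function.uncurry (flowCoef D X)) := by
  have h1 : Continuous fun m : M => D.form m (X.toFun m) :=
    (D.smooth.comp X.smooth).continuous
  exact (h1.comp (X.continuous_flow.comp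
    ((continuous_const.sub continuous_snd).prodMk continuous_fst))).neg

theorem continuous_flowTransport : Continuous (flowTransport D X) :=
  continuous_transport (continuous_flowCoef D X) (star_flowCoef D X)

theorem continuous_flowCoef_apply (m : M) : Continuous (flowCoef D X m) :=
  (continuous_flowCoef D X).uncurry_left m

theorem star_flowTransport_mul_self (m : M) :
    star (flowTransport D X m) * flowTransport D X m = 1 :=
  star_transport_mul_self (continuous_flowCoef_apply D X m) (star_flowCoef D X m)

theorem norm_flowTransport_apply_le (m : M) (v : Fibre) : ‖flowTransport D X m v‖ ≤ ‖v‖ := by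
  refine (ContinuousLinearMap.le_opNorm _ _).trans ?_
  exact mul_le_of_le_one_left (norm_nonneg _)
    (norm_le_one_of_star_mul (star_flowTransport_mul_self D X m))

theorem exists_isTransport_flow (m : M) :
    ∃ U, IsTransport (D.coef fun t => X.flow (1 - t) m) U ∧ U 1 = flowTransport D X m := by
  obtain ⟨U, hU, -⟩ := exists_isTransport (continuous_flowCoef_apply D X m)
    (star_flowCoef D X m)
  refine ⟨U, ?_, (hU.transport_eq (star_flowCoef D X m)).symm⟩
  rw [coef_flow]
  exact hU

theorem hol_flow (m : M) (v : Fibre) :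
    D.hol (fun t => X.flow (1 - t) m) v = flowTransport D X m v := by
  obtain ⟨U, hU, h1⟩ := exists_isTransport_flow D X m
  rw [hol_eq_of_isTransport D hU, h1]

variable [SecondCountableTopology M] [MeasurableSpace M] [BorelSpace M] (μ : Measure M)

/-- The density of the pullback of `μ` by the flow of `X` at time `1`. -/
def flowDensity (m : M) : ℝ≥0∞ := (μ.map (X.flow (-1))).rnDeriv μ m

theorem measurable_flowDensity : Measurable (flowDensity X μ) := Measure.measurable_rnDeriv _ _

theorem map_flow_map_flow_neg : (μ.map (X.flow (-1))).map (X.flow 1) = μ := by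
  rw [Measure.map_map (X.continuous_flow_time 1).measurable (X.continuous_flow_time (-1)).measurable]
  have : X.flow 1 ∘ X.flow (-1) = id := funext fun m => X.flow_flow_neg 1 m
  rw [this, Measure.map_id]

variable {μ}

/-- A property that holds almost everywhere holds at almost every `X.flow 1 m` where the density of
the pulled back measure does not vanish. The flow need not be known to preserve null sets. -/
theorem ae_flow {P : M → Prop} (h : ∀ᵐ m ∂μ, P m) :
    ∀ᵐ m ∂μ, flowDensity X μ m ≠ 0 → P (X.flow 1 m) := by
  rw [← ae_withDensity_iff (measurable_flowDensity X μ)]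
  refine (Measure.withDensity_rnDeriv_le (μ.map (X.flow (-1))) μ).absolutelyContinuous.ae_le ?_
  refine ae_of_ae_map (X.continuous_flow_time 1).measurable.aemeasurable ?_
  rwa [map_flow_map_flow_neg]

/-- Values of a section at `X.flow 1 m` matter only where the density does not vanish. -/
theorem smul_eq_of_flowDensity {m : M} {u v : Fibre} (h : flowDensity X μ m ≠ 0 → u = v) :
    ((√(flowDensity X μ m).toReal : ℝ) : ℂ) • u = ((√(flowDensity X μ m).toReal : ℝ) : ℂ) • v := by
  by_cases h0 : flowDensity X μ m = 0
  · simp [h0]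
  · rw [h h0]

/-- The section `e^X ξ`, with the holonomy written as an operator. -/
def flowMap (ξ : M → Fibre) (m : M) : Fibre :=
  ((√(flowDensity X μ m).toReal : ℝ) : ℂ) • flowTransport D X m (ξ (X.flow 1 m))

theorem flowSection_eq (ξ : M → Fibre) (m : M) :
    flowSection μ D X ξ m = flowMap (μ := μ) D X ξ m := by
  rw [flowSection, hol_flow, flowMap, flowDensity]

/-- The change of variables is only an inequality, because the singular part of the pulled back
measure is discarded by the density. This is enough for `f e^X` to be bounded. -/
theorem lintegral_flow_le {g : M → ℝ≥0∞} (hg : Measurable g) :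
    ∫⁻ m, flowDensity X μ m * g (X.flow 1 m) ∂μ ≤ ∫⁻ m, g m ∂μ := by
  have hm := (X.continuous_flow_time 1).measurable
  calc ∫⁻ m, flowDensity X μ m * g (X.flow 1 m) ∂μ
      = ∫⁻ m, g (X.flow 1 m) ∂(μ.withDensity (flowDensity X μ)) := by
        exact (lintegral_withDensity_eq_lintegral_mul _ (measurable_flowDensity X μ)
          (hg.comp hm)).symm
    _ ≤ ∫⁻ m, g (X.flow 1 m) ∂(μ.map (X.flow (-1))) :=
        lintegral_mono' (Measure.withDensity_rnDeriv_le _ _) le_rfl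
    _ = ∫⁻ m, g m ∂μ := by
        rw [← lintegral_map hg hm, map_flow_map_flow_neg]

theorem stronglyMeasurable_flowMap {ξ : M → Fibre} (hξ : StronglyMeasurable ξ) :
    StronglyMeasurable (flowMap (μ := μ) D X ξ) := by
  have h1 : StronglyMeasurable fun m => ξ (X.flow 1 m) :=
    hξ.comp_measurable (X.continuous_flow_time 1).measurable
  have h2 : StronglyMeasurable fun m => ((√(flowDensity X μ m).toReal : ℝ) : ℂ) :=
    (Complex.measurable_ofReal.comp (measurable_flowDensity X μ).ennreal_toReal.sqrt).stronglyMeasurable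
  have h3 : StronglyMeasurable fun m => flowTransport D X m (ξ (X.flow 1 m)) := by
    have hc : Continuous fun z : EndFibre × Fibre => z.1 z.2 :=
      continuous_fst.clm_apply continuous_snd
    exact hc.comp_stronglyMeasurable ((continuous_flowTransport D X).stronglyMeasurable.prodMk h1)
  exact h2.smul h3

theorem eLpNorm_flowMap_le {f : M → ℂ} {C : ℝ} (hC : ∀ m, ‖f m‖ ≤ C) {ξ : M → Fibre}
    (hξ : StronglyMeasurable ξ) :
    eLpNorm (fun m => f m • flowMap (μ := μ) D X ξ m) 2 μ ≤ ENNReal.ofReal C * eLpNorm ξ 2 μ := by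
  have h0 : eLpNorm (fun m => f m • flowMap (μ := μ) D X ξ m) 2 μ ≤
      ENNReal.ofReal C * eLpNorm (flowMap (μ := μ) D X ξ) 2 μ := by
    refine eLpNorm_le_mul_eLpNorm_of_ae_le_mul (Filter.Eventually.of_forall fun m => ?_) 2
    rw [norm_smul]
    exact mul_le_mul_of_nonneg_right (hC m) (norm_nonneg _)
  refine h0.trans (mul_le_mul_right ?_ _)
  rw [eLpNorm_eq_lintegral_rpow_enorm_toReal (by simp) (by simp),
    eLpNorm_eq_lintegral_rpow_enorm_toReal (by simp) (by simp)]
  refine ENNReal.rpow_le_rpow ?_ (by simp)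
  refine le_trans (lintegral_mono fun m => ?_)
    (lintegral_flow_le (μ := μ) X (g := fun m => ‖ξ m‖ₑ ^ (2 : ℝ≥0∞).toReal) ?_)
  · simp only [ENNReal.toReal_ofNat, ENNReal.rpow_ofNat]
    rw [flowMap, enorm_smul, mul_pow]
    refine mul_le_mul' ?_ (pow_le_pow_left' ?_ 2)
    · rw [← ofReal_norm, Complex.norm_real, Real.norm_of_nonneg (Real.sqrt_nonneg _),
        ← ENNReal.ofReal_pow (Real.sqrt_nonneg _), Real.sq_sqrt ENNReal.toReal_nonneg]
      exact ENNReal.ofReal_toReal_le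
    · rw [← ofReal_norm, ← ofReal_norm]
      exact ENNReal.ofReal_le_ofReal (norm_flowTransport_apply_le D X m _)
  · exact (hξ.enorm).pow_const _

theorem memLp_flowMap {f : M → ℂ} (hf : Continuous f) {C : ℝ} (hC : ∀ m, ‖f m‖ ≤ C)
    (ξ : L2 μ) : MemLp (fun m => f m • flowMap (μ := μ) D X ξ m) 2 μ := by
  have hξ := Lp.stronglyMeasurable ξ
  refine ⟨?_, (eLpNorm_flowMap_le D X hC hξ).trans_lt
    (ENNReal.mul_lt_top ENNReal.ofReal_lt_top (Lp.memLp ξ).2)⟩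
  exact (hf.stronglyMeasurable.smul (stronglyMeasurable_flowMap D X hξ)).aestronglyMeasurable

/-- The operator `f e^X` for a bounded continuous function `f`. -/
def flowOp {f : M → ℂ} (hf : Continuous f) {C : ℝ} (hC0 : 0 ≤ C) (hC : ∀ m, ‖f m‖ ≤ C) :
    L2 μ →L[ℂ] L2 μ :=
  LinearMap.mkContinuous
    { toFun := fun ξ => (memLp_flowMap D X hf hC ξ).toLp
      map_add' := fun ξ η => by
        rw [← MemLp.toLp_add]
        refine MemLp.toLp_congr _ _ ?_
        filter_upwards [ae_flow X (Lp.coeFn_add ξ η)] with m hm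
        rw [Pi.add_apply, ← smul_add, flowMap, flowMap, flowMap, ← smul_add, ← map_add]
        congr 1
        exact smul_eq_of_flowDensity X fun h0 => by rw [hm h0, Pi.add_apply]
      map_smul' := fun a ξ => by
        rw [RingHom.id_apply, ← MemLp.toLp_const_smul]
        refine MemLp.toLp_congr _ _ ?_
        filter_upwards [ae_flow X (Lp.coeFn_smul a ξ)] with m hm
        rw [Pi.smul_apply, smul_comm a, flowMap, flowMap, smul_comm a,
          ← map_smul (flowTransport D X m) a]
        refine congrArg _ ?_
        exact smul_eq_of_flowDensity X fun h0 => by rw [hm h0, Pi.smul_apply] }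
    C
    (fun ξ => by
      change ‖(memLp_flowMap D X hf hC ξ).toLp‖ ≤ _
      rw [Lp.norm_toLp, Lp.norm_def, ← ENNReal.toReal_ofReal hC0, ← ENNReal.toReal_mul]
      refine ENNReal.toReal_mono (ENNReal.mul_ne_top ENNReal.ofReal_ne_top (Lp.memLp ξ).2.ne) ?_
      exact eLpNorm_flowMap_le D X hC (Lp.stronglyMeasurable ξ))

theorem coeFn_flowOp {f : M → ℂ} (hf : Continuous f) {C : ℝ} (hC0 : 0 ≤ C)
    (hC : ∀ m, ‖f m‖ ≤ C) (ξ : L2 μ) :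
    (flowOp D X hf hC0 hC ξ : M → Fibre) =ᵐ[μ] fun m => f m • flowMap (μ := μ) D X ξ m :=
  (memLp_flowMap D X hf hC ξ).coeFn_toLp

variable (μ)

/-- The functions `f e^X` exist as elements of the algebra. Their norms are bounded by the supremum
of `f`, uniformly in the connection. -/
theorem exists_isFlowOperator {f : M → ℂ} (hf : ContMDiff (𝓡 n) 𝓘(ℝ, ℂ) ∞ f)
    (hfc : HasCompactSupport f) :
    ∃ Ψ : HD n μ, IsFlowOperator μ f X (Ψ : OperatorFunctions n μ) := by
  obtain ⟨C', hC'⟩ := hf.continuous.bounded_above_of_compact_support hfc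
  obtain ⟨C, hC0, hC⟩ : ∃ C, 0 ≤ C ∧ ∀ m, ‖f m‖ ≤ C :=
    ⟨max C' 0, le_max_right _ _, fun m => (hC' m).trans (le_max_left _ _)⟩
  have hb : Memℓp (fun D : SU2Connection n M =>
      flowOp (μ := μ) D.toUnitaryConnection X hf.continuous hC0 hC) ∞ := by
    refine memℓp_infty ⟨C, ?_⟩
    rintro _ ⟨D, rfl⟩
    exact LinearMap.mkContinuous_norm_le _ hC0 _
  have hflow : IsFlowOperator μ f X (⟨_, hb⟩ : OperatorFunctions n μ) := by
    intro D ξ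
    refine (coeFn_flowOp D.toUnitaryConnection X hf.continuous hC0 hC ξ).trans ?_
    exact Filter.Eventually.of_forall fun m => congrArg (f m • ·) (flowSection_eq _ X _ m).symm
  refine ⟨⟨⟨_, hb⟩, ?_⟩, hflow⟩
  exact NonUnitalStarSubalgebra.le_topologicalClosure _ (NonUnitalStarAlgebra.subset_adjoin ℂ _
    (Submodule.subset_span ⟨f, X, hf, hfc, hflow⟩))

end FlowOperator


/-! ### Restriction of representations to invariant subspaces -/

section RestrictRep

variable {A : Type*} [NonUnitalNonAssocSemiring A] [Module ℂ A] [Star A]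
  {H : Type*} [NormedAddCommGroup H] [InnerProductSpace ℂ H] [CompleteSpace H]

/-- The restriction of a `*`-representation to an invariant subspace. -/
def restrictRep (π : A →⋆ₙₐ[ℂ] (H →L[ℂ] H)) (K : Submodule ℂ H) [CompleteSpace K]
    (hK : ∀ a, ∀ x ∈ K, π a x ∈ K) : A →⋆ₙₐ[ℂ] (K →L[ℂ] K) where
  toFun a := ((π a).comp K.subtypeL).codRestrict K fun x => hK a x x.2
  map_smul' c a := ContinuousLinearMap.ext fun x =>
    Subtype.ext (congrArg (fun T : H →L[ℂ] H => T x) (map_smul π c a))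
  map_zero' := ContinuousLinearMap.ext fun x =>
    Subtype.ext (congrArg (fun T : H →L[ℂ] H => T x) (map_zero π))
  map_add' a b := ContinuousLinearMap.ext fun x =>
    Subtype.ext (congrArg (fun T : H →L[ℂ] H => T x) (map_add π a b))
  map_mul' a b := ContinuousLinearMap.ext fun x =>
    Subtype.ext (congrArg (fun T : H →L[ℂ] H => T x) (map_mul π a b))
  map_star' a := by
    rw [ContinuousLinearMap.star_eq_adjoint, ContinuousLinearMap.eq_adjoint_iff]
    intro x y
    change inner ℂ (π (star a) x) (y : H) = inner ℂ (x : H) (π a y)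
    rw [map_star, ContinuousLinearMap.star_eq_adjoint, ContinuousLinearMap.adjoint_inner_left]

/-- An operator that preserves a subspace and its orthogonal complement commutes with the orthogonal
projection. -/
theorem starProjection_mul_comm_of_invariant (K : Submodule ℂ H) [K.HasOrthogonalProjection]
    {T : H →L[ℂ] H} (h : ∀ x ∈ K, T x ∈ K) (h' : ∀ x ∈ Kᗮ, T x ∈ Kᗮ) :
    K.starProjection * T = T * K.starProjection := by
  ext1 x
  refine Submodule.eq_starProjection_of_mem_orthogonal (h _ (K.starProjection_apply_mem x)) ?_
  change T x - T (K.starProjection x) ∈ Kᗮ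
  rw [← map_sub]
  exact h' _ (Submodule.sub_starProjection_mem_orthogonal x)

end RestrictRep

section HDCommute

variable {n : ℕ} {M : Type*} [TopologicalSpace M] [ChartedSpace (EuclideanSpace ℝ (Fin n)) M]
  [IsManifold (𝓡 n) ∞ M] [MeasurableSpace M] {μ : Measure M}

/-- A self-adjoint operator that commutes with all `f e^X_∇` commutes with the image of the
holonomy-diffeomorphism algebra. -/
theorem commute_phi_of_commute_flowOperators {D : SU2Connection n M} {p : L2 μ →L[ℂ] L2 μ}
    (hp : star p = p)
    (h : ∀ (f : M → ℂ) (X : ExpVectorField n M) (Ψ : OperatorFunctions n μ),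
      IsFlowOperator μ f X Ψ → p * Ψ D = Ψ D * p) (a : HD n μ) :
    p * phi μ D a = phi μ D a * p := by
  obtain ⟨a, ha⟩ := a
  change p * a D = a D * p
  have hcont : Continuous fun a : OperatorFunctions n μ => a D := by
    refine (LipschitzWith.of_dist_le_mul (K := 1) fun a b => ?_).continuous
    rw [dist_eq_norm, dist_eq_norm, NNReal.coe_one, one_mul]
    exact lp.norm_apply_le_norm ENNReal.top_ne_zero (a - b) D
  have hclosed : IsClosed {a : OperatorFunctions n μ | p * a D = a D * p} :=
    isClosed_eq (continuous_const.mul hcont) (hcont.mul continuous_const)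
  refine closure_minimal (fun b hb => ?_) hclosed ha
  refine NonUnitalStarAlgebra.adjoin_induction (R := ℂ)
    (p := fun (b : OperatorFunctions n μ) _ => p * b D = b D * p) ?_ ?_ ?_ ?_ ?_ ?_ hb
  · intro x hx
    refine Submodule.span_induction (p := fun b _ => p * b D = b D * p) ?_ ?_ ?_ ?_ hx
    · rintro x ⟨f, X, -, -, hx⟩
      exact h f X x hx
    · change p * 0 = 0 * p
      rw [mul_zero, zero_mul]
    · intro x y _ _ hx hy
      change p * (x D + y D) = (x D + y D) * p
      rw [mul_add, add_mul, hx, hy]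
    · intro c x _ hx
      change p * (c • x D) = (c • x D) * p
      rw [mul_smul_comm, smul_mul_assoc, hx]
  · intro x y _ _ hx hy
    change p * (x D + y D) = (x D + y D) * p
    rw [mul_add, add_mul, hx, hy]
  · change p * 0 = 0 * p
    rw [mul_zero, zero_mul]
  · intro x y _ _ hx hy
    change p * (x D * y D) = (x D * y D) * p
    rw [← mul_assoc, hx, mul_assoc, hy, mul_assoc]
  · intro c x _ hx
    change p * (c • x D) = (c • x D) * p
    rw [mul_smul_comm, smul_mul_assoc, hx]
  · intro x _ hx
    change p * star (x D) = star (x D) * p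
    have := congrArg star hx
    rw [star_mul, star_mul, hp] at this
    exact this.symm

end HDCommute

/-! ### Sections of a parallel subbundle -/

section SectionsOfSubbundle

variable {n : ℕ} {M : Type*} [TopologicalSpace M] [ChartedSpace (EuclideanSpace ℝ (Fin n)) M]
  [MeasurableSpace M] [BorelSpace M] [SecondCountableTopology M] {μ : Measure M}

theorem norm_starProjection_apply_le {P : EndFibre} (hP : IsStarProjection P) (v : Fibre) :
    ‖P v‖ ≤ ‖v‖ := by
  refine (P.le_opNorm v).trans (mul_le_of_le_one_left (norm_nonneg _) ?_)
  exact IsStarProjection.norm_le P hP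

/-- The projection to a subbundle of a square integrable section is again square integrable. -/
theorem exists_coeFn_eq_proj (L : Subbundle n M) (ξ : L2 μ) :
    ∃ ζ : L2 μ, (ζ : M → Fibre) =ᵐ[μ] fun m => L.proj m (ξ m) := by
  have hm : MemLp (fun m => L.proj m (ξ m)) 2 μ := by
    refine (Lp.memLp ξ).of_le ?_
      (Filter.Eventually.of_forall fun m => norm_starProjection_apply_le (L.isStarProjection m) _)
    have hc : Continuous fun z : EndFibre × Fibre => z.1 z.2 :=
      continuous_fst.clm_apply continuous_snd
    exact (hc.comp_stronglyMeasurable (L.smooth.continuous.stronglyMeasurable.prodMk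
      (Lp.stronglyMeasurable ξ))).aestronglyMeasurable
  exact ⟨hm.toLp, hm.coeFn_toLp⟩

theorem inner_L2Sections_eq_zero {L₁ L₂ : Subbundle n M} (h : ∀ x, L₁.proj x + L₂.proj x = 1)
    {ξ η : L2 μ} (hξ : ξ ∈ L2Sections μ L₁) (hη : η ∈ L2Sections μ L₂) : inner ℂ ξ η = 0 := by
  rw [L2.inner_def]
  refine integral_eq_zero_of_ae ?_
  filter_upwards [hξ, hη] with m h1 h2
  have hsa : star (L₁.proj m) = L₁.proj m := (L₁.isStarProjection m).isSelfAdjoint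
  have h3 : L₁.proj m (η m) = 0 := by
    have h4 := congrArg (fun T : EndFibre => T (η m)) (h m)
    change L₁.proj m (η m) + L₂.proj m (η m) = η m at h4
    rwa [h2, add_eq_right] at h4
  rw [← h1, ← ContinuousLinearMap.adjoint_inner_right, ← ContinuousLinearMap.star_eq_adjoint, hsa,
    h3, inner_zero_right, Pi.zero_apply]

theorem orthogonal_L2Sections {L₁ L₂ : Subbundle n M} (h : ∀ x, L₁.proj x + L₂.proj x = 1) :
    (L2Sections μ L₁)ᗮ = L2Sections μ L₂ := by
  have hle : L2Sections μ L₂ ≤ (L2Sections μ L₁)ᗮ := fun η hη =>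
    (Submodule.mem_orthogonal _ _).mpr fun ξ hξ => inner_L2Sections_eq_zero h hξ hη
  refine le_antisymm (fun η hη => ?_) hle
  obtain ⟨ζ, hζ⟩ := exists_coeFn_eq_proj L₁ η
  have hζ1 : ζ ∈ L2Sections μ L₁ := by
    change ∀ᵐ m ∂μ, L₁.proj m (ζ m) = ζ m
    filter_upwards [hζ] with m hm
    rw [hm]
    exact congrArg (fun T : EndFibre => T (η m)) (L₁.isStarProjection m).isIdempotentElem
  have hζ2 : η - ζ ∈ L2Sections μ L₂ := by
    change ∀ᵐ m ∂μ, L₂.proj m ((η - ζ : L2 μ) m) = (η - ζ : L2 μ) m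
    filter_upwards [hζ, Lp.coeFn_sub η ζ] with m hm hm2
    have e1 : ∀ w, L₁.proj m w + L₂.proj m w = w := fun w =>
      congrArg (fun T : EndFibre => T w) (h m)
    have e2 : L₂.proj m (L₂.proj m (η m)) = L₂.proj m (η m) :=
      congrArg (fun T : EndFibre => T (η m)) (L₂.isStarProjection m).isIdempotentElem
    have e3 : (η - ζ : L2 μ) m = L₂.proj m (η m) := by
      rw [hm2, Pi.sub_apply, hm, sub_eq_iff_eq_add', e1]
    rw [e3, e2]
  have h0 : ζ ∈ (L2Sections μ L₁)ᗮ := by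
    have := (L2Sections μ L₁)ᗮ.sub_mem hη (hle hζ2)
    rwa [sub_sub_cancel] at this
  have hz : ζ = 0 := (Submodule.orthogonal_disjoint _).le_bot ⟨hζ1, h0⟩
  rwa [hz, sub_zero] at hζ2

variable [IsManifold (𝓡 n) ∞ M] [T2Space M]

theorem mdifferentiableAt_flow_one_sub (X : ExpVectorField n M) (m : M) :
    ∀ t ∈ Ioo (0 : ℝ) 1, t ∉ (∅ : Finset ℝ) →
      MDifferentiableAt 𝓘(ℝ, ℝ) (𝓡 n) (fun t => X.flow (1 - t) m) t := fun t _ _ =>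
  (hasMFDerivAt_flow_one_sub X m t).mdifferentiableAt

theorem continuous_flow_one_sub (X : ExpVectorField n M) (m : M) :
    Continuous fun t => X.flow (1 - t) m :=
  (X.isMIntegralCurve_flow m).continuous.comp (continuous_const.sub continuous_id)

namespace IsParallelField

variable {D : SU2Connection n M} {Q : M → EndFibre}

theorem flowOperator_mem (hQ : IsParallelField D.toUnitaryConnection Q) {f : M → ℂ}
    {X : ExpVectorField n M} {Ψ : OperatorFunctions n μ} (hΨ : IsFlowOperator μ f X Ψ) {ξ : L2 μ}
    (hξ : ξ ∈ L2Sections μ hQ.subbundle) : Ψ D ξ ∈ L2Sections μ hQ.subbundle := by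
  change ∀ᵐ m ∂μ, Q m (Ψ D ξ m) = Ψ D ξ m
  filter_upwards [hΨ D ξ, ae_flow X hξ] with m hm h1
  rw [hm, map_smul, flowSection_eq, flowMap, map_smul]
  refine congrArg (f m • ·) (smul_eq_of_flowDensity X fun h0 => ?_)
  have h2 := hQ.hol_mem (continuous_flow_one_sub X m).continuousOn
    (mdifferentiableAt_flow_one_sub X m) (v := ξ (X.flow 1 m)) (by
      rw [sub_zero]
      exact h1 h0)
  rw [hol_flow] at h2
  simpa [X.flow_zero] using h2

theorem subbundle_add (hQ : IsParallelField D.toUnitaryConnection Q) (x : M) :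
    hQ.subbundle.proj x + hQ.one_sub.subbundle.proj x = 1 :=
  add_sub_cancel (Q x) 1

/-- The square integrable sections of a parallel subbundle form an invariant subspace. -/
theorem phi_mem (hQ : IsParallelField D.toUnitaryConnection Q) (a : HD n μ) {ξ : L2 μ}
    (hξ : ξ ∈ L2Sections μ hQ.subbundle) : phi μ D a ξ ∈ L2Sections μ hQ.subbundle := by
  set K := L2Sections μ hQ.subbundle with hK
  have hcomm := commute_phi_of_commute_flowOperators (D := D) (μ := μ) (p := K.starProjection)
    (isStarProjection_starProjection (U := K)).isSelfAdjoint (fun f X Ψ hΨ => by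
      refine starProjection_mul_comm_of_invariant K (fun x hx => hQ.flowOperator_mem hΨ hx) ?_
      rw [hK, orthogonal_L2Sections hQ.subbundle_add]
      exact fun x hx => hQ.one_sub.flowOperator_mem hΨ hx) a
  have h1 := congrArg (fun T : L2 μ →L[ℂ] L2 μ => T ξ) hcomm
  change K.starProjection (phi μ D a ξ) = phi μ D a (K.starProjection ξ) at h1
  rw [Submodule.starProjection_eq_self_iff.mpr hξ] at h1
  exact Submodule.starProjection_eq_self_iff.mp h1

/-- The representation of the holonomy-diffeomorphism algebra on the sections of a parallel
subbundle. -/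
def rep (hQ : IsParallelField D.toUnitaryConnection Q) :
    HD n μ →⋆ₙₐ[ℂ] (L2Sections μ hQ.subbundle →L[ℂ] L2Sections μ hQ.subbundle) :=
  restrictRep (phi μ D) (L2Sections μ hQ.subbundle) fun a _ hξ => hQ.phi_mem a hξ

theorem isRepOfConnection_rep (hQ : IsParallelField D.toUnitaryConnection Q) :
    IsRepOfConnection μ hQ.connection (hQ.rep (μ := μ)) := by
  intro f X _ _ a ha ξ
  change ((phi μ D a (ξ : L2 μ) : L2 μ) : M → Fibre) =ᵐ[μ] _
  have hξ : ∀ᵐ m ∂μ, Q m ((ξ : L2 μ) m) = (ξ : L2 μ) m := ξ.2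
  filter_upwards [ha D ξ, ae_flow X hξ] with m hm h1
  refine hm.trans (congrArg (f m • ·) ?_)
  refine smul_eq_of_flowDensity X fun h0 => ?_
  obtain ⟨U, hU, -⟩ := exists_isTransport_flow D.toUnitaryConnection X m
  exact (hQ.hol_connection (continuous_flow_one_sub X m).continuousOn
    (mdifferentiableAt_flow_one_sub X m) hU (v := (ξ : L2 μ) (X.flow 1 m)) (by
      simpa using h1 h0)).symm

end IsParallelField

end SectionsOfSubbundle


/-! ### Translations in charts -/

section ChartTranslation

variable {n : ℕ} {M : Type*} [TopologicalSpace M] [ChartedSpace (EuclideanSpace ℝ (Fin n)) M]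

/-- A bump function that is equal to `1` on `chartBall n p`. -/
def chartBump (p : M) : SmoothBumpFunction (𝓡 n) p where
  rIn := chartRadius n p
  rOut := 2 * chartRadius n p
  rIn_pos := chartRadius_pos p
  rIn_lt_rOut := by linarith [chartRadius_pos (n := n) p]
  closedBall_subset := inter_subset_left.trans (closedBall_subset_target p)

theorem chartBump_eq_one {p : M} {y : EuclideanSpace ℝ (Fin n)} (hy : y ∈ chartBall n p) :
    chartBump (n := n) p ((extChartAt (𝓡 n) p).symm y) = 1 := by
  have ht := chartBall_subset_target p hy
  refine (chartBump p).one_of_dist_le ?_ ?_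
  · rw [← extChartAt_source (𝓡 n)]
    exact (extChartAt (𝓡 n) p).map_target ht
  · rw [(extChartAt (𝓡 n) p).right_inv ht]
    exact (Metric.mem_ball.mp hy).le

variable (n) in
/-- A ball so small that a coordinate segment between two of its points can be prolonged to twice
its length on both sides within `chartBall n p`. -/
def smallBall (p : M) : Set (EuclideanSpace ℝ (Fin n)) :=
  Metric.ball (extChartAt (𝓡 n) p p) (chartRadius n p / 8)

theorem isOpen_smallBall (p : M) : IsOpen (smallBall n p) := Metric.isOpen_ball

theorem center_mem_smallBall (p : M) : extChartAt (𝓡 n) p p ∈ smallBall n p :=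
  Metric.mem_ball_self (by linarith [chartRadius_pos (n := n) p])

theorem smallBall_subset_chartBall (p : M) : smallBall n p ⊆ chartBall n p :=
  Metric.ball_subset_ball (by linarith [chartRadius_pos (n := n) p])

theorem smallBall_subset_target (p : M) : smallBall n p ⊆ (extChartAt (𝓡 n) p).target :=
  (smallBall_subset_chartBall p).trans (chartBall_subset_target p)

theorem add_smul_mem_chartBall {p : M} {y v : EuclideanSpace ℝ (Fin n)} (hy : y ∈ smallBall n p)
    (hyv : y + v ∈ smallBall n p) {s : ℝ} (hs : s ∈ Ioo (-2 : ℝ) 2) : y + s • v ∈ chartBall n p := by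
  rw [smallBall, mem_ball_iff_norm] at hy hyv
  rw [chartBall, mem_ball_iff_norm]
  set c := extChartAt (𝓡 n) p p
  have hv : ‖v‖ ≤ ‖y + v - c‖ + ‖y - c‖ := by
    have : v = (y + v - c) - (y - c) := by abel
    conv_lhs => rw [this]
    exact norm_sub_le _ _
  have h1 : ‖y + s • v - c‖ ≤ ‖y - c‖ + |s| * ‖v‖ := by
    have : y + s • v - c = (y - c) + s • v := by abel
    rw [this, ← Real.norm_eq_abs, ← norm_smul]
    exact norm_add_le _ _
  have h2 : |s| * ‖v‖ ≤ 2 * ‖v‖ :=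
    mul_le_mul_of_nonneg_right (abs_lt.mpr hs).le (norm_nonneg _)
  have := chartRadius_pos (n := n) p
  linarith

variable [IsManifold (𝓡 n) ∞ M] [T2Space M]

/-- The coordinate vector field in direction `v` in the chart at `p`, cut off by a bump function. -/
def chartVectorField (p : M) (v : EuclideanSpace ℝ (Fin n)) : ExpVectorField n M where
  toFun m := chartBump (n := n) p m • coordField p v m
  smooth := ContMDiffOn.smul_section_of_tsupport (s := coordField p v)
    ((chartBump p).contMDiff.contMDiffOn) (isOpen_extChartAt_source p)
    (chartBump p).tsupport_subset_extChartAt_source (contMDiffOn_coordField p v)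
  complete := exists_isMIntegralCurve_of_isCompact
    (ContMDiffOn.smul_section_of_tsupport (s := coordField p v)
      ((chartBump p).contMDiff.contMDiffOn) (isOpen_extChartAt_source p)
      (chartBump p).tsupport_subset_extChartAt_source (contMDiffOn_coordField p v))
    (chartBump (n := n) p).hasCompactSupport fun m hm => by
      rw [image_eq_zero_of_notMem_tsupport hm, zero_smul]

theorem chartVectorField_symm {p : M} {y : EuclideanSpace ℝ (Fin n)} (hy : y ∈ chartBall n p)
    (v : EuclideanSpace ℝ (Fin n)) :
    (chartVectorField p v).toFun ((extChartAt (𝓡 n) p).symm y) = chartInvDeriv p y v := by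
  change chartBump (n := n) p ((extChartAt (𝓡 n) p).symm y) •
    coordField p v ((extChartAt (𝓡 n) p).symm y) = _
  rw [chartBump_eq_one hy, one_smul, coordField_symm (chartBall_subset_target p hy)]

theorem flow_chartVectorField {p : M} {y v : EuclideanSpace ℝ (Fin n)} (hy : y ∈ smallBall n p)
    (hyv : y + v ∈ smallBall n p) {s : ℝ} (hs : s ∈ Ioo (-2 : ℝ) 2) :
    (chartVectorField p v).flow s ((extChartAt (𝓡 n) p).symm y) =
      (extChartAt (𝓡 n) p).symm (y + s • v) := by
  refine (chartVectorField p v).flow_eq_of_isMIntegralCurveOn (a := -2) (b := 2)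
    (c := fun s => (extChartAt (𝓡 n) p).symm (y + s • v)) (by norm_num) (fun t ht => ?_)
    (by simp) hs
  have hmem := add_smul_mem_chartBall hy hyv ht
  have hd : HasDerivAt (fun t : ℝ => y + t • v) v t := by
    simpa using ((hasDerivAt_id t).smul_const v).const_add y
  rw [chartVectorField_symm hmem]
  exact (hasMFDerivAt_chart_symm_comp hd (chartBall_subset_target p hmem)).hasMFDerivWithinAt

theorem flowTransport_chartVectorField (D : UnitaryConnection (trivialBundle n M)) {p : M}
    {y v : EuclideanSpace ℝ (Fin n)} (hy : y ∈ smallBall n p) (hyv : y + v ∈ smallBall n p) :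
    flowTransport D (chartVectorField p v) ((extChartAt (𝓡 n) p).symm y) =
      chartTransport D p y (y + v) := by
  obtain ⟨U, hU, -⟩ := exists_isTransport
    (continuous_segCoef (continuous_chartForm D p) y (y + v))
    (star_segCoef (star_chartForm D p) y (y + v))
  have h1 : chartTransport D p y (y + v) = U 1 :=
    hU.transport_eq (star_segCoef (star_chartForm D p) y (y + v))
  have h2 : IsTransport (flowCoef D (chartVectorField p v) ((extChartAt (𝓡 n) p).symm y)) U := by
    refine hU.congr ∅ fun t ht _ => ?_
    have hs : 1 - t ∈ Ioo (-2 : ℝ) 2 := ⟨by linarith [ht.2], by linarith [ht.1]⟩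
    have hmem := add_smul_mem_chartBall hy hyv hs
    have e : y + (1 - t) • v = y + v + t • (y - (y + v)) := by
      rw [sub_add_cancel_left, smul_neg, sub_smul, one_smul]
      abel
    have e2 : flowCoef D (chartVectorField p v) ((extChartAt (𝓡 n) p).symm y) t =
        -chartForm D p (y + (1 - t) • v) v := by
      rw [flowCoef, flow_chartVectorField hy hyv hs, chartVectorField_symm hmem, chartForm_eq D hmem]
    rw [e2, segCoef, ← e, sub_add_cancel_left, map_neg]
  rw [h1]
  exact h2.transport_eq (star_flowCoef D _ _)

variable [MeasurableSpace M] [BorelSpace M] {μ : Measure M}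

theorem IsSmoothPositiveMeasure.ae_chart_iff (hμ : IsSmoothPositiveMeasure n M μ) (p : M)
    {P : M → Prop} : (∀ᵐ x ∂μ, x ∈ (extChartAt (𝓡 n) p).source → P x) ↔
      ∀ᵐ y, y ∈ (extChartAt (𝓡 n) p).target → P ((extChartAt (𝓡 n) p).symm y) := by
  have := hμ.ae_iff (e := chartAt (EuclideanSpace ℝ (Fin n)) p)
    (IsManifold.chart_mem_maximalAtlas p) (P := P)
  simpa [extChartAt, mfld_simps] using this

variable [SecondCountableTopology M]

/-- Where the flow is a coordinate translation, it preserves null sets, as Lebesgue measure is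
invariant under translations. -/
theorem null_iff_map_flow_null (hμ : IsSmoothPositiveMeasure n M μ) (p : M)
    (v : EuclideanSpace ℝ (Fin n)) {N : Set M} (hN : MeasurableSet N)
    (hNs : ∀ m ∈ N, m ∈ (extChartAt (𝓡 n) p).source ∧ extChartAt (𝓡 n) p m ∈ smallBall n p ∧
      extChartAt (𝓡 n) p m + v ∈ smallBall n p) :
    μ N = 0 ↔ μ.map ((chartVectorField p v).flow (-1)) N = 0 := by
  set X := chartVectorField p v
  set φ := extChartAt (𝓡 n) p with hφ
  have hflow : ∀ m ∈ N, X.flow 1 m = φ.symm (φ m + v) := by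
    intro m hm
    have h := flow_chartVectorField (hNs m hm).2.1 (hNs m hm).2.2 (s := 1) (by norm_num)
    rwa [φ.left_inv (hNs m hm).1, one_smul] at h
  have hN1 : μ N = 0 ↔ ∀ᵐ y, y ∈ φ.target → φ.symm y ∉ N := by
    rw [← hμ.ae_chart_iff p (P := fun m => m ∉ N), measure_eq_zero_iff_ae_notMem]
    exact Filter.eventually_congr (Filter.Eventually.of_forall fun m =>
      ⟨fun h _ => h, fun h hm => h (hNs m hm).1 hm⟩)
  have hN2 : μ.map (X.flow (-1)) N = 0 ↔
      ∀ᵐ z, z ∈ φ.target → X.flow (-1) (φ.symm z) ∉ N := by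
    rw [← hμ.ae_chart_iff p (P := fun m => X.flow (-1) m ∉ N),
      Measure.map_apply (X.continuous_flow_time (-1)).measurable hN, measure_eq_zero_iff_ae_notMem]
    refine Filter.eventually_congr (Filter.Eventually.of_forall fun m =>
      ⟨fun h _ => h, fun h hm => h ?_ hm⟩)
    have h1 := hflow _ hm
    rw [X.flow_flow_neg] at h1
    rw [h1]
    exact φ.map_target (smallBall_subset_target p (hNs _ hm).2.2)
  rw [hN1, hN2]
  constructor
  · intro h
    filter_upwards [(measurePreserving_sub_right volume v).quasiMeasurePreserving.ae h]
      with z hz hzt hzN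
    have h1 := hflow _ hzN
    rw [X.flow_flow_neg] at h1
    have h2 : z = φ (X.flow (-1) (φ.symm z)) + v :=
      φ.symm.injOn hzt (smallBall_subset_target p (hNs _ hzN).2.2) h1
    have h3 : z - v = φ (X.flow (-1) (φ.symm z)) := sub_eq_iff_eq_add.mpr h2
    rw [h3, φ.left_inv (hNs _ hzN).1] at hz
    exact hz (smallBall_subset_target p (hNs _ hzN).2.1) hzN
  · intro h
    filter_upwards [(measurePreserving_add_right volume v).quasiMeasurePreserving.ae h]
      with y hy hyt hyN
    have h1 := hflow _ hyN
    have h2 := (hNs _ hyN).2.2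
    rw [φ.right_inv hyt] at h1 h2
    rw [← h1, X.flow_neg_flow] at hy
    exact hy (smallBall_subset_target p h2) hyN

/-- The density of the measure pulled back by a coordinate translation does not vanish. -/
theorem flowDensity_chartVectorField_ne_zero (hμ : IsSmoothPositiveMeasure n M μ) (p : M)
    (v : EuclideanSpace ℝ (Fin n)) :
    ∀ᵐ y, y ∈ smallBall n p → y + v ∈ smallBall n p →
      flowDensity (chartVectorField p v) μ ((extChartAt (𝓡 n) p).symm y) ≠ 0 := by
  set X := chartVectorField p v
  set φ := extChartAt (𝓡 n) p with hφ
  set ν := μ.map (X.flow (-1))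
  set V : Set M := φ.source ∩ φ ⁻¹' (smallBall n p ∩ (fun y => y + v) ⁻¹' smallBall n p) with hV
  have := hμ.isLocallyFiniteMeasure
  have hVo : IsOpen V := (continuousOn_extChartAt p).isOpen_inter_preimage
    (isOpen_extChartAt_source p)
    ((isOpen_smallBall p).inter ((isOpen_smallBall p).preimage (continuous_add_const v)))
  have hnull : ∀ s, MeasurableSet s → (μ (s ∩ V) = 0 ↔ ν (s ∩ V) = 0) := fun s hs =>
    null_iff_map_flow_null hμ p v (hs.inter hVo.measurableSet) fun m hm =>
      ⟨hm.2.1, hm.2.2.1, hm.2.2.2⟩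
  have hac1 : ν.restrict V ≪ μ := by
    refine Measure.AbsolutelyContinuous.mk fun s hs h => ?_
    rw [Measure.restrict_apply hs, ← hnull s hs]
    exact measure_mono_null inter_subset_left h
  have hac2 : μ.restrict V ≪ ν.restrict V := by
    refine Measure.AbsolutelyContinuous.mk fun s hs h => ?_
    rw [Measure.restrict_apply hs] at h ⊢
    exact (hnull s hs).mpr h
  have hpos : ∀ᵐ m ∂μ.restrict V, 0 < (ν.restrict V).rnDeriv μ m :=
    hac2.ae_le (Measure.rnDeriv_pos hac1)
  have hres := Measure.rnDeriv_restrict ν μ hVo.measurableSet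
  have h1 : ∀ᵐ m ∂μ, m ∈ φ.source → m ∈ V → flowDensity X μ m ≠ 0 := by
    filter_upwards [ae_imp_of_ae_restrict hpos, hres] with m hm1 hm2 _ hmV
    have h := hm1 hmV
    rw [hm2, indicator_of_mem hmV] at h
    exact h.ne'
  filter_upwards [(hμ.ae_chart_iff p).mp h1] with y hy hyb hyv
  have hyt := smallBall_subset_target p hyb
  refine hy hyt ⟨φ.map_target hyt, ?_⟩
  rw [mem_preimage, φ.right_inv hyt]
  exact ⟨hyb, hyv⟩

end ChartTranslation


/-! ### The commutant acts by multiplication operators -/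

section Commutant

variable {n : ℕ} {M : Type*} [TopologicalSpace M] [ChartedSpace (EuclideanSpace ℝ (Fin n)) M]
  [IsManifold (𝓡 n) ∞ M]

variable (n M) in
theorem isMIntegralCurve_zero (m : M) : IsMIntegralCurve (I := 𝓡 n) (fun _ : ℝ => m)
    (fun m => (0 : TangentSpace (𝓡 n) m)) := by
  intro t
  have h := hasMFDerivAt_const (I := 𝓘(ℝ, ℝ)) (I' := 𝓡 n) m t
  have e : (1 : ℝ →L[ℝ] ℝ).smulRight (0 : EuclideanSpace ℝ (Fin n)) = 0 := by
    ext
    simp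
  exact e ▸ h

variable (n M) in
/-- The zero vector field. -/
def zeroField : ExpVectorField n M where
  toFun _ := 0
  smooth := Bundle.contMDiff_zeroSection ℝ (TangentSpace (𝓡 n))
  complete m := ⟨fun _ => m, rfl, isMIntegralCurve_zero n M m⟩

variable [T2Space M]

theorem flow_zeroField (t : ℝ) (m : M) : (zeroField n M).flow t m = m := by
  have hlt : |t| < |t| + 1 := lt_add_one _
  exact (zeroField n M).flow_eq_of_isMIntegralCurveOn (c := fun _ => m) (a := -(|t| + 1))
    (b := |t| + 1) ⟨by linarith [abs_nonneg t], by linarith [abs_nonneg t]⟩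
    ((isMIntegralCurve_zero n M m).isMIntegralCurveOn _) rfl (abs_lt.mp hlt)

theorem flowTransport_zeroField (D : UnitaryConnection (trivialBundle n M)) (m : M) :
    flowTransport D (zeroField n M) m = 1 := by
  have : flowCoef D (zeroField n M) m = fun _ => 0 := by
    funext t
    have h : ∀ q : M, -D.form q (0 : TangentSpace (𝓡 n) q) = 0 := fun q => by
      rw [map_zero, neg_zero]
    exact h _
  rw [flowTransport, this, transport_zero]

variable [SecondCountableTopology M] [MeasurableSpace M] [BorelSpace M] {μ : Measure M}

/-- The algebra `HD` contains the multiplication operators `f = f e^0`. -/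
theorem exists_phi_eq_smul [IsLocallyFiniteMeasure μ] (D : SU2Connection n M) {f : M → ℂ}
    (hf : ContMDiff (𝓡 n) 𝓘(ℝ, ℂ) ∞ f) (hfc : HasCompactSupport f) :
    ∃ a : HD n μ, ∀ ξ : L2 μ, (phi μ D a ξ : M → Fibre) =ᵐ[μ] fun m => f m • ξ m := by
  obtain ⟨a, ha⟩ := exists_isFlowOperator (zeroField n M) μ hf hfc
  refine ⟨a, fun ξ => (ha D ξ).trans ?_⟩
  have hid : μ.map ((zeroField n M).flow (-1)) = μ := by
    have : (zeroField n M).flow (-1) = id := funext fun m => flow_zeroField (-1) m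
    rw [this, Measure.map_id]
  have hd : ∀ᵐ m ∂μ, flowDensity (zeroField n M) μ m = 1 := by
    have := μ.rnDeriv_self
    filter_upwards [this] with m hm
    rw [flowDensity, hid, hm]
  filter_upwards [hd] with m hm
  rw [flowSection_eq, flowMap, hm, flowTransport_zeroField, flow_zeroField]
  simp

variable (n) in
/-- The neighbourhood of `p` that corresponds to `chartBall n p`. -/
def chartNhd (p : M) : Set M := (extChartAt (𝓡 n) p).source ∩ extChartAt (𝓡 n) p ⁻¹' chartBall n p

theorem isOpen_chartNhd (p : M) : IsOpen (chartNhd n p) :=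
  (continuousOn_extChartAt p).isOpen_inter_preimage (isOpen_extChartAt_source p) Metric.isOpen_ball

theorem chartBump_eq_one_of_mem {p m : M} (hm : m ∈ chartNhd n p) :
    chartBump (n := n) p m = 1 := by
  have := chartBump_eq_one (n := n) hm.2
  rwa [(extChartAt (𝓡 n) p).left_inv hm.1] at this

section Cutoff

variable [IsLocallyFiniteMeasure μ]

theorem memLp_cutoff (p : M) (v : Fibre) :
    MemLp (fun m => ((chartBump (n := n) p m : ℝ) : ℂ) • v) 2 μ := by
  refine Continuous.memLp_of_hasCompactSupport ?_ ?_
  · exact (Complex.continuous_ofReal.comp (chartBump p).continuous).smul continuous_const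
  · have h := (chartBump (n := n) p).hasCompactSupport
    have h2 : HasCompactSupport fun m => ((chartBump (n := n) p m : ℝ) : ℂ) :=
      h.comp_left (g := fun x : ℝ => (x : ℂ)) Complex.ofReal_zero
    exact h2.smul_right

variable (n μ) in
/-- The constant section with value `v`, cut off by the bump function around `p`. -/
def cutoff (p : M) (v : Fibre) : L2 μ := (memLp_cutoff (n := n) p v).toLp

theorem coeFn_cutoff (p : M) (v : Fibre) :
    ∀ᵐ m ∂μ, cutoff n μ p v m = ((chartBump (n := n) p m : ℝ) : ℂ) • v :=
  (memLp_cutoff (n := n) (μ := μ) p v).coeFn_toLp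

theorem cutoff_eq_of_mem (p : M) (v : Fibre) :
    ∀ᵐ m ∂μ, m ∈ chartNhd n p → cutoff n μ p v m = v := by
  filter_upwards [coeFn_cutoff (n := n) (μ := μ) p v] with m hm hmem
  rw [hm, chartBump_eq_one_of_mem hmem, Complex.ofReal_one, one_smul]

/-- The standard basis of the fibre. -/
abbrev stdVec (i : Fin 2) : Fibre := EuclideanSpace.single i 1

/-- The rows of the matrix of a self-adjoint operator of the commutant are its values on cut off
constant sections. -/
theorem inner_stdVec_apply_eq {D : SU2Connection n M} {p : L2 μ →L[ℂ] L2 μ} (hpp : star p = p)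
    (hp : ∀ a : HD n μ, p * phi μ D a = phi μ D a * p) (p₀ : M) (i : Fin 2) (ξ : L2 μ) :
    ∀ᵐ m ∂μ, m ∈ chartNhd n p₀ →
      inner ℂ (stdVec i) (p ξ m) = inner ℂ (p (cutoff n μ p₀ (stdVec i)) m) (ξ m) := by
  set e := cutoff n μ p₀ (stdVec i) with he
  have : LocallyCompactSpace M := ChartedSpace.locallyCompactSpace (EuclideanSpace ℝ (Fin n)) M
  have key := IsOpen.ae_eq_zero_of_integral_contMDiff_smul_eq_zero (I := 𝓡 n) (μ := μ)
    (f := fun m => inner ℂ (stdVec i) (p ξ m) - inner ℂ (p e m) (ξ m))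
    (isOpen_chartNhd (n := n) p₀) ?_ ?_
  · filter_upwards [key] with m hm hmem
    exact sub_eq_zero.mp (hm hmem)
  · refine LocallyIntegrable.locallyIntegrableOn (LocallyIntegrable.sub ?_ ?_) _
    · have h1 : MemLp (fun m => inner ℂ (stdVec i) (p ξ m)) 2 μ :=
        (Lp.memLp (p ξ)).const_inner (stdVec i)
      exact h1.locallyIntegrable (by norm_num)
    · exact (L2.integrable_inner (p e) ξ).locallyIntegrable
  · intro g hg hgc hgU
    have hgC : ContMDiff (𝓡 n) 𝓘(ℝ, ℂ) ∞ fun m => ((g m : ℝ) : ℂ) :=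
      Complex.ofRealCLM.contDiff.contMDiff.comp hg
    have hgcC : HasCompactSupport fun m => ((g m : ℝ) : ℂ) :=
      hgc.comp_left (g := fun x : ℝ => (x : ℂ)) Complex.ofReal_zero
    obtain ⟨a, ha⟩ := exists_phi_eq_smul (μ := μ) D hgC hgcC
    have h1 : inner ℂ (phi μ D a e) (p ξ) = inner ℂ (phi μ D a (p e)) ξ := by
      have h2 : p (phi μ D a e) = phi μ D a (p e) :=
        congrArg (fun T : L2 μ →L[ℂ] L2 μ => T e) (hp a)
      rw [← h2, ← ContinuousLinearMap.adjoint_inner_left, ← ContinuousLinearMap.star_eq_adjoint,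
        hpp]
    rw [L2.inner_def, L2.inner_def, ← sub_eq_zero,
      ← integral_sub (L2.integrable_inner _ _) (L2.integrable_inner _ _)] at h1
    rw [← h1]
    refine integral_congr_ae ?_
    filter_upwards [ha e, ha (p e), cutoff_eq_of_mem (n := n) (μ := μ) p₀ (stdVec i)]
      with m hm1 hm2 hm3
    rw [hm1, hm2, inner_smul_left, inner_smul_left, Complex.conj_ofReal, Complex.real_smul, mul_sub]
    by_cases hmem : m ∈ chartNhd n p₀
    · rw [hm3 hmem]
    · rw [image_eq_zero_of_notMem_tsupport fun h => hmem (hgU h)]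
      simp

theorem eq_of_inner_stdVec {v w : Fibre} (h : ∀ i, inner ℂ (stdVec i) v = inner ℂ (stdVec i) w) :
    v = w := by
  ext i
  simpa [EuclideanSpace.inner_single_left] using h i

theorem endFibre_ext {A B : EndFibre} (h : ∀ i, A (stdVec i) = B (stdVec i)) : A = B := by
  have h2 := (EuclideanSpace.basisFun (Fin 2) ℂ).toBasis.ext (f₁ := (A : Fibre →ₗ[ℂ] Fibre))
    (f₂ := (B : Fibre →ₗ[ℂ] Fibre)) (fun i => by simpa using h i)
  exact ContinuousLinearMap.coe_injective h2

/-- Near `p₀`, a projection in the commutant is the multiplication by a measurable field of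
projections in the fibres. -/
theorem exists_localField {D : SU2Connection n M} {p : L2 μ →L[ℂ] L2 μ} (hpp : IsStarProjection p)
    (hp : ∀ a : HD n μ, p * phi μ D a = phi μ D a * p) (p₀ : M) :
    ∃ P : M → EndFibre, StronglyMeasurable P ∧
      (∀ᵐ m ∂μ, m ∈ chartNhd n p₀ → IsStarProjection (P m)) ∧
      ∀ ξ : L2 μ, ∀ᵐ m ∂μ, m ∈ chartNhd n p₀ → p ξ m = P m (ξ m) := by
  set g : Fin 2 → L2 μ := fun i => p (cutoff n μ p₀ (stdVec i)) with hg
  set P : M → EndFibre := fun m =>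
    ∑ i, ContinuousLinearMap.smulRight (innerSL ℂ (g i m)) (stdVec i) with hP
  have hPinner : ∀ m v i, inner ℂ (stdVec i) (P m v) = inner ℂ (g i m) v := by
    intro m v i
    rw [hP, EuclideanSpace.inner_single_left]
    simp only [map_one, one_mul, Fin.sum_univ_two]
    fin_cases i <;> simp
  have hrep : ∀ ξ : L2 μ, ∀ᵐ m ∂μ, m ∈ chartNhd n p₀ → p ξ m = P m (ξ m) := by
    intro ξ
    have h : ∀ᵐ m ∂μ, ∀ i, m ∈ chartNhd n p₀ →
        inner ℂ (stdVec i) (p ξ m) = inner ℂ (g i m) (ξ m) :=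
      ae_all_iff.mpr fun i => inner_stdVec_apply_eq hpp.isSelfAdjoint hp p₀ i ξ
    filter_upwards [h] with m hm hmem
    exact eq_of_inner_stdVec fun i => by rw [hm i hmem, hPinner]
  refine ⟨P, ?_, ?_, hrep⟩
  · refine Finset.stronglyMeasurable_fun_sum _ fun i _ => ?_
    have hc : Continuous fun w : Fibre =>
        (ContinuousLinearMap.smulRight (innerSL ℂ w) (stdVec i) : EndFibre) :=
      ((ContinuousLinearMap.smulRightL ℂ Fibre Fibre).flip (stdVec i)).continuous.comp
        (innerSL ℂ).continuous
    exact hc.comp_stronglyMeasurable (Lp.stronglyMeasurable (g i))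
  · have h1 : ∀ᵐ m ∂μ, ∀ i, m ∈ chartNhd n p₀ → P m (stdVec i) = g i m := by
      refine ae_all_iff.mpr fun i => ?_
      filter_upwards [hrep (cutoff n μ p₀ (stdVec i)),
        cutoff_eq_of_mem (n := n) (μ := μ) p₀ (stdVec i)] with m hm hm2 hmem
      rw [← hm2 hmem, ← hm hmem]
    have h2 : ∀ᵐ m ∂μ, ∀ i, m ∈ chartNhd n p₀ → P m (g i m) = g i m := by
      refine ae_all_iff.mpr fun i => ?_
      filter_upwards [hrep (g i)] with m hm hmem
      rw [← hm hmem]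
      have : p (g i) = g i := congrArg (fun T : L2 μ →L[ℂ] L2 μ => T (cutoff n μ p₀ (stdVec i)))
        hpp.isIdempotentElem
      rw [this]
    filter_upwards [h1, h2] with m hm1 hm2 hmem
    constructor
    · exact endFibre_ext fun i => by
        change P m (P m (stdVec i)) = P m (stdVec i)
        rw [hm1 i hmem, hm2 i hmem]
    · change star (P m) = P m
      ext1 v
      refine eq_of_inner_stdVec fun i => ?_
      rw [hPinner, ContinuousLinearMap.star_eq_adjoint, ContinuousLinearMap.adjoint_inner_right,
        hm1 i hmem]

end Cutoff

end Commutant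


/-! ### Projections in the commutant are parallel -/

/-- A measurable field of projections that commutes almost everywhere with a continuous family of
unitaries agrees almost everywhere with a continuous field. By Fubini's theorem there is a point
from which the value of the field can be transported to almost all other points. -/
theorem exists_continuous_of_ae_intertwine {E 𝔸 : Type*} [NormedAddCommGroup E] [NormedSpace ℝ E]
    [FiniteDimensional ℝ E] [MeasureSpace E] [BorelSpace E]
    [(volume : Measure E).IsAddHaarMeasure] [NormedRing 𝔸] [StarRing 𝔸] [ContinuousStar 𝔸]
    {S : Set E} (hS : IsOpen S) (hne : S.Nonempty) {h : E → E → 𝔸}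
    (hh : Continuous fun z : E × E => h z.1 z.2) (h1 : ∀ x y, star (h x y) * h x y = 1)
    (h2 : ∀ x y, h x y * star (h x y) = 1) {P : E → 𝔸} (hP : StronglyMeasurable P)
    (hproj : ∀ᵐ y, y ∈ S → IsStarProjection (P y))
    (hint : ∀ v, ∀ᵐ y, y ∈ S → y + v ∈ S → P y * h y (y + v) = h y (y + v) * P (y + v)) :
    ∃ Q : E → 𝔸, Continuous Q ∧ (∀ x, IsStarProjection (Q x)) ∧ (∀ᵐ y, y ∈ S → P y = Q y) ∧
      ∀ x ∈ S, ∀ y ∈ S, Q x * h x y = h x y * Q y := by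
  have hmeas : MeasurableSet {z : E × E | z.1 ∈ S → z.1 + z.2 ∈ S →
      P z.1 * h z.1 (z.1 + z.2) = h z.1 (z.1 + z.2) * P (z.1 + z.2)} := by
    have hfst : Measurable fun z : E × E => z.1 := measurable_fst
    have hadd : Measurable fun z : E × E => z.1 + z.2 := measurable_fst.add measurable_snd
    have hhm : StronglyMeasurable fun z : E × E => h z.1 (z.1 + z.2) :=
      (hh.comp (continuous_fst.prodMk (continuous_fst.add continuous_snd))).stronglyMeasurable
    have e1 := StronglyMeasurable.measurableSet_eq_fun
      ((hP.comp_measurable hfst).mul hhm) (hhm.mul (hP.comp_measurable hadd))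
    have e2 : MeasurableSet {z : E × E | z.1 ∈ S} := hfst hS.measurableSet
    have e3 : MeasurableSet {z : E × E | z.1 + z.2 ∈ S} := hadd hS.measurableSet
    exact e2.imp (e3.imp e1)
  have hae := (Measure.ae_ae_comm (μ := (volume : Measure E)) (ν := (volume : Measure E))
    hmeas).mpr (Filter.Eventually.of_forall hint)
  obtain ⟨x₁, hx₁S, hx₁P, hx₁⟩ : ∃ x₁ ∈ S, IsStarProjection (P x₁) ∧
      ∀ᵐ v, x₁ ∈ S → x₁ + v ∈ S → P x₁ * h x₁ (x₁ + v) = h x₁ (x₁ + v) * P (x₁ + v) := by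
    by_contra hcon
    refine (hS.measure_pos volume hne).ne' ?_
    refine measure_mono_null (t := {x | ¬ ((x ∈ S → IsStarProjection (P x)) ∧
      ∀ᵐ v, x ∈ S → x + v ∈ S → P x * h x (x + v) = h x (x + v) * P (x + v))}) ?_
      (ae_iff.mp (hproj.and hae))
    exact fun x hx hx2 => hcon ⟨x, hx, hx2.1 hx, hx2.2⟩
  have hQc : Continuous fun x => star (h x₁ x) * P x₁ * h x₁ x := by
    have : Continuous fun x => h x₁ x := hh.comp (Continuous.prodMk_right x₁)
    exact (this.star.mul continuous_const).mul this
  have hPQ : ∀ᵐ y, y ∈ S → P y = star (h x₁ y) * P x₁ * h x₁ y := by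
    filter_upwards [(measurePreserving_sub_right volume x₁).quasiMeasurePreserving.ae hx₁]
      with y hy hyS
    rw [add_sub_cancel] at hy
    rw [mul_assoc, hy hx₁S hyS, ← mul_assoc, h1, one_mul]
  refine ⟨fun x => star (h x₁ x) * P x₁ * h x₁ x, hQc, fun x => ?_, hPQ, fun x hx y hy => ?_⟩
  · have := isStarProjection_conj hx₁P (U := star (h x₁ x)) (by rw [star_star, h2])
    rwa [star_star] at this
  · have hopen : IsOpen (S ∩ (fun z => z + (y - x)) ⁻¹' S) :=
      hS.inter (hS.preimage (continuous_add_const _))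
    have hc : Continuous fun z => h z (z + (y - x)) :=
      hh.comp (continuous_id.prodMk (continuous_add_const _))
    have key := Measure.eqOn_open_of_ae_eq (μ := (volume : Measure E))
      (f := fun z => star (h x₁ z) * P x₁ * h x₁ z * h z (z + (y - x)))
      (g := fun z => h z (z + (y - x)) *
        (star (h x₁ (z + (y - x))) * P x₁ * h x₁ (z + (y - x)))) (U := _) ?_ hopen
      (hQc.mul hc).continuousOn (hc.mul (hQc.comp (continuous_add_const _))).continuousOn
    · have := key (x := x) ⟨hx, by simpa using hy⟩
      simpa using this
    · refine (ae_restrict_iff' hopen.measurableSet).mpr ?_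
      filter_upwards [hPQ, hint (y - x),
        (measurePreserving_add_right volume (y - x)).quasiMeasurePreserving.ae hPQ]
        with z hz1 hz2 hz3 hz
      rw [← hz1 hz.1, ← hz3 hz.2]
      exact hz2 hz.1 hz.2

section Parallel

variable {n : ℕ} {M : Type*} [TopologicalSpace M] [ChartedSpace (EuclideanSpace ℝ (Fin n)) M]
  [IsManifold (𝓡 n) ∞ M] [T2Space M] [SecondCountableTopology M] [MeasurableSpace M] [BorelSpace M]
  {μ : Measure M}

theorem flowDensity_lt_top [IsLocallyFiniteMeasure μ] (X : ExpVectorField n M) :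
    ∀ᵐ m ∂μ, flowDensity X μ m < ⊤ := by
  have : SigmaFinite (μ.map (X.flow (-1))) := by
    let e : M ≃ᵐ M :=
      { toFun := X.flow (-1)
        invFun := X.flow 1
        left_inv := fun m => X.flow_flow_neg 1 m
        right_inv := fun m => X.flow_neg_flow 1 m
        measurable_toFun := (X.continuous_flow_time (-1)).measurable
        measurable_invFun := (X.continuous_flow_time 1).measurable }
    exact e.sigmaFinite_map
  exact Measure.rnDeriv_lt_top _ _

theorem contMDiff_ofReal_chartBump (p : M) :
    ContMDiff (𝓡 n) 𝓘(ℝ, ℂ) ∞ fun m => ((chartBump (n := n) p m : ℝ) : ℂ) :=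
  Complex.ofRealCLM.contDiff.contMDiff.comp (chartBump p).contMDiff

theorem hasCompactSupport_ofReal_chartBump (p : M) :
    HasCompactSupport fun m => ((chartBump (n := n) p m : ℝ) : ℂ) :=
  (chartBump (n := n) p).hasCompactSupport.comp_left (g := fun x : ℝ => (x : ℂ))
    Complex.ofReal_zero

/-- The local field of a projection in the commutant commutes with the transports along flow lines,
where the flow does not collapse the measure. -/
theorem localField_mul_flowTransport [IsLocallyFiniteMeasure μ] {D : SU2Connection n M}
    {p : L2 μ →L[ℂ] L2 μ} (hp : ∀ a : HD n μ, p * phi μ D a = phi μ D a * p) {p₀ : M}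
    {P : M → EndFibre} (hP : ∀ ξ : L2 μ, ∀ᵐ m ∂μ, m ∈ chartNhd n p₀ → p ξ m = P m (ξ m))
    (X : ExpVectorField n M) :
    ∀ᵐ m ∂μ, m ∈ chartNhd n p₀ → X.flow 1 m ∈ chartNhd n p₀ → flowDensity X μ m ≠ 0 →
      P m * flowTransport D.toUnitaryConnection X m =
        flowTransport D.toUnitaryConnection X m * P (X.flow 1 m) := by
  obtain ⟨a, ha⟩ := exists_isFlowOperator X μ (contMDiff_ofReal_chartBump p₀)
    (hasCompactSupport_ofReal_chartBump p₀)
  have hi : ∀ i, ∀ᵐ m ∂μ, m ∈ chartNhd n p₀ → X.flow 1 m ∈ chartNhd n p₀ →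
      flowDensity X μ m ≠ 0 → P m (flowTransport D.toUnitaryConnection X m (stdVec i)) =
        flowTransport D.toUnitaryConnection X m (P (X.flow 1 m) (stdVec i)) := by
    intro i
    set ξ := cutoff n μ p₀ (stdVec i) with hξ
    have hcomm : p (phi μ D a ξ) = phi μ D a (p ξ) :=
      congrArg (fun T : L2 μ →L[ℂ] L2 μ => T ξ) (hp a)
    filter_upwards [hP (phi μ D a ξ), ha D ξ, ha D (p ξ),
      ae_flow X (cutoff_eq_of_mem (n := n) (μ := μ) p₀ (stdVec i)), ae_flow X (hP ξ),
      flowDensity_lt_top X] with m h1 h2 h3 h4 h5 h6 hm hfm h0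
    have h1' := h1 hm
    have e2 : phi μ D a ξ m = flowMap (μ := μ) D.toUnitaryConnection X ξ m := by
      refine h2.trans ?_
      rw [chartBump_eq_one_of_mem hm, Complex.ofReal_one, one_smul, flowSection_eq]
    have e3 : phi μ D a (p ξ) m = flowMap (μ := μ) D.toUnitaryConnection X (p ξ) m := by
      refine h3.trans ?_
      rw [chartBump_eq_one_of_mem hm, Complex.ofReal_one, one_smul, flowSection_eq]
    rw [hcomm, e3, e2, flowMap, flowMap, map_smul, h5 h0 hfm, h4 h0 hfm] at h1'
    have hne : ((√(flowDensity X μ m).toReal : ℝ) : ℂ) ≠ 0 := by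
      rw [Complex.ofReal_ne_zero]
      exact (Real.sqrt_pos.mpr (ENNReal.toReal_pos h0 h6.ne)).ne'
    exact (smul_right_injective Fibre hne h1').symm
  filter_upwards [ae_all_iff.mpr hi] with m hm hm1 hm2 hm3
  exact endFibre_ext fun i => hm i hm1 hm2 hm3

/-- A projection in the commutant is, near a point, the multiplication by a continuous field of
projections that commutes with the transports along coordinate segments. -/
theorem exists_chartField (hμ : IsSmoothPositiveMeasure n M μ) {D : SU2Connection n M}
    {p : L2 μ →L[ℂ] L2 μ} (hpp : IsStarProjection p)
    (hp : ∀ a : HD n μ, p * phi μ D a = phi μ D a * p) (p₀ : M) :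
    ∃ Q : EuclideanSpace ℝ (Fin n) → EndFibre, Continuous Q ∧ (∀ x, IsStarProjection (Q x)) ∧
      (∀ ξ : L2 μ, ∀ᵐ m ∂μ, m ∈ (extChartAt (𝓡 n) p₀).source →
        extChartAt (𝓡 n) p₀ m ∈ smallBall n p₀ → p ξ m = Q (extChartAt (𝓡 n) p₀ m) (ξ m)) ∧
      ∀ x ∈ smallBall n p₀, ∀ y ∈ smallBall n p₀,
        Q x * chartTransport D.toUnitaryConnection p₀ x y =
          chartTransport D.toUnitaryConnection p₀ x y * Q y := by
  classical
  have := hμ.isLocallyFiniteMeasure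
  obtain ⟨P, hPm, hPproj, hP⟩ := exists_localField hpp hp p₀
  set φ := extChartAt (𝓡 n) p₀ with hφ
  have hnhd : ∀ y ∈ smallBall n p₀, φ.symm y ∈ chartNhd n p₀ := fun y hy =>
    ⟨φ.map_target (smallBall_subset_target p₀ hy), by
      rw [mem_preimage, φ.right_inv (smallBall_subset_target p₀ hy)]
      exact smallBall_subset_chartBall p₀ hy⟩
  -- a measurable extension of the inverse of the chart
  set σ : EuclideanSpace ℝ (Fin n) → M := (smallBall n p₀).piecewise φ.symm (fun _ => p₀) with hσ
  have hσm : Measurable σ := ContinuousOn.measurable_piecewise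
    ((continuousOn_extChartAt_symm p₀).mono (smallBall_subset_target p₀)) continuousOn_const
    (isOpen_smallBall p₀).measurableSet
  have hσe : ∀ y ∈ smallBall n p₀, σ y = φ.symm y := fun y hy => piecewise_eq_of_mem _ _ _ hy
  have hproj : ∀ᵐ y, y ∈ smallBall n p₀ → IsStarProjection (P (σ y)) := by
    have h1 : ∀ᵐ m ∂μ, m ∈ φ.source → m ∈ chartNhd n p₀ → IsStarProjection (P m) := by
      filter_upwards [hPproj] with m hm _ hm2 using hm hm2
    filter_upwards [(hμ.ae_chart_iff p₀).mp h1] with y hy hyS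
    rw [hσe y hyS]
    exact hy (smallBall_subset_target p₀ hyS) (hnhd y hyS)
  have hint : ∀ v, ∀ᵐ y, y ∈ smallBall n p₀ → y + v ∈ smallBall n p₀ →
      P (σ y) * chartTransport D.toUnitaryConnection p₀ y (y + v) =
        chartTransport D.toUnitaryConnection p₀ y (y + v) * P (σ (y + v)) := by
    intro v
    have h1 := localField_mul_flowTransport hp hP (chartVectorField p₀ v)
    have h2 : ∀ᵐ m ∂μ, m ∈ φ.source → _ := h1.mono fun m hm _ => hm
    filter_upwards [(hμ.ae_chart_iff p₀).mp h2, flowDensity_chartVectorField_ne_zero hμ p₀ v]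
      with y hy hd hyS hyv
    have hflow := flow_chartVectorField hyS hyv (s := 1) (by norm_num)
    rw [one_smul] at hflow
    have h3 := hy (smallBall_subset_target p₀ hyS) (hnhd y hyS) (by
      rw [hflow]
      exact hnhd _ hyv) (hd hyS hyv)
    rw [hflow, flowTransport_chartVectorField _ hyS hyv] at h3
    rw [hσe y hyS, hσe _ hyv]
    exact h3
  obtain ⟨Q, hQc, hQp, hPQ, hQ⟩ := exists_continuous_of_ae_intertwine (S := smallBall n p₀)
    (h := chartTransport D.toUnitaryConnection p₀) (P := fun y => P (σ y))
    (isOpen_smallBall p₀) ⟨_, center_mem_smallBall p₀⟩ (continuous_chartTransport _ p₀)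
    (star_chartTransport_mul_self _ p₀) (chartTransport_mul_star_self _ p₀)
    (hPm.comp_measurable hσm) hproj hint
  refine ⟨Q, hQc, hQp, fun ξ => ?_, hQ⟩
  have h1 : ∀ᵐ m ∂μ, m ∈ φ.source → φ m ∈ smallBall n p₀ → P m = Q (φ m) := by
    rw [hμ.ae_chart_iff p₀]
    filter_upwards [hPQ] with y hy hyt hyS
    rw [φ.right_inv hyt] at hyS ⊢
    rw [← hσe y hyS, hy hyS]
  filter_upwards [h1, hP ξ] with m hm1 hm2 hms hmS
  rw [hm2 ⟨hms, smallBall_subset_chartBall p₀ hmS⟩, hm1 hms hmS]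

/-- A projection in the commutant of `φ_∇` is the multiplication by a parallel field of
projections. -/
theorem exists_isParallelField_of_commute (hμ : IsSmoothPositiveMeasure n M μ)
    {D : SU2Connection n M} {p : L2 μ →L[ℂ] L2 μ} (hpp : IsStarProjection p)
    (hp : ∀ a : HD n μ, p * phi μ D a = phi μ D a * p) :
    ∃ Q : M → EndFibre, IsParallelField D.toUnitaryConnection Q ∧
      ∀ ξ : L2 μ, ∀ᵐ m ∂μ, p ξ m = Q m (ξ m) := by
  have := hμ.isLocallyFiniteMeasure
  have := hμ.isOpenPosMeasure
  choose Q hQc hQp hQ hQt using exists_chartField hμ hpp hp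
  let N : M → Set M := fun x =>
    (extChartAt (𝓡 n) x).source ∩ extChartAt (𝓡 n) x ⁻¹' smallBall n x
  have hNo : ∀ x, IsOpen (N x) := fun x => (continuousOn_extChartAt x).isOpen_inter_preimage
    (isOpen_extChartAt_source x) (isOpen_smallBall x)
  have hNx : ∀ x, x ∈ N x := fun x => ⟨mem_extChartAt_source x, center_mem_smallBall x⟩
  have hcont : ∀ x i, ContinuousOn (fun m => Q x (extChartAt (𝓡 n) x m) (stdVec i)) (N x) :=
    fun x i => (((hQc x).comp_continuousOn (continuousOn_extChartAt x)).clm_apply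
      continuousOn_const).mono inter_subset_left
  -- the local fields agree almost everywhere on the overlaps, hence everywhere by continuity
  have hcons : ∀ x m, m ∈ N x →
      Q x (extChartAt (𝓡 n) x m) = Q m (extChartAt (𝓡 n) m m) := by
    intro x m hm
    refine endFibre_ext fun i => ?_
    have hopen := (hNo x).inter (hNo m)
    refine Measure.eqOn_open_of_ae_eq (μ := μ)
      (f := fun z => Q x (extChartAt (𝓡 n) x z) (stdVec i))
      (g := fun z => Q m (extChartAt (𝓡 n) m z) (stdVec i)) (U := N x ∩ N m) ?_ hopen
      ((hcont x i).mono inter_subset_left) ((hcont m i).mono inter_subset_right) ⟨hm, hNx m⟩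
    refine (ae_restrict_iff' hopen.measurableSet).mpr ?_
    filter_upwards [hQ x (cutoff n μ m (stdVec i)), hQ m (cutoff n μ m (stdVec i)),
      cutoff_eq_of_mem (n := n) (μ := μ) m (stdVec i)] with z h1 h2 h3 hz
    rw [← h3 ⟨hz.2.1, smallBall_subset_chartBall m hz.2.2⟩, ← h1 hz.1.1 hz.1.2,
      ← h2 hz.2.1 hz.2.2]
  refine ⟨fun m => Q m (extChartAt (𝓡 n) m m), ?_, fun ξ => ?_⟩
  · refine isParallelField_of_chartTransport _ (fun m => hQp _ _) fun x =>
      ⟨chartRadius n x / 8, by linarith [chartRadius_pos (n := n) x],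
        by linarith [chartRadius_pos (n := n) x], fun y hy z hz => ?_⟩
    have key : ∀ y ∈ smallBall n x, Q ((extChartAt (𝓡 n) x).symm y)
        (extChartAt (𝓡 n) ((extChartAt (𝓡 n) x).symm y) ((extChartAt (𝓡 n) x).symm y)) =
          Q x y := by
      intro y hy
      have hyt := smallBall_subset_target x hy
      rw [← hcons x _ ⟨(extChartAt (𝓡 n) x).map_target hyt, by
        rwa [mem_preimage, (extChartAt (𝓡 n) x).right_inv hyt]⟩,
        (extChartAt (𝓡 n) x).right_inv hyt]
    rw [key y hy, key z hz]
    exact hQt x y hy z hz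
  · rw [ae_iff]
    refine measure_null_of_locally_null _ fun x _ =>
      ⟨_, inter_mem_nhdsWithin _ ((hNo x).mem_nhds (hNx x)), ?_⟩
    refine measure_mono_null (fun m hm => ?_) (ae_iff.mp (hQ x ξ))
    intro hcon
    refine hm.1 ?_
    change p ξ m = Q m (extChartAt (𝓡 n) m m) (ξ m)
    rw [← hcons x m hm.2]
    exact hcon hm.2.1 hm.2.2

/-- Every closed invariant subspace of `φ_∇` consists of the square integrable sections of a
parallel subbundle. -/
theorem exists_isParallelField_of_invariant (hμ : IsSmoothPositiveMeasure n M μ)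
    {D : SU2Connection n M} {K : Submodule ℂ (L2 μ)} (hK : IsClosed (K : Set (L2 μ)))
    (hinv : ∀ a : HD n μ, ∀ ξ ∈ K, phi μ D a ξ ∈ K) :
    ∃ (Q : M → EndFibre) (hQ : IsParallelField D.toUnitaryConnection Q),
      K = L2Sections μ hQ.subbundle := by
  have : CompleteSpace K := hK.completeSpace_coe
  obtain ⟨Q, hQ, hpQ⟩ := exists_isParallelField_of_commute hμ (D := D) (p := K.starProjection)
    isStarProjection_starProjection fun a => by
      ext1 ξ
      refine starProjection_apply_comm K (hinv a) (fun η hη => ?_) ξ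
      rw [← map_star]
      exact hinv (star a) η hη
  refine ⟨Q, hQ, ?_⟩
  ext ξ
  rw [← Submodule.starProjection_eq_self_iff]
  constructor
  · intro h
    change ∀ᵐ m ∂μ, Q m (ξ m) = ξ m
    filter_upwards [hpQ ξ] with m hm
    rw [← hm, h]
  · intro h
    have h' : ∀ᵐ m ∂μ, Q m (ξ m) = ξ m := h
    ext1
    filter_upwards [hpQ ξ, h'] with m hm hm2
    rw [hm, hm2]

end Parallel


/-! ### Projections in the fibre -/

theorem eq_zero_of_isStarProjection_of_norm_lt {R : Type*} [NormedRing R] [StarRing R]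
    [CStarRing R] {P : R} (hP : IsStarProjection P)
    (h : ‖P‖ < 1) : P = 0 := by
  have h1 : ‖star P * P‖ = ‖P‖ * ‖P‖ := CStarRing.norm_star_mul_self
  rw [hP.isSelfAdjoint.star_eq, hP.isIdempotentElem.eq] at h1
  by_contra h0
  have : ‖P‖ = 1 := (mul_right_cancel₀ (norm_ne_zero_iff.mpr h0) (by rw [one_mul, ← h1])).symm
  exact h.ne this

/-- A continuous field of projections on a connected space that vanishes at a point vanishes
everywhere, since a projection of norm less than `1` is `0`. -/
theorem eq_zero_of_continuous_isStarProjection {X : Type*} [TopologicalSpace X] [ConnectedSpace X]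
    {R : X → EndFibre} (hc : Continuous R) (hR : ∀ x, IsStarProjection (R x)) {m : X}
    (h0 : R m = 0) (x : X) : R x = 0 := by
  have hclopen : IsClopen {x | R x = 0} := by
    refine ⟨isClosed_eq hc continuous_const, ?_⟩
    have : {x | R x = 0} = {x | ‖R x‖ < 1} := by
      ext x
      constructor
      · intro (h : R x = 0)
        change ‖R x‖ < 1
        rw [h, norm_zero]
        exact one_pos
      · exact fun h => eq_zero_of_isStarProjection_of_norm_lt (hR x) h
    rw [this]
    exact isOpen_lt hc.norm continuous_const
  have huniv := hclopen.eq_univ ⟨m, h0⟩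
  have : x ∈ {x | R x = 0} := by
    rw [huniv]
    exact mem_univ x
  exact this

theorem apply_eq_self_of_mem_range {P : EndFibre} (hP : IsStarProjection P) {v : Fibre}
    (hv : v ∈ P.range) : P v = v := by
  obtain ⟨w, rfl⟩ := hv
  exact congrArg (fun T : EndFibre => T w) hP.isIdempotentElem

theorem eq_zero_of_range_eq_bot {P : EndFibre} (h : P.range = ⊥) : P = 0 := by
  ext1 v
  have : P v ∈ P.range := ⟨v, rfl⟩
  rw [h] at this
  exact (Submodule.mem_bot ℂ).mp this

theorem eq_one_of_range_eq_top {P : EndFibre} (hP : IsStarProjection P) (h : P.range = ⊤) :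
    P = 1 := by
  ext1 v
  exact apply_eq_self_of_mem_range hP (h ▸ Submodule.mem_top)

theorem finrank_range_eq_one {P : EndFibre} (hP : IsStarProjection P) (h0 : P ≠ 0) (h1 : P ≠ 1) :
    Module.finrank ℂ P.range = 1 := by
  have hlt := Submodule.finrank_lt (K := ℂ) (s := P.range) fun h =>
    h1 (eq_one_of_range_eq_top hP h)
  have hpos := (Submodule.one_le_finrank_iff (S := P.range)).mpr fun h =>
    h0 (eq_zero_of_range_eq_bot h)
  rw [finrank_euclideanSpace_fin] at hlt
  omega

/-- A nonzero projection below a projection of rank one is equal to it. -/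
theorem eq_of_mul_eq_of_finrank_eq_one {P P' : EndFibre} (hP : IsStarProjection P)
    (hP' : IsStarProjection P') (h : P * P' = P') (h1 : Module.finrank ℂ P.range = 1)
    (h0 : P' ≠ 0) : P' = P := by
  have hle : P'.range ≤ P.range := by
    rintro _ ⟨v, rfl⟩
    exact ⟨P' v, congrArg (fun T : EndFibre => T v) h⟩
  have hpos := (Submodule.one_le_finrank_iff (S := P'.range)).mpr fun h =>
    h0 (eq_zero_of_range_eq_bot h)
  have heq : P'.range = P.range := Submodule.eq_of_le_of_finrank_le hle (by rw [h1]; exact hpos)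
  have h2 : P' * P = P := by
    ext1 v
    have : P v ∈ P'.range := heq ▸ ⟨v, rfl⟩
    exact apply_eq_self_of_mem_range hP' this
  have h3 := congrArg star h2
  rw [star_mul, hP.isSelfAdjoint.star_eq, hP'.isSelfAdjoint.star_eq, h] at h3
  exact h3

theorem isStarProjection_sub {R : Type*} [Ring R] [StarRing R] {P P' : R} (hP : IsStarProjection P)
    (hP' : IsStarProjection P') (h : P * P' = P') : IsStarProjection (P - P') := by
  have h3 := congrArg star h
  rw [star_mul, hP.isSelfAdjoint.star_eq, hP'.isSelfAdjoint.star_eq] at h3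
  refine ⟨?_, hP.isSelfAdjoint.sub hP'.isSelfAdjoint⟩
  have e1 : P * P = P := hP.isIdempotentElem
  have e2 : P' * P' = P' := hP'.isIdempotentElem
  change (P - P') * (P - P') = P - P'
  rw [sub_mul, mul_sub, mul_sub, e1, e2, h, h3, sub_self, sub_zero]

/-! ### Irreducibility -/

section Irreducibility

variable {n : ℕ} {M : Type*} [TopologicalSpace M] [ChartedSpace (EuclideanSpace ℝ (Fin n)) M]
  [IsManifold (𝓡 n) ∞ M] [T2Space M] [SecondCountableTopology M] [MeasurableSpace M] [BorelSpace M]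
  {μ : Measure M}

/-- Every vector of a subbundle is the value of a square integrable section that is continuous
nearby, so that relations between continuous fields can be tested on square integrable sections. -/
theorem mul_proj_eq_zero (hμ : IsSmoothPositiveMeasure n M μ) {A : M → EndFibre}
    (hA : Continuous A) (L : Subbundle n M)
    (h : ∀ ζ ∈ L2Sections μ L, ∀ᵐ m ∂μ, A m (ζ m) = 0) (x : M) : A x * L.proj x = 0 := by
  have := hμ.isLocallyFiniteMeasure
  have := hμ.isOpenPosMeasure
  refine endFibre_ext fun i => ?_
  obtain ⟨ζ, hζ⟩ := exists_coeFn_eq_proj L (cutoff n μ x (stdVec i))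
  have hζL : ζ ∈ L2Sections μ L := by
    change ∀ᵐ m ∂μ, L.proj m (ζ m) = ζ m
    filter_upwards [hζ] with m hm
    rw [hm]
    exact congrArg (fun T : EndFibre => T _) (L.isStarProjection m).isIdempotentElem
  have hopen := isOpen_chartNhd (n := n) x
  have hx : x ∈ chartNhd n x := ⟨mem_extChartAt_source x, center_mem_chartBall x⟩
  refine Measure.eqOn_open_of_ae_eq (μ := μ) (f := fun m => A m (L.proj m (stdVec i)))
    (g := fun _ => 0) ?_ hopen (hA.clm_apply
      (L.smooth.continuous.clm_apply continuous_const)).continuousOn continuousOn_const hx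
  refine (ae_restrict_iff' hopen.measurableSet).mpr ?_
  filter_upwards [hζ, h ζ hζL, cutoff_eq_of_mem (n := n) (μ := μ) x (stdVec i)] with m h1 h2 h3 hm
  rw [h1, h3 hm] at h2
  exact h2

theorem proj_eq_zero_of_L2Sections_eq_bot (hμ : IsSmoothPositiveMeasure n M μ) {L : Subbundle n M}
    (h : L2Sections μ L = ⊥) (x : M) : L.proj x = 0 := by
  have := mul_proj_eq_zero hμ (A := fun _ => 1) continuous_const L (fun ζ hζ => by
    rw [h, Submodule.mem_bot] at hζ
    subst hζ
    exact Lp.coeFn_zero Fibre 2 μ) x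
  rwa [one_mul] at this

theorem proj_mul_proj_of_L2Sections_le (hμ : IsSmoothPositiveMeasure n M μ) {L L' : Subbundle n M}
    (h : L2Sections μ L ≤ L2Sections μ L') (x : M) : L'.proj x * L.proj x = L.proj x := by
  have := mul_proj_eq_zero hμ (A := fun m => 1 - L'.proj m)
    (continuous_const.sub L'.smooth.continuous) L (fun ζ hζ => by
      have h1 : ∀ᵐ m ∂μ, L'.proj m (ζ m) = ζ m := h hζ
      filter_upwards [h1] with m hm
      change ζ m - L'.proj m (ζ m) = 0
      rw [hm, sub_self]) x
  rw [sub_mul, one_mul, sub_eq_zero] at this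
  exact this.symm

theorem L2Sections_eq_bot {L : Subbundle n M} (h : ∀ x, L.proj x = 0) : L2Sections μ L = ⊥ := by
  rw [Submodule.eq_bot_iff]
  intro ξ hξ
  have hξ' : ∀ᵐ m ∂μ, L.proj m (ξ m) = ξ m := hξ
  ext1
  filter_upwards [hξ', Lp.coeFn_zero Fibre 2 μ] with m hm h0
  rw [← hm, h m, h0]
  rfl

theorem L2Sections_eq_top {L : Subbundle n M} (h : ∀ x, L.proj x = 1) : L2Sections μ L = ⊤ := by
  rw [Submodule.eq_top_iff']
  intro ξ
  change ∀ᵐ m ∂μ, L.proj m (ξ m) = ξ m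
  exact Filter.Eventually.of_forall fun m => by rw [h m]; rfl

namespace IsParallelField

variable [ConnectedSpace M] {D : SU2Connection n M} {Q : M → EndFibre}

theorem eq_zero (hQ : IsParallelField D.toUnitaryConnection Q) {m : M} (h : Q m = 0) (x : M) :
    Q x = 0 :=
  eq_zero_of_continuous_isStarProjection hQ.smooth.continuous hQ.isStarProjection h x

theorem eq_one (hQ : IsParallelField D.toUnitaryConnection Q) {m : M} (h : Q m = 1) (x : M) :
    Q x = 1 := by
  have := hQ.one_sub.eq_zero (m := m) (by rw [h, sub_self]) x
  exact (sub_eq_zero.mp this).symm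

theorem finrank_range (hQ : IsParallelField D.toUnitaryConnection Q) {m : M} (h0 : Q m ≠ 0)
    (h1 : Q m ≠ 1) (x : M) : Module.finrank ℂ (Q x).range = 1 :=
  finrank_range_eq_one (hQ.isStarProjection x) (fun h => h0 (hQ.eq_zero h m))
    (fun h => h1 (hQ.eq_one h m))

theorem isLineBundle (hQ : IsParallelField D.toUnitaryConnection Q) {m : M} (h0 : Q m ≠ 0)
    (h1 : Q m ≠ 1) : hQ.subbundle.IsLineBundle := hQ.finrank_range h0 h1

/-- The representation on the sections of a parallel line bundle is irreducible: an invariant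
subspace comes from a parallel field below the line bundle. -/
theorem isIrreducibleRep_rep (hμ : IsSmoothPositiveMeasure n M μ)
    (hQ : IsParallelField D.toUnitaryConnection Q) {m : M} (h0 : Q m ≠ 0) (h1 : Q m ≠ 1) :
    IsIrreducibleRep (hQ.rep (μ := μ)) := by
  constructor
  · rw [Submodule.nontrivial_iff_ne_bot]
    exact fun h => h0 (proj_eq_zero_of_L2Sections_eq_bot hμ h m)
  · intro K' hK' hinv
    have hclosed : IsClosed ((K'.map (L2Sections μ hQ.subbundle).subtype : Submodule ℂ (L2 μ)) :
        Set (L2 μ)) := by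
      rw [Submodule.map_coe]
      exact (isClosed_L2Sections μ hQ.subbundle).isClosedEmbedding_subtypeVal.isClosedMap _ hK'
    have hKinv : ∀ a : HD n μ, ∀ ξ ∈ K'.map (L2Sections μ hQ.subbundle).subtype,
        phi μ D a ξ ∈ K'.map (L2Sections μ hQ.subbundle).subtype := by
      rintro a _ ⟨ξ, hξ, rfl⟩
      exact ⟨hQ.rep a ξ, hinv _ ⟨a, rfl⟩ ξ hξ, rfl⟩
    obtain ⟨Q', hQ', hKQ⟩ := exists_isParallelField_of_invariant hμ hclosed hKinv
    have hle : L2Sections μ hQ'.subbundle ≤ L2Sections μ hQ.subbundle := by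
      rw [← hKQ]
      exact Submodule.map_subtype_le _ K'
    have hmul : ∀ x, Q x * Q' x = Q' x := proj_mul_proj_of_L2Sections_le hμ hle
    by_cases hm : Q' m = 0
    · left
      have hbot : L2Sections μ hQ'.subbundle = ⊥ := L2Sections_eq_bot (hQ'.eq_zero hm)
      exact Submodule.map_injective_of_injective
        (L2Sections μ hQ.subbundle).injective_subtype (hKQ.trans (hbot.trans
          (Submodule.map_bot _).symm))
    · right
      have heq := eq_of_mul_eq_of_finrank_eq_one (hQ.isStarProjection m) (hQ'.isStarProjection m)
        (hmul m) (hQ.finrank_range h0 h1 m) hm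
      have hQQ : Q' = Q := funext fun x => (sub_eq_zero.mp
        (eq_zero_of_continuous_isStarProjection (R := fun x => Q x - Q' x)
          (hQ.smooth.continuous.sub hQ'.smooth.continuous)
          (fun x => isStarProjection_sub (hQ.isStarProjection x) (hQ'.isStarProjection x) (hmul x))
          (m := m) (by rw [heq, sub_self]) x)).symm
      subst hQQ
      rw [Submodule.eq_top_iff']
      intro ξ
      have : (ξ : L2 μ) ∈ K'.map (L2Sections μ hQ.subbundle).subtype := by
        rw [hKQ]
        exact ξ.2
      obtain ⟨η, hη, hηξ⟩ := this
      exact Subtype.ext hηξ ▸ hη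

end IsParallelField

variable [ConnectedSpace M]

/-- The fibre at `m` of a parallel field is invariant under the holonomy group. -/
theorem IsParallelField.holonomyGroup_mem {D : SU2Connection n M} {Q : M → EndFibre}
    (hQ : IsParallelField D.toUnitaryConnection Q) {m : M} {g : Fibre → Fibre}
    (hg : g ∈ D.holonomyGroup m) {v : Fibre} (hv : v ∈ (Q m).range) : g v ∈ (Q m).range := by
  obtain ⟨c, hc, h0, h1, rfl⟩ := hg
  obtain ⟨s, hs⟩ := hc.exists_mdifferentiableAt
  have h := hQ.hol_mem hc.1 hs (v := v) (by
    rw [h0]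
    exact apply_eq_self_of_mem_range (hQ.isStarProjection m) hv)
  rw [h1] at h
  exact ⟨_, h⟩

theorem isIrreducibleRep_phi_of_isIrreducibleAt (hμ : IsSmoothPositiveMeasure n M μ)
    {D : SU2Connection n M} {m : M} (h : D.IsIrreducibleAt m) : IsIrreducibleRep (phi μ D) := by
  constructor
  · by_contra hcon
    have hsub : Subsingleton (L2 μ) := not_nontrivial_iff_subsingleton.mp hcon
    have := proj_eq_zero_of_L2Sections_eq_bot hμ (L := trivialBundle n M)
      (Submodule.eq_bot_of_subsingleton) m
    exact one_ne_zero (α := EndFibre) this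
  · intro K hK hinv
    obtain ⟨Q, hQ, rfl⟩ := exists_isParallelField_of_invariant hμ hK
      fun a ξ hξ => hinv _ ⟨a, rfl⟩ ξ hξ
    rcases h.2 (Q m).range (Submodule.closed_of_finiteDimensional _)
      (fun g hg v hv => hQ.holonomyGroup_mem hg hv) with h0 | h1
    · exact Or.inl (L2Sections_eq_bot (hQ.eq_zero (eq_zero_of_range_eq_bot h0)))
    · exact Or.inr (L2Sections_eq_top
        (hQ.eq_one (eq_one_of_range_eq_top (hQ.isStarProjection m) h1)))

/-- A reducible connection has a parallel field of projections other than `0` and `1`. -/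
theorem exists_isParallelField_of_not_isIrreducibleAt {D : SU2Connection n M} {m : M}
    (h : ¬ D.IsIrreducibleAt m) :
    ∃ Q : M → EndFibre, IsParallelField D.toUnitaryConnection Q ∧ Q m ≠ 0 ∧ Q m ≠ 1 := by
  have hex : ∃ W : Submodule ℂ Fibre, (∀ g ∈ D.holonomyGroup m, ∀ x ∈ W, g x ∈ W) ∧
      W ≠ ⊥ ∧ W ≠ ⊤ := by
    by_contra! hcon
    exact h ⟨inferInstance, fun K _ hK => or_iff_not_imp_left.mpr (hcon K hK)⟩
  obtain ⟨W, hW, hbot, htop⟩ := hex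
  obtain ⟨Q, hQ, hQm⟩ := exists_isParallelField D m W hW
  refine ⟨Q, hQ, fun h0 => hbot ?_, fun h1 => htop ?_⟩
  · rw [Submodule.eq_bot_iff]
    intro x hx
    have := Submodule.starProjection_eq_self_iff.mpr hx
    rw [← hQm, h0] at this
    exact this.symm
  · rw [Submodule.eq_top_iff']
    intro x
    refine Submodule.starProjection_eq_self_iff.mp ?_
    rw [← hQm, h1]
    rfl

theorem isIrreducibleAt_of_isIrreducibleRep_phi (hμ : IsSmoothPositiveMeasure n M μ)
    {D : SU2Connection n M} {m : M} (h : IsIrreducibleRep (phi μ D)) : D.IsIrreducibleAt m := by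
  by_contra hcon
  obtain ⟨Q, hQ, h0, h1⟩ := exists_isParallelField_of_not_isIrreducibleAt hcon
  rcases h.2 (L2Sections μ hQ.subbundle) (isClosed_L2Sections μ _)
    (by rintro _ ⟨a, rfl⟩ ξ hξ; exact hQ.phi_mem a hξ) with hb | ht
  · exact h0 (proj_eq_zero_of_L2Sections_eq_bot hμ hb m)
  · have hperp := orthogonal_L2Sections (μ := μ) hQ.subbundle_add
    rw [ht, Submodule.top_orthogonal_eq_bot] at hperp
    have := proj_eq_zero_of_L2Sections_eq_bot hμ hperp.symm m
    exact h1 (sub_eq_zero.mp this).symm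

end Irreducibility

end HolDiff

end

theorem mainTheorem5 (n : ℕ) (M : Type*) [TopologicalSpace M]
    [ChartedSpace (EuclideanSpace ℝ (Fin n)) M] [IsManifold (𝓡 n) ∞ M] [T2Space M]
    [SecondCountableTopology M] [ConnectedSpace M] [MeasurableSpace M] [BorelSpace M]
    (μ : Measure M) (hμ : HolDiff.IsSmoothPositiveMeasure n M μ)
    (D : HolDiff.SU2Connection n M) (m : M) :
    (HolDiff.IsIrreducibleRep (HolDiff.phi μ D) ↔ D.IsIrreducibleAt m) ∧
    (¬ D.IsIrreducibleAt m →
      ∃ (L₁ L₂ : HolDiff.Subbundle n M)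
        (D₁ : HolDiff.UnitaryConnection L₁) (D₂ : HolDiff.UnitaryConnection L₂)
        (π₁ : HolDiff.HD n μ →⋆ₙₐ[ℂ] (HolDiff.L2Sections μ L₁ →L[ℂ] HolDiff.L2Sections μ L₁))
        (π₂ : HolDiff.HD n μ →⋆ₙₐ[ℂ] (HolDiff.L2Sections μ L₂ →L[ℂ] HolDiff.L2Sections μ L₂)),
        L₁.IsLineBundle ∧ L₂.IsLineBundle ∧ (∀ x, L₁.proj x + L₂.proj x = 1) ∧
        HolDiff.IsRepOfConnection μ D₁ π₁ ∧ HolDiff.IsRepOfConnection μ D₂ π₂ ∧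
        HolDiff.IsIrreducibleRep π₁ ∧ HolDiff.IsIrreducibleRep π₂ ∧
        (HolDiff.L2Sections μ L₁)ᗮ = HolDiff.L2Sections μ L₂ ∧
        ∀ (a : HolDiff.HD n μ) (ξ₁ : HolDiff.L2Sections μ L₁) (ξ₂ : HolDiff.L2Sections μ L₂),
          HolDiff.phi μ D a ((ξ₁ : HolDiff.L2 μ) + ξ₂) =
            (π₁ a ξ₁ : HolDiff.L2 μ) + π₂ a ξ₂) := by
  refine ⟨⟨HolDiff.isIrreducibleAt_of_isIrreducibleRep_phi hμ,
    HolDiff.isIrreducibleRep_phi_of_isIrreducibleAt hμ⟩, fun h => ?_⟩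
  obtain ⟨Q, hQ, h0, h1⟩ := HolDiff.exists_isParallelField_of_not_isIrreducibleAt h
  have h0' : 1 - Q m ≠ 0 := fun h => h1 (sub_eq_zero.mp h).symm
  have h1' : 1 - Q m ≠ 1 := fun h => h0 (sub_eq_self.mp h)
  refine ⟨hQ.subbundle, hQ.one_sub.subbundle, hQ.connection, hQ.one_sub.connection, hQ.rep,
    hQ.one_sub.rep, hQ.isLineBundle h0 h1, hQ.one_sub.isLineBundle h0' h1', hQ.subbundle_add,
    hQ.isRepOfConnection_rep, hQ.one_sub.isRepOfConnection_rep, hQ.isIrreducibleRep_rep hμ h0 h1,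
    hQ.one_sub.isIrreducibleRep_rep hμ h0' h1', HolDiff.orthogonal_L2Sections hQ.subbundle_add,
    fun a ξ₁ ξ₂ => ?_⟩
  exact map_add (HolDiff.phi μ D a) (ξ₁ : HolDiff.L2 μ) ξ₂
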